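/- Let $K$ be a field of characteristic $0$ and let $\mathcal{M}$ be a $K$-linear rigid tensor category: $\mathcal M$ is additive, idempotent complete and $K$-linear, with a symmetric monoidal structure whose tensor product is $K$-bilinear, every object has a dual, and $K=\operatorname{End}_{\mathcal M}(\mathbf 1)$. For an object $M$ let $\chi(M)=\operatorname{tr}(1_M)\in K$, and let $\Lambda^n(M)$ and $S^n(M)$ be the images of the antisymmetrizer $\frac1{n!}\sum_{\sigma}\operatorname{sgn}(\sigma)\sigma$ and the symmetrizer $\frac1{n!}\sum_\sigma\sigma$ on $M^{\otimes n}$. Call $M$ positive (resp. negative) if $\Lambda^N(M)=0$ (resp. $S^N(M)=0$) for some $N>0$, and finite-dimensional if $M\simeq M^+\oplus M^-$ with $M^+$ positive and $M^-$ negative; then put $$\det(M)=\Lambda^{\chi(M^+)}(M^+)\otimes \bigl(S^{-\chi(M^-)}(M^-)\bigr)^{-1},$$ where the inverse $L^{-1}$ of an invertible object $L$ is its dual (here $\chi(M^+)$ and $-\chi(M^-)$ are natural numbers). Let $M,N$ be finite-dimensional objects of $\mathcal M$. Then $\chi(M),\chi(N)\in\mathbf Z$; $\det(M)$ and $\det(N)$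 are invertible and, up to isomorphism, independent of the chosen decompositions; the objects $M\oplus N$, $M\otimes N$, $\Lambda^n(M)$, $S^n(M)$ ($n\ge 0$) are finite-dimensional; and there are isomorphisms, whichever decompositions are used to compute the determinants, 1. $\det(M\oplus N)\simeq\det(M)\otimes\det(N)$; 2. $\det(M\otimes N)\simeq\det(M)^{\otimes\chi(N)}\otimes\det(N)^{\otimes\chi(M)}$; 3. for all $n\ge0$, $\det(\Lambda^n(M))\simeq\det(M)^{\otimes r}$ with $r=n\binom{\chi(M)}{n}/\chi(M)\in\mathbf Z$; 4. for all $n\ge0$, $\det(S^n(M))\simeq\det(M)^{\otimes s}$ with $s=n\binom{\chi(M)+n-1}{n}/\chi(M)\in\mathbf Z$. Here binomial coefficients are the polynomials $\binom{X}{n}=X(X-1)\cdots(X-n+1)/n!$, and if $\chi(M)=0$ the quotients in 3 and 4 are the values at $X=0$ of the polynomials $n\binom{X}{n}/X$ and $n\binom{X+n-1}{n}/X$: for $n=0$ one has $r=s=0$, and for $n\ge1$, $r=(-1)^{n-1}$ and $s=1$. -/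

import Mathlib

open CategoryTheory MonoidalCategory Limits

noncomputable section

namespace TensorDet

universe v u

section Action

variable {C : Type u} [Category.{v} C] [MonoidalCategory C] [SymmetricCategory C]

/-- The tensor power `M ⊗ (M ⊗ (⋯ ⊗ 𝟙))` with `n` factors `M`. -/
def tensorPow (M : C) : ℕ → C
  | 0 => 𝟙_ C
  | n + 1 => M ⊗ tensorPow M n

/-- Tensoring an endomorphism of `M^{⊗ n}` on the left with the identity of `M`. -/
def whisk (M : C) (n : ℕ) : End (tensorPow M n) →* End (tensorPow M (n + 1)) where
  toFun f := M ◁ (f : tensorPow M n ⟶ tensorPow M n)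
  map_one' := MonoidalCategory.whiskerLeft_id _ _
  map_mul' f g := MonoidalCategory.whiskerLeft_comp M
    (g : tensorPow M n ⟶ tensorPow M n) (f : tensorPow M n ⟶ tensorPow M n)

/-- The commutativity constraint exchanging the two factors `M` of `M ⊗ (M ⊗ X)`. -/
def swapTwo (M X : C) : M ⊗ (M ⊗ X) ⟶ M ⊗ (M ⊗ X) :=
  (α_ M M X).inv ≫ (β_ M M).hom ▷ X ≫ (α_ M M X).hom

/-- The commutativity constraint exchanging the first two factors of `M^{⊗ (n + 2)}`. -/
def swapFirst (M : C) (n : ℕ) : End (tensorPow M (n + 2)) :=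
  swapTwo M (tensorPow M n)

/-- The endomorphism of `M^{⊗ (n + 1)}` which moves the first factor to position `p` and keeps
the order of the others. Recall that `f * g = g ≫ f` in `End`. -/
def cycleMap (M : C) : (n : ℕ) → Fin (n + 1) → End (tensorPow M (n + 1))
  | 0, _ => 1
  | n + 1, p => Fin.cases 1 (fun q => whisk M (n + 1) (cycleMap M n q) * swapFirst M n) p

/-- The permutation of `{0, …, n}` which fixes `0` and acts as `e` on `{1, …, n}`. -/
def extPerm {n : ℕ} (e : Equiv.Perm (Fin n)) : Equiv.Perm (Fin (n + 1)) :=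
  Equiv.Perm.decomposeFin.symm (0, e)

/-- The permutation of `{0, …, n}` which moves `0` to `p` and keeps the order of the others. -/
def cyclePerm : (n : ℕ) → Fin (n + 1) → Equiv.Perm (Fin (n + 1))
  | 0, _ => 1
  | n + 1, p => Fin.cases 1 (fun q => extPerm (cyclePerm n q) * Equiv.swap 0 1) p

/-- The permutation `e` of `Fin n` such that `σ = cyclePerm n (σ 0) * extPerm e`. -/
def restPerm {n : ℕ} (σ : Equiv.Perm (Fin (n + 1))) : Equiv.Perm (Fin n) :=
  (Equiv.Perm.decomposeFin ((cyclePerm n (σ 0))⁻¹ * σ)).2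

/-- The endomorphism of `M^{⊗ n}` given by a permutation `σ`: the factor in position `i` moves to
position `σ i`. -/
def permMap (M : C) : (n : ℕ) → Equiv.Perm (Fin n) → End (tensorPow M n)
  | 0, _ => 1
  | n + 1, σ => cycleMap M n (σ 0) * whisk M n (permMap M n (restPerm σ))

theorem extPerm_zero {n : ℕ} (e : Equiv.Perm (Fin n)) : extPerm e 0 = 0 := by
  simp [extPerm]

theorem extPerm_succ {n : ℕ} (e : Equiv.Perm (Fin n)) (x : Fin n) :
    extPerm e x.succ = (e x).succ := by
  simp [extPerm]

theorem extPerm_mul {n : ℕ} (e f : Equiv.Perm (Fin n)) :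
    extPerm (e * f) = extPerm e * extPerm f := by
  ext x
  refine Fin.cases ?_ (fun y => ?_) x <;> simp [extPerm_zero, extPerm_succ]

theorem extPerm_one {n : ℕ} : extPerm (1 : Equiv.Perm (Fin n)) = 1 := by
  ext x
  refine Fin.cases ?_ (fun y => ?_) x <;> simp [extPerm_zero, extPerm_succ]

theorem extPerm_swap {n : ℕ} (x y : Fin n) :
    extPerm (Equiv.swap x y) = Equiv.swap x.succ y.succ := by
  ext z
  refine Fin.cases ?_ (fun w => ?_) z
  · rw [extPerm_zero, Equiv.swap_apply_of_ne_of_ne (Fin.succ_ne_zero _).symm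
      (Fin.succ_ne_zero _).symm]
  · rw [extPerm_succ, Equiv.swap_apply_def, Equiv.swap_apply_def]
    simp only [Fin.succ_inj]
    split_ifs <;> rfl

theorem cyclePerm_apply_zero : ∀ (n : ℕ) (p : Fin (n + 1)), cyclePerm n p 0 = p
  | 0, p => by simp [cyclePerm, Fin.eq_zero p]
  | n + 1, p => by
    refine Fin.cases ?_ (fun q => ?_) p
    · simp [cyclePerm]
    · have h : (1 : Fin (n + 2)) = Fin.succ 0 := rfl
      simp only [cyclePerm, Fin.cases_succ, Equiv.Perm.mul_apply, Equiv.swap_apply_left]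
      rw [h, extPerm_succ, cyclePerm_apply_zero n q]

theorem extPerm_of_fix {n : ℕ} (σ : Equiv.Perm (Fin (n + 1))) (h : σ 0 = 0) :
    extPerm (Equiv.Perm.decomposeFin σ).2 = σ := by
  obtain ⟨⟨p, e⟩, rfl⟩ := Equiv.Perm.decomposeFin.symm.surjective σ
  have hp : p = 0 := by simpa using h
  subst hp
  simp [extPerm]

theorem cyclePerm_mul_extPerm_restPerm {n : ℕ} (σ : Equiv.Perm (Fin (n + 1))) :
    cyclePerm n (σ 0) * extPerm (restPerm σ) = σ := by
  rw [restPerm, extPerm_of_fix, mul_inv_cancel_left]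
  rw [Equiv.Perm.mul_apply, Equiv.Perm.inv_eq_iff_eq, cyclePerm_apply_zero]

theorem restPerm_cyclePerm_mul_extPerm {n : ℕ} (p : Fin (n + 1)) (e : Equiv.Perm (Fin n)) :
    restPerm (cyclePerm n p * extPerm e) = e := by
  have h : (cyclePerm n p * extPerm e) 0 = p := by
    rw [Equiv.Perm.mul_apply, extPerm_zero, cyclePerm_apply_zero]
  rw [restPerm, h, inv_mul_cancel_left, extPerm, Equiv.apply_symm_apply]

theorem permMap_cyclePerm_mul_extPerm (M : C) {n : ℕ} (p : Fin (n + 1))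
    (e : Equiv.Perm (Fin n)) :
    permMap M (n + 1) (cyclePerm n p * extPerm e) =
      cycleMap M n p * whisk M n (permMap M n e) := by
  have h : (cyclePerm n p * extPerm e) 0 = p := by
    rw [Equiv.Perm.mul_apply, extPerm_zero, cyclePerm_apply_zero]
  rw [permMap, h, restPerm_cyclePerm_mul_extPerm]

theorem swapTwo_swapTwo (M X : C) : swapTwo M X ≫ swapTwo M X = 𝟙 _ := by
  simp only [swapTwo, Category.assoc, Iso.hom_inv_id_assoc]
  rw [← MonoidalCategory.comp_whiskerRight_assoc, SymmetricCategory.symmetry]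
  simp

theorem swapTwo_naturality (M : C) {X Y : C} (f : X ⟶ Y) :
    (M ◁ M ◁ f) ≫ swapTwo M Y = swapTwo M X ≫ (M ◁ M ◁ f) := by
  simp only [swapTwo, Category.assoc]
  rw [MonoidalCategory.associator_inv_naturality_right_assoc,
    MonoidalCategory.whisker_exchange_assoc, MonoidalCategory.associator_naturality_right]

theorem swapTwo_braid (M X : C) :
    swapTwo M (M ⊗ X) ≫ M ◁ swapTwo M X ≫ swapTwo M (M ⊗ X) =
      M ◁ swapTwo M X ≫ swapTwo M (M ⊗ X) ≫ M ◁ swapTwo M X := by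
  have h := congrArg (fun f => (α_ M M (M ⊗ X)).inv ≫ (α_ (M ⊗ M) M X).inv ≫
    ((α_ M M M).hom ▷ X) ≫ (f ▷ X) ≫ (α_ M (M ⊗ M) X).hom ≫ (M ◁ (α_ M M X).hom))
    (BraidedCategory.yang_baxter M M M)
  simp only [swapTwo]
  refine Eq.trans ?_ (h.trans ?_)
  · simp only [MonoidalCategory.comp_whiskerRight, MonoidalCategory.whiskerLeft_comp,
      Category.assoc]
    monoidal
  · simp only [MonoidalCategory.comp_whiskerRight, MonoidalCategory.whiskerLeft_comp,
      Category.assoc]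
    monoidal

theorem swapFirst_mul_self (M : C) (n : ℕ) : swapFirst M n * swapFirst M n = 1 :=
  swapTwo_swapTwo M (tensorPow M n)

theorem swapFirst_mul_whisk (M : C) (n : ℕ) (f : End (tensorPow M n)) :
    swapFirst M n * whisk M (n + 1) (whisk M n f) =
      whisk M (n + 1) (whisk M n f) * swapFirst M n :=
  swapTwo_naturality M (X := tensorPow M n) (Y := tensorPow M n) f

theorem swapFirst_braid (M : C) (n : ℕ) :
    swapFirst M (n + 1) * whisk M (n + 2) (swapFirst M n) * swapFirst M (n + 1) =
      whisk M (n + 2) (swapFirst M n) * swapFirst M (n + 1) *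
        whisk M (n + 2) (swapFirst M n) :=
  swapTwo_braid M (tensorPow M n)

theorem cycleMap_succ (M : C) (n : ℕ) (q : Fin (n + 1)) :
    cycleMap M (n + 1) q.succ = whisk M (n + 1) (cycleMap M n q) * swapFirst M n := rfl

theorem cycleMap_zero (M : C) (n : ℕ) : cycleMap M n 0 = 1 := by
  cases n <;> rfl

theorem cyclePerm_succ (n : ℕ) (q : Fin (n + 1)) :
    cyclePerm (n + 1) q.succ = extPerm (cyclePerm n q) * Equiv.swap 0 1 := rfl

theorem cyclePerm_zero (n : ℕ) : cyclePerm n 0 = 1 := by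
  cases n <;> rfl

/-- Pairs consisting of an adjacent transposition (or the identity) and the corresponding
endomorphism of `M^{⊗ n}`; used only to show that `permMap` is multiplicative. -/
inductive IsGen (M : C) : (n : ℕ) → Equiv.Perm (Fin n) → End (tensorPow M n) → Prop
  | one (n : ℕ) : IsGen M n 1 1
  | first (n : ℕ) : IsGen M (n + 2) (Equiv.swap 0 1) (swapFirst M n)
  | ext (n : ℕ) (e : Equiv.Perm (Fin n)) (x : End (tensorPow M n)) :
      IsGen M n e x → IsGen M (n + 1) (extPerm e) (whisk M n x)

theorem swap_mul_extPerm {n : ℕ} (e : Equiv.Perm (Fin n)) :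
    Equiv.swap 0 1 * extPerm (extPerm e) = extPerm (extPerm e) * Equiv.swap 0 1 := by
  have h1 : (1 : Fin (n + 2)) = Fin.succ 0 := rfl
  ext x
  refine Fin.cases ?_ (fun y => Fin.cases ?_ (fun z => ?_) y) x
  · simp only [Equiv.Perm.mul_apply, extPerm_zero, Equiv.swap_apply_left]
    rw [h1, extPerm_succ, extPerm_zero]
  · simp only [Equiv.Perm.mul_apply, extPerm_zero, extPerm_succ]
    rw [← h1, Equiv.swap_apply_right, extPerm_zero]
  · have h (w : Fin n) : Equiv.swap (0 : Fin (n + 2)) 1 w.succ.succ = w.succ.succ := by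
      rw [h1]
      exact Equiv.swap_apply_of_ne_of_ne (Fin.succ_ne_zero _)
        (fun h => Fin.succ_ne_zero _ (Fin.succ_inj.1 h))
    simp only [Equiv.Perm.mul_apply, extPerm_succ, h]

theorem swap_braid (n : ℕ) :
    Equiv.swap (0 : Fin (n + 3)) 1 * extPerm (Equiv.swap 0 1) * Equiv.swap 0 1 =
      extPerm (Equiv.swap 0 1) * Equiv.swap 0 1 * extPerm (Equiv.swap 0 1) := by
  have h1 : (1 : Fin (n + 3)) = Fin.succ 0 := rfl
  have h2 : Fin.succ (1 : Fin (n + 2)) = 2 := rfl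
  have h3 : (0 : Fin (n + 3)) ≠ 1 := by simp
  have h4 : (0 : Fin (n + 3)) ≠ 2 := (Fin.succ_ne_zero (1 : Fin (n + 2))).symm
  have h5 : (1 : Fin (n + 3)) ≠ 2 := fun h =>
    (Fin.succ_ne_zero (0 : Fin (n + 1))).symm (Fin.succ_injective _ h)
  rw [extPerm_swap, ← h1, h2]
  have hA := Equiv.swap_mul_swap_mul_swap (x := (2 : Fin (n + 3))) (y := 1) (z := 0)
    h5.symm h4.symm
  have hB := Equiv.swap_mul_swap_mul_swap (x := (0 : Fin (n + 3))) (y := 1) (z := 2)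
    h3 h4
  rw [Equiv.swap_comm 1 0, Equiv.swap_comm 2 1] at hA
  rw [hA, hB, Equiv.swap_comm]

theorem IsGen.mul_cycle (M : C) : ∀ (n : ℕ) (e : Equiv.Perm (Fin (n + 1)))
    (x : End (tensorPow M (n + 1))), IsGen M (n + 1) e x → ∀ p : Fin (n + 1),
    ∃ e' x', IsGen M n e' x' ∧ e * cyclePerm n p = cyclePerm n (e p) * extPerm e' ∧
      x * cycleMap M n p = cycleMap M n (e p) * whisk M n x' := by
  intro n
  induction n with
  | zero =>
    intro e x h p
    have hx : x = 1 := by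
      cases h with
      | one => rfl
      | ext _ e x h => cases h; exact map_one _
    have he : e = 1 := by
      ext z
      rw [Fin.eq_zero (e z), Fin.eq_zero ((1 : Equiv.Perm (Fin (0 + 1))) z)]
    subst he
    subst hx
    exact ⟨1, 1, .one _, by rw [extPerm_one, one_mul, mul_one, Equiv.Perm.one_apply],
        by rw [map_one, one_mul, mul_one, Equiv.Perm.one_apply]⟩
  | succ n ih =>
    intro e x h p
    cases h with
    | one => exact ⟨1, 1, .one _, by rw [extPerm_one, one_mul, mul_one, Equiv.Perm.one_apply],
        by rw [map_one, one_mul, mul_one, Equiv.Perm.one_apply]⟩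
    | first =>
      have h1 : (1 : Fin (n + 2)) = Fin.succ 0 := rfl
      refine Fin.cases ?_ (fun q => ?_) p
      · refine ⟨1, 1, .one _, ?_, ?_⟩
        · rw [Equiv.swap_apply_left, h1, cyclePerm_succ]
          simp only [cyclePerm_zero, extPerm_one, one_mul, mul_one, ← h1]
        · rw [Equiv.swap_apply_left, h1, cycleMap_succ]
          simp only [cycleMap_zero, map_one, one_mul, mul_one]
      · cases n with
        | zero =>
          obtain rfl := Fin.eq_zero q
          refine ⟨1, 1, .one _, ?_, ?_⟩
          · rw [← h1, Equiv.swap_apply_right, h1, cyclePerm_succ]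
            simp only [cyclePerm_zero, extPerm_one, one_mul, mul_one, Equiv.swap_mul_self, ← h1]
          · rw [← h1, Equiv.swap_apply_right, h1, cycleMap_succ]
            simp only [cycleMap_zero, map_one, one_mul, mul_one, swapFirst_mul_self]
        | succ n =>
          refine Fin.cases ?_ (fun r => ?_) q
          · refine ⟨1, 1, .one _, ?_, ?_⟩
            · rw [← h1, Equiv.swap_apply_right, h1, cyclePerm_succ]
              simp only [cyclePerm_zero, extPerm_one, one_mul, mul_one, Equiv.swap_mul_self, ← h1]
            · rw [← h1, Equiv.swap_apply_right, h1, cycleMap_succ]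
              simp only [cycleMap_zero, map_one, one_mul, mul_one, swapFirst_mul_self]
          · have h2 : Equiv.swap (0 : Fin (n + 3)) 1 r.succ.succ = r.succ.succ := by
              rw [h1]
              exact Equiv.swap_apply_of_ne_of_ne (Fin.succ_ne_zero _)
                (fun h => Fin.succ_ne_zero _ (Fin.succ_inj.1 h))
            refine ⟨_, _, .first n, ?_, ?_⟩
            · have hb := swap_braid n
              rw [h2, cyclePerm_succ, cyclePerm_succ, extPerm_mul]
              simp only [← mul_assoc, swap_mul_extPerm]
              simp only [mul_assoc] at hb ⊢
              rw [hb]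
            · have hb := swapFirst_braid M n
              rw [h2, cycleMap_succ, cycleMap_succ, map_mul]
              simp only [← mul_assoc, swapFirst_mul_whisk]
              simp only [mul_assoc] at hb ⊢
              rw [hb]
    | ext _ e x h =>
      refine Fin.cases ?_ (fun q => ?_) p
      · exact ⟨e, x, h, by simp [extPerm_zero, cyclePerm_zero],
          by simp only [extPerm_zero, cycleMap_zero, one_mul, mul_one]⟩
      · obtain ⟨e', x', h', he, hx⟩ := ih e x h q
        refine ⟨_, _, .ext _ _ _ h', ?_, ?_⟩
        · rw [extPerm_succ, cyclePerm_succ, cyclePerm_succ, ← mul_assoc, ← extPerm_mul, he,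
            extPerm_mul, mul_assoc, mul_assoc, swap_mul_extPerm]
        · rw [extPerm_succ, cycleMap_succ, cycleMap_succ, ← mul_assoc, ← map_mul, hx,
            map_mul, mul_assoc, mul_assoc, swapFirst_mul_whisk]

theorem IsGen.permMap_mul (M : C) : ∀ (n : ℕ) (e : Equiv.Perm (Fin n))
    (x : End (tensorPow M n)), IsGen M n e x → ∀ τ : Equiv.Perm (Fin n),
    permMap M n (e * τ) = x * permMap M n τ := by
  intro n
  induction n with
  | zero =>
    intro e x h τ
    cases h
    rw [one_mul, one_mul]
  | succ n ih =>
    intro e x h τ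
    obtain ⟨e', x', h', he, hx⟩ := IsGen.mul_cycle M n e x h (τ 0)
    conv_lhs => rw [← cyclePerm_mul_extPerm_restPerm τ, ← mul_assoc, he, mul_assoc,
      ← extPerm_mul, permMap_cyclePerm_mul_extPerm, ih _ _ h', map_mul, ← mul_assoc, ← hx]
    rw [permMap, mul_assoc]

theorem permMap_one (M : C) : ∀ n : ℕ, permMap M n 1 = 1
  | 0 => rfl
  | n + 1 => by
    have h := permMap_cyclePerm_mul_extPerm M (n := n) 0 1
    rwa [cyclePerm_zero, extPerm_one, cycleMap_zero, permMap_one M n, map_one, one_mul,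
      one_mul] at h

theorem isGen_adjacent (M : C) : ∀ (n : ℕ) (i : Fin n),
    ∃ x, IsGen M (n + 1) (Equiv.swap i.castSucc i.succ) x
  | 0, i => i.elim0
  | n + 1, i => by
    refine Fin.cases ?_ (fun j => ?_) i
    · exact ⟨_, .first n⟩
    · obtain ⟨x, hx⟩ := isGen_adjacent M n j
      have h := IsGen.ext _ _ _ hx
      rw [extPerm_swap] at h
      exact ⟨_, h⟩

theorem permMap_mul (M : C) : ∀ (n : ℕ) (σ τ : Equiv.Perm (Fin n)),
    permMap M n (σ * τ) = permMap M n σ * permMap M n τ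
  | 0, _, _ => (one_mul _).symm
  | n + 1, σ, τ => by
    have hσ : σ ∈ Submonoid.closure
        (Set.range fun i : Fin n => Equiv.swap i.castSucc i.succ) := by
      rw [Equiv.Perm.mclosure_swap_castSucc_succ]
      trivial
    induction hσ using Submonoid.closure_induction generalizing τ with
    | mem σ h =>
      obtain ⟨i, rfl⟩ := h
      obtain ⟨x, hx⟩ := isGen_adjacent M n i
      have h1 := hx.permMap_mul M _ _ _ 1
      rw [mul_one, permMap_one, mul_one] at h1
      rw [hx.permMap_mul, h1]
    | one => rw [one_mul, permMap_one, one_mul]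
    | mul a b _ _ iha ihb => rw [mul_assoc, iha, ihb, iha, mul_assoc]

/-- The action of the symmetric group on `M^{⊗ n}` through the commutativity constraint. -/
def permAction (M : C) (n : ℕ) : Equiv.Perm (Fin n) →* End (tensorPow M n) where
  toFun := permMap M n
  map_one' := permMap_one M n
  map_mul' := permMap_mul M n

theorem permAction_swap (M : C) (n : ℕ) :
    permAction M (n + 2) (Equiv.swap 0 1) = swapFirst M n := by
  have h := (IsGen.first (M := M) n).permMap_mul M _ _ _ 1
  rwa [mul_one, permMap_one, mul_one] at h

theorem permAction_extPerm (M : C) (n : ℕ) (σ : Equiv.Perm (Fin n)) :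
    permAction M (n + 1) (extPerm σ) = whisk M n (permAction M n σ) := by
  have h := permMap_cyclePerm_mul_extPerm M 0 σ
  rwa [cyclePerm_zero, cycleMap_zero, one_mul, one_mul] at h

theorem sum_perm_mul_self {K : Type*} [Field K] [CharZero K] {n : ℕ} {A : Type*} [Ring A]
    [Algebra K A] (ρ : Equiv.Perm (Fin n) →* A) (ε : Equiv.Perm (Fin n) →* ℤˣ) :
    ((n.factorial : K)⁻¹ • ∑ σ, (((ε σ : ℤˣ) : ℤ) : K) • ρ σ) *
        ((n.factorial : K)⁻¹ • ∑ σ, (((ε σ : ℤˣ) : ℤ) : K) • ρ σ) =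
      (n.factorial : K)⁻¹ • ∑ σ, (((ε σ : ℤˣ) : ℤ) : K) • ρ σ := by
  have hf (σ τ : Equiv.Perm (Fin n)) :
      ((((ε σ : ℤˣ) : ℤ) : K) • ρ σ) * ((((ε τ : ℤˣ) : ℤ) : K) • ρ τ) =
        (((ε (σ * τ) : ℤˣ) : ℤ) : K) • ρ (σ * τ) := by
    rw [smul_mul_smul_comm, map_mul, map_mul]
    push_cast
    rfl
  have h : (∑ σ, (((ε σ : ℤˣ) : ℤ) : K) • ρ σ) * (∑ σ, (((ε σ : ℤˣ) : ℤ) : K) • ρ σ) =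
      (n.factorial : K) • ∑ σ, (((ε σ : ℤˣ) : ℤ) : K) • ρ σ := by
    rw [Finset.sum_mul]
    simp_rw [Finset.mul_sum, hf]
    have hs (σ : Equiv.Perm (Fin n)) :
        ∑ τ, (((ε (σ * τ) : ℤˣ) : ℤ) : K) • ρ (σ * τ) =
          ∑ τ, (((ε τ : ℤˣ) : ℤ) : K) • ρ τ :=
      Equiv.sum_comp (Equiv.mulLeft σ) fun τ => (((ε τ : ℤˣ) : ℤ) : K) • ρ τ
    simp_rw [hs]
    rw [Finset.sum_const, Finset.card_univ, Fintype.card_perm, Fintype.card_fin,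
      ← Nat.cast_smul_eq_nsmul K]
  have h0 : (n.factorial : K) ≠ 0 := Nat.cast_ne_zero.2 n.factorial_ne_zero
  rw [smul_mul_smul_comm, h, smul_smul]
  congr 1
  field_simp

end Action

section Powers

variable (K : Type*) [Field K] [CharZero K]
variable {C : Type u} [Category.{v} C] [Preadditive C] [Linear K C] [MonoidalCategory C]
  [SymmetricCategory C]

/-- The symmetrizer `(1 / n!) ∑ σ` acting on `M^{⊗ n}`. -/
def symmetrizer (M : C) (n : ℕ) : tensorPow M n ⟶ tensorPow M n :=
  (n.factorial : K)⁻¹ • ∑ σ : Equiv.Perm (Fin n), permAction M n σ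

/-- The antisymmetrizer `(1 / n!) ∑ sgn(σ) σ` acting on `M^{⊗ n}`. -/
def antisymmetrizer (M : C) (n : ℕ) : tensorPow M n ⟶ tensorPow M n :=
  (n.factorial : K)⁻¹ •
    ∑ σ : Equiv.Perm (Fin n), ((Equiv.Perm.sign σ : ℤ) : K) • permAction M n σ

theorem symmetrizer_idem (M : C) (n : ℕ) :
    symmetrizer K M n ≫ symmetrizer K M n = symmetrizer K M n := by
  have h := sum_perm_mul_self (K := K) (permAction M n) 1
  simp only [MonoidHom.one_apply, Units.val_one, Int.cast_one, one_smul] at h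
  exact h

theorem antisymmetrizer_idem (M : C) (n : ℕ) :
    antisymmetrizer K M n ≫ antisymmetrizer K M n = antisymmetrizer K M n :=
  sum_perm_mul_self (K := K) (permAction M n) Equiv.Perm.sign

variable [IsIdempotentComplete C]

/-- The image of an idempotent: an object `Y` with `i : Y ⟶ X`, `r : X ⟶ Y` such that
`i ≫ r = 𝟙 Y` and `r ≫ i = p`. It is unique up to unique isomorphism. -/
def idemImage {X : C} (p : X ⟶ X) (hp : p ≫ p = p) : C :=
  (IsIdempotentComplete.idempotents_split X p hp).choose

/-- The symmetric power `Sⁿ(M)`. -/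
def symPow (M : C) (n : ℕ) : C :=
  idemImage (symmetrizer K M n) (symmetrizer_idem K M n)

/-- The exterior power `Λⁿ(M)`. -/
def extPow (M : C) (n : ℕ) : C :=
  idemImage (antisymmetrizer K M n) (antisymmetrizer_idem K M n)

/-- `M` is positive: some exterior power `Λᴺ(M)` with `N > 0` vanishes. -/
def IsPositive (M : C) : Prop := ∃ N : ℕ, 0 < N ∧ IsZero (extPow K M N)

/-- `M` is negative: some symmetric power `Sᴺ(M)` with `N > 0` vanishes. -/
def IsNegative (M : C) : Prop := ∃ N : ℕ, 0 < N ∧ IsZero (symPow K M N)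

/-- A decomposition `M ≅ M⁺ ⊕ M⁻` with `M⁺` positive and `M⁻` negative. -/
structure SignDecomposition [HasBinaryBiproducts C] (M : C) where
  pos : C
  neg : C
  iso : M ≅ pos ⊞ neg
  isPositive : IsPositive K pos
  isNegative : IsNegative K neg

/-- `M` is finite-dimensional (in the sense of Kimura and O'Sullivan). -/
def IsFiniteDimensional [HasBinaryBiproducts C] (M : C) : Prop :=
  Nonempty (SignDecomposition K M)

end Powers

section Determinant

variable {C : Type u} [Category.{v} C] [MonoidalCategory C] [SymmetricCategory C]
  [RigidCategory C]

/-- The Euler characteristic of `M`: the trace of the identity of `M`,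
`𝟙 ⟶ M ⊗ M* ⟶ M* ⊗ M ⟶ 𝟙`, an element of the ring `End 𝟙`. -/
def eulerChar (M : C) : End (𝟙_ C) :=
  (η_ M (Mᘁ) ≫ (β_ M (Mᘁ)).hom ≫ ε_ M (Mᘁ) : 𝟙_ C ⟶ 𝟙_ C)

/-- `L` is invertible for the tensor product. -/
def IsTensorInvertible (L : C) : Prop := ∃ T : C, Nonempty (L ⊗ T ≅ 𝟙_ C)

/-- The integral tensor power of an invertible object `L`, whose inverse is its dual `L*`. -/
def tensorZPow (L : C) : ℤ → C
  | Int.ofNat n => tensorPow L n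
  | Int.negSucc n => tensorPow (Lᘁ) (n + 1)

/-- The natural number `n` with `x = n` in `End 𝟙` (an arbitrary number if there is none). -/
def natValue [Preadditive C] (x : End (𝟙_ C)) : ℕ :=
  Classical.epsilon fun n : ℕ => x = (n : End (𝟙_ C))

variable (K : Type*) [Field K] [CharZero K]
variable [Preadditive C] [Linear K C] [IsIdempotentComplete C] [HasBinaryBiproducts C]

/-- The determinant `Λ^{χ(M⁺)}(M⁺) ⊗ (S^{-χ(M⁻)}(M⁻))⁻¹` computed with a given decomposition
`M ≅ M⁺ ⊕ M⁻`; the inverse of an invertible object is its dual. -/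
def SignDecomposition.det {K : Type*} [Field K] [CharZero K] [Linear K C] {M : C}
    (d : SignDecomposition K M) : C :=
  extPow K d.pos (natValue (eulerChar d.pos)) ⊗
    (symPow K d.neg (natValue (-eulerChar d.neg)))ᘁ

/-- `X` is finite-dimensional, and its determinant is isomorphic to `D` whichever decomposition
`X ≅ X⁺ ⊕ X⁻` it is computed with. -/
def HasDet (X D : C) : Prop :=
  IsFiniteDimensional K X ∧ ∀ d : SignDecomposition K X, Nonempty (d.det ≅ D)

end Determinant

end TensorDet

end

/-! The proof treats objects of a single sign first. `Signed K s d X` says that `alt K s X (d + 1) =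
0` and `χ(X) = s d`, where `alt` is the antisymmetrizer for `s = 1` and the symmetrizer for `s =
-1`. Closing the first strand of `alt` multiplies the next smaller one by `(χ(X) - s n) / (n + 1)`,
so the vanishing of some `alt` forces `χ(X) = s d` for a natural number `d` (`ptrace_alt`,
`exists_signed`). The image of `alt K s X d` is again signed, of dimension one (`Signed.det`), hence
invertible with its dual as inverse (`Signed.tensor_dual`).

The heart is a rigidity statement: an invertible summand `L` of `X^{⊗ m}`, `m = d k`, which is cut
out by an element of the group algebra of the symmetric group is isomorphic to `det(X)^{⊗ k}`
(`iso_tensorPow_det`; `iso_tensorPow_det_tensor` treats `X^{⊗ m} ⊗ Y^{⊗ n}`). Since `- ⊗ L` is an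
equivalence, the Jucys-Murphy sum of transpositions acts on `X ⊗ L` through some `f : X ⟶ X`. The
trace over all factors but the first shows that `f` is a scalar `κ`, and the trace over the first
factor gives `κ χ(X) = m`, so `κ = s k` (`jmEigen_of_invertible`). For such an eigenvector the `m`
positions can be antisymmetrized in `k` blocks of size `d`, one position at a time, without ever
reaching zero (`smul_eq_zero_of_contraction`, `exists_blockEigen`). This yields a nonzero map, in
the group algebra, from `L` to `det(X)^{⊗ k}`. The group algebra is von Neumann regular and
invertible objects have only scalar endomorphisms, so the map is an isomorphism
(`IsIm.iso_of_regular`). The determinants of `X ⊗ Y` and of the exterior and symmetric powers of `X`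
are summands of this kind, which gives their classes for signed objects.

Three further ingredients lead to the general case. A tensor product of signed objects is signed,
and a map between objects of opposite signs has a vanishing tensor power; both come from
`exists_mem_ker_of_swapEigen`, which separates two representations of a symmetric group by an
element of the group algebra. Traces turn the second fact into nilpotence, so that the positive and
negative parts of an object are unique up to isomorphism (`iso_of_biprod_iso`). Finally, a power of
a direct sum is the sum of the products of powers of the summands (`isIm_wordSum`).

Determinants are then handled as elements of the commutative group of units of `Skeleton C`, with
`det(P ⊞ N) = w w'⁻¹` for `P` positive and `N` negative (`HasDetClass`). The stated exponents follow
from the results for signed objects and from two Vandermonde identities, `powDim_add` and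
`powExp_add`. -/

set_option linter.unusedSectionVars false

open CategoryTheory MonoidalCategory Limits

noncomputable section

namespace TensorDet

universe v u

/-! ### Images of idempotents -/

section Image

variable {C : Type u} [Category.{v} C]

/-- `Y` is the image of the idempotent `p`. -/
def IsIm {X : C} (p : X ⟶ X) (Y : C) : Prop :=
  ∃ (i : Y ⟶ X) (r : X ⟶ Y), i ≫ r = 𝟙 Y ∧ r ≫ i = p

theorem isIm_idemImage [IsIdempotentComplete C] {X : C} (p : X ⟶ X) (hp : p ≫ p = p) :
    IsIm p (idemImage p hp) :=
  (IsIdempotentComplete.idempotents_split X p hp).choose_spec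

theorem isIm_id (X : C) : IsIm (𝟙 X) X := ⟨𝟙 X, 𝟙 X, by simp, by simp⟩

theorem IsIm.idem {X Y : C} {p : X ⟶ X} (h : IsIm p Y) : p ≫ p = p := by
  obtain ⟨i, r, h1, rfl⟩ := h
  simp only [Category.assoc]
  rw [reassoc_of% h1]

theorem exists_isIm [IsIdempotentComplete C] {X : C} (p : X ⟶ X) (hp : p ≫ p = p) :
    ∃ Y, IsIm p Y := ⟨_, isIm_idemImage p hp⟩

/-- Two idempotents which are equivalent through `a` and `b` have isomorphic images. -/
theorem IsIm.iso_of_equiv {X X' Y Y' : C} {p : X ⟶ X} {q : X' ⟶ X'} (h : IsIm p Y)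
    (h' : IsIm q Y') (a : X ⟶ X') (b : X' ⟶ X) (h1 : p ≫ a ≫ q ≫ b ≫ p = p)
    (h2 : q ≫ b ≫ p ≫ a ≫ q = q) : Nonempty (Y ≅ Y') := by
  obtain ⟨i, r, hi, rfl⟩ := h
  obtain ⟨i', r', hi', rfl⟩ := h'
  refine ⟨⟨i ≫ a ≫ r', i' ≫ b ≫ r, ?_, ?_⟩⟩
  · have := congrArg (fun f => i ≫ f ≫ r) h1
    simp only [Category.assoc, reassoc_of% hi, hi, Category.comp_id] at this
    simpa using this
  · have := congrArg (fun f => i' ≫ f ≫ r') h2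
    simp only [Category.assoc, reassoc_of% hi', hi', Category.comp_id] at this
    simpa using this

theorem IsIm.iso_of_comp {X X' Y Y' : C} {p : X ⟶ X} {q : X' ⟶ X'} (h : IsIm p Y)
    (h' : IsIm q Y') (a : X ⟶ X') (b : X' ⟶ X) (h1 : a ≫ b = p) (h2 : b ≫ a = q) :
    Nonempty (Y ≅ Y') := by
  have hp := h.idem
  have hq := h'.idem
  refine h.iso_of_equiv h' a b ?_ ?_
  · rw [← h2]
    simp only [Category.assoc, reassoc_of% h1, hp]
  · rw [← h1]
    simp only [Category.assoc, reassoc_of% h2, hq]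

theorem IsIm.iso {X Y Y' : C} {p : X ⟶ X} (h : IsIm p Y) (h' : IsIm p Y') :
    Nonempty (Y ≅ Y') :=
  h.iso_of_comp h' p p h.idem h.idem

theorem IsIm.of_iso {X Y Y' : C} {p : X ⟶ X} (h : IsIm p Y) (e : Y ≅ Y') : IsIm p Y' := by
  obtain ⟨i, r, hi, rfl⟩ := h
  exact ⟨e.inv ≫ i, r ≫ e.hom, by simp [reassoc_of% hi], by simp⟩

theorem IsIm.conj {X X' Y : C} {p : X ⟶ X} (h : IsIm p Y) (e : X ≅ X') :
    IsIm (e.inv ≫ p ≫ e.hom) Y := by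
  obtain ⟨i, r, hi, rfl⟩ := h
  exact ⟨i ≫ e.hom, e.inv ≫ r, by simp [hi], by simp⟩

/-- An image inside an image is an image. -/
theorem IsIm.trans {X Y Z : C} {i : Y ⟶ X} {r : X ⟶ Y} (h : i ≫ r = 𝟙 Y) {q : Y ⟶ Y}
    (h' : IsIm q Z) : IsIm (r ≫ q ≫ i) Z := by
  obtain ⟨j, s, hj, rfl⟩ := h'
  exact ⟨j ≫ i, r ≫ s, by simp [reassoc_of% h, hj], by simp⟩

theorem IsIm.isZero_iff [HasZeroMorphisms C] {X Y : C} {p : X ⟶ X} (h : IsIm p Y) :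
    IsZero Y ↔ p = 0 := by
  obtain ⟨i, r, hi, rfl⟩ := h
  rw [IsZero.iff_id_eq_zero]
  constructor
  · intro h0
    rw [← Category.id_comp i, h0, zero_comp, comp_zero]
  · intro h0
    have := congrArg (fun f => i ≫ f ≫ r) h0
    simpa [reassoc_of% hi, hi] using this

end Image

section ImageTensor

variable {C : Type u} [Category.{v} C] [MonoidalCategory C]

theorem IsIm.tensor {X X' Y Y' : C} {p : X ⟶ X} {q : X' ⟶ X'} (h : IsIm p Y)
    (h' : IsIm q Y') : IsIm (p ⊗ₘ q) (Y ⊗ Y') := by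
  obtain ⟨i, r, hi, rfl⟩ := h
  obtain ⟨i', r', hi', rfl⟩ := h'
  exact ⟨i ⊗ₘ i', r ⊗ₘ r', by simp [hi, hi'], by simp⟩

end ImageTensor

/-! ### Traces and partial traces in a symmetric monoidal category -/

section Trace

variable {C : Type u} [Category.{v} C] [MonoidalCategory C] [SymmetricCategory C]

/-- The trace of `f` computed with the dual `D` of `X`. -/
def trPair (X D : C) [ExactPairing X D] (f : X ⟶ X) : 𝟙_ C ⟶ 𝟙_ C :=
  η_ X D ≫ f ▷ D ≫ (β_ X D).hom ≫ ε_ X D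

/-- Cyclicity: `f` is moved around the loop as its mate `f'` between the duals. The two duals are
arbitrary exact pairings, which gives `trPair_indep` by taking `f` to be an identity. -/
theorem trPair_comm {X D Y E : C} [ExactPairing X D] [ExactPairing Y E] (f : X ⟶ Y)
    (g : Y ⟶ X) : trPair X D (f ≫ g) = trPair Y E (g ≫ f) := by
  obtain ⟨f', h1, h2⟩ : ∃ f' : E ⟶ D, η_ Y E ≫ Y ◁ f' = η_ X D ≫ f ▷ D ∧
      f' ▷ X ≫ ε_ X D = E ◁ f ≫ ε_ Y E := by
    let _ : HasRightDual X := ⟨D⟩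
    let _ : HasRightDual Y := ⟨E⟩
    exact ⟨fᘁ, coevaluation_comp_rightAdjointMate f, rightAdjointMate_comp_evaluation f⟩
  calc trPair X D (f ≫ g) = (η_ X D ≫ f ▷ D) ≫ g ▷ D ≫ (β_ X D).hom ≫ ε_ X D := by
        simp [trPair]
    _ = η_ Y E ≫ g ▷ E ≫ (X ◁ f' ≫ (β_ X D).hom) ≫ ε_ X D := by
        rw [← h1]
        simp only [Category.assoc]
        rw [whisker_exchange_assoc]
    _ = η_ Y E ≫ g ▷ E ≫ (β_ X E).hom ≫ f' ▷ X ≫ ε_ X D := by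
        rw [BraidedCategory.braiding_naturality_right]
        simp only [Category.assoc]
    _ = trPair Y E (g ≫ f) := by
        rw [h2, ← BraidedCategory.braiding_naturality_left_assoc, trPair, comp_whiskerRight,
          Category.assoc]

theorem trPair_indep {X D E : C} [ExactPairing X D] [i : ExactPairing X E] (f : X ⟶ X) :
    trPair X D f = trPair X E f := by
  have := trPair_comm (D := D) (E := E) (𝟙 X) f
  simpa using this

/-- The partial trace over the left factor. -/
def ptr (X D : C) [ExactPairing X D] {Z W : C} (f : X ⊗ Z ⟶ X ⊗ W) : Z ⟶ W :=
  (λ_ Z).inv ≫ (η_ X D ≫ (β_ X D).hom) ▷ Z ≫ (α_ D X Z).hom ≫ D ◁ f ≫ (α_ D X W).inv ≫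
    ε_ X D ▷ W ≫ (λ_ W).hom

theorem ptr_whisker (X D : C) [ExactPairing X D] {Z W Z' W' : C} (g : Z' ⟶ Z)
    (f : X ⊗ Z ⟶ X ⊗ W) (g' : W ⟶ W') :
    ptr X D (X ◁ g ≫ f ≫ X ◁ g') = g ≫ ptr X D f ≫ g' := by
  simp only [ptr, whiskerLeft_comp, Category.assoc]
  rw [← associator_naturality_right_assoc, ← whisker_exchange_assoc,
    ← leftUnitor_inv_naturality_assoc, associator_inv_naturality_right_assoc,
    whisker_exchange_assoc, leftUnitor_naturality]

theorem ptr_whiskerRight (X D : C) [ExactPairing X D] {Z : C} (f : X ⟶ X) :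
    ptr X D (f ▷ Z) = (λ_ Z).inv ≫ trPair X D f ▷ Z ≫ (λ_ Z).hom := by
  have h : (α_ D X Z).hom ≫ D ◁ f ▷ Z ≫ (α_ D X Z).inv = (D ◁ f) ▷ Z := by simp
  rw [trPair, BraidedCategory.braiding_naturality_left_assoc]
  simp only [ptr, comp_whiskerRight, Category.assoc]
  rw [reassoc_of% h]

/-- The hexagon axiom and the naturality of the braiding turn the closed strand into a zigzag, which
the triangle identity straightens. This is the source of every partial trace of a permutation below.
-/
theorem ptr_braiding (X D : C) [ExactPairing X D] : ptr X D (β_ X X).hom = 𝟙 X := by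
  have h := BraidedCategory.braiding_naturality_right X (ε_ X D)
  rw [BraidedCategory.braiding_tensor_right_hom] at h
  have h2 : (α_ X D X).hom ≫ X ◁ ε_ X D ≫ (β_ X (𝟙_ C)).hom =
    (β_ X D).hom ▷ X ≫ (α_ D X X).hom ≫ D ◁ (β_ X X).hom ≫ (α_ D X X).inv ≫ ε_ X D ▷ X := by
    rw [h]
    simp
  simp only [ptr, comp_whiskerRight, Category.assoc]
  rw [← reassoc_of% h2]
  have h4 : η_ X D ▷ X ≫ (α_ X D X).hom ≫ X ◁ ε_ X D = (λ_ X).hom ≫ (ρ_ X).inv :=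
    ExactPairing.evaluation_coevaluation (X := X) (Y := D)
  rw [reassoc_of% h4]
  simp

theorem ptr_assoc (X D : C) [ExactPairing X D] {Z W V : C} (f : X ⊗ Z ⟶ X ⊗ W) :
    ptr X D ((α_ X Z V).inv ≫ f ▷ V ≫ (α_ X W V).hom) = ptr X D f ▷ V := by
  simp only [ptr, comp_whiskerRight, whiskerLeft_comp, Category.assoc]
  monoidal

theorem ptr_swapTwo (X D : C) [ExactPairing X D] (Z : C) :
    ptr X D (swapTwo X Z) = 𝟙 (X ⊗ Z) := by
  rw [swapTwo, ptr_assoc, ptr_braiding, id_whiskerRight]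

/-- The dual of a tensor product is the reversed product of the duals, so the loop of `X ⊗ Z`
consists of two nested loops. The inner one is closed first. -/
theorem trPair_tensor {X Z D E : C} [ExactPairing X D] [ExactPairing Z E]
    (f : X ⊗ Z ⟶ X ⊗ Z) : trPair (X ⊗ Z) (E ⊗ D) f = trPair Z E (ptr X D f) := by
  -- The part of the diagram which closes the strand of `X` and leaves `Z`. Both traces are
  -- rewritten to pass through it.
  let k : (X ⊗ Z) ⊗ D ⟶ Z := (β_ (X ⊗ Z) D).hom ≫ (α_ D X Z).inv ≫ ε_ X D ▷ Z ≫ (λ_ Z).hom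
  have hptr : ptr X D f = (λ_ Z).inv ≫ η_ X D ▷ Z ≫ (α_ X D Z).hom ≫ X ◁ (β_ D Z).hom ≫
      (α_ X Z D).inv ≫ f ▷ D ≫ k := by
    simp only [k]
    rw [BraidedCategory.braiding_naturality_left_assoc, BraidedCategory.braiding_tensor_left_hom]
    simp only [Category.assoc, Iso.inv_hom_id_assoc]
    rw [← whiskerLeft_comp_assoc, SymmetricCategory.symmetry]
    simp [ptr]
  have htail : (β_ (X ⊗ Z) (E ⊗ D)).hom ≫ (ε_ (X ⊗ Z) (E ⊗ D)) =
      (X ⊗ Z) ◁ (β_ E D).hom ≫ (α_ _ _ _).inv ≫ k ▷ E ≫ (β_ Z E).hom ≫ ε_ Z E := by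
    rw [BraidedCategory.braiding_naturality_left_assoc,
      BraidedCategory.braiding_tensor_left_hom (X ⊗ Z) D E]
    simp only [Category.assoc, Iso.inv_hom_id_assoc]
    rw [← whiskerLeft_comp_assoc, SymmetricCategory.symmetry]
    rw [BraidedCategory.braiding_tensor_right_hom, ExactPairing.tensor_evaluation]
    simp [k, monoidalComp]
  have hhead : η_ (X ⊗ Z) (E ⊗ D) ≫ (X ⊗ Z) ◁ (β_ E D).hom ≫ (α_ _ _ _).inv =
      η_ Z E ≫ ((λ_ Z).inv ≫ η_ X D ▷ Z ≫ (α_ X D Z).hom ≫ X ◁ (β_ D Z).hom ≫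
      (α_ X Z D).inv) ▷ E := by
    have h1 : η_ Z E ▷ D ≫ (α_ _ _ _).hom ≫ Z ◁ (β_ E D).hom = (λ_ D).hom ≫ (ρ_ D).inv ≫
        D ◁ η_ Z E ≫ (α_ _ _ _).inv ≫ (β_ D Z).hom ▷ E ≫ (α_ _ _ _).hom := by
      have h2 := BraidedCategory.braiding_naturality_right D (η_ Z E)
      rw [BraidedCategory.braiding_tensor_right_hom] at h2
      have h3 : η_ Z E ▷ D = (β_ D (𝟙_ C)).inv ≫ D ◁ η_ Z E ≫ (α_ D Z E).inv ≫
        (β_ D Z).hom ▷ E ≫ (α_ Z D E).hom ≫ Z ◁ (β_ D E).hom ≫ (α_ Z E D).inv := by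
        rw [h2]; simp
      rw [h3]
      simp only [Category.assoc, Iso.inv_hom_id_assoc]
      rw [← whiskerLeft_comp, SymmetricCategory.symmetry]
      simp
    rw [ExactPairing.tensor_coevaluation]
    have h4 := congrArg (fun g => η_ X D ≫ X ◁ ((λ_ D).inv ≫ g ≫ (α_ _ _ _).inv) ≫
      (α_ _ _ _).inv ≫ (α_ _ _ _).inv ▷ E) h1
    have h5 : η_ X D ≫ X ◁ ((λ_ D).inv ≫ ((λ_ D).hom ≫ (ρ_ D).inv ≫
        D ◁ η_ Z E ≫ (α_ _ _ _).inv ≫ (β_ D Z).hom ▷ E ≫ (α_ _ _ _).hom) ≫ (α_ _ _ _).inv) ≫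
      (α_ _ _ _).inv ≫ (α_ _ _ _).inv ▷ E = (λ_ (𝟙_ C)).inv ≫
        (η_ X D ▷ 𝟙_ C ≫ (X ⊗ D) ◁ η_ Z E) ⊗≫
        (X ◁ (β_ D Z).hom ≫ (α_ X Z D).inv) ▷ E := by
      monoidal
    rw [← whisker_exchange] at h5
    refine Eq.trans ?_ (h4.trans (h5.trans ?_))
    · monoidal
    · monoidal
  rw [trPair, htail, ← whisker_exchange_assoc, associator_inv_naturality_left_assoc,
    reassoc_of% hhead, trPair, hptr]
  simp

end Trace

/-! ### Vectors symmetric or antisymmetric under transpositions -/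

section Swap

open Equiv

variable {α : Type*} [DecidableEq α] {K : Type*} [Field K] {W : Type*} [AddCommGroup W] [Module K W]

/-- The trivial character of a symmetric group if `s = 1` and the sign if `s = -1`. -/
def tw [Fintype α] (s : ℤˣ) : Perm α →* ℤˣ := if s = 1 then 1 else Perm.sign

theorem tw_one [Fintype α] (σ : Perm α) : tw 1 σ = 1 := by simp [tw]

theorem tw_neg_one [Fintype α] (σ : Perm α) : tw (-1) σ = Perm.sign σ := by
  simp [tw]

theorem tw_swap [Fintype α] (s : ℤˣ) {x y : α} (h : x ≠ y) : tw s (swap x y) = s := by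
  rcases Int.units_eq_one_or s with rfl | rfl
  · exact tw_one _
  · rw [tw_neg_one, Perm.sign_swap h]

/-- The transpositions of elements of `S` act on `w` as the sign `s`. -/
def SwapEigen (ρ : Perm α →* Module.End K W) (s : ℤˣ) (S : Finset α) (w : W) : Prop :=
  ∀ x ∈ S, ∀ y ∈ S, x ≠ y → ρ (swap x y) w = ((s : ℤ) : K) • w

theorem units_mul_self_cast (s : ℤˣ) : ((s : ℤ) : K) * ((s : ℤ) : K) = 1 := by
  rcases Int.units_eq_one_or s with rfl | rfl <;> simp

theorem swap_mul_swap_conj {x p t : α} (hx : x ≠ p) (hxt : x ≠ t) :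
    swap x p * swap t p = swap t p * swap x t := by
  have := Equiv.mul_swap_eq_swap_mul (swap t p) x t
  rw [swap_apply_left, swap_apply_of_ne_of_ne hxt hx] at this
  exact this.symm

/-- Extending the antisymmetry (or symmetry) by one element. -/
theorem SwapEigen.insert {ρ : Perm α →* Module.End K W} {s : ℤˣ} {S : Finset α} {w : W}
    (h : SwapEigen ρ s S w) {p : α} (hp : p ∉ S) :
    SwapEigen ρ s (insert p S) (w + ((s : ℤ) : K) • ∑ x ∈ S, ρ (swap x p) w) := by
  have hs : ((s : ℤ) : K) * ((s : ℤ) : K) = 1 := units_mul_self_cast s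
  have h1 : ∀ x ∈ S, ρ (swap x p) (w + ((s : ℤ) : K) • ∑ x ∈ S, ρ (swap x p) w) =
      ((s : ℤ) : K) • (w + ((s : ℤ) : K) • ∑ x ∈ S, ρ (swap x p) w) := by
    intro x hx
    have hxp : x ≠ p := fun e => hp (e ▸ hx)
    rw [map_add, map_smul, map_sum, smul_add, smul_smul, hs, one_smul,
      ← Finset.add_sum_erase _ _ hx, ← Finset.add_sum_erase S (fun y => ρ (swap y p) w) hx]
    -- From `(x p)(y p) = (y p)(x y)`, and `(x y)` already acts on `w` by `s`.
    have h2 : ∑ y ∈ S.erase x, ρ (swap x p) (ρ (swap y p) w) =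
        ((s : ℤ) : K) • ∑ y ∈ S.erase x, ρ (swap y p) w := by
      rw [Finset.smul_sum]
      refine Finset.sum_congr rfl fun y hy => ?_
      have hy' := Finset.mem_erase.1 hy
      rw [← Module.End.mul_apply, ← map_mul,
        swap_mul_swap_conj hxp hy'.1.symm, map_mul, Module.End.mul_apply,
        h x hx y hy'.2 hy'.1.symm, map_smul]
    rw [h2, ← Module.End.mul_apply, ← map_mul, swap_mul_self, map_one, Module.End.one_apply,
      smul_add, smul_smul, hs, one_smul]
    abel
  intro x hx y hy hxy
  rcases Finset.mem_insert.1 hx with rfl | hx'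
  · rcases Finset.mem_insert.1 hy with rfl | hy'
    · exact absurd rfl hxy
    · rw [swap_comm]
      exact h1 y hy'
  · rcases Finset.mem_insert.1 hy with rfl | hy'
    · exact h1 x hx'
    · rw [map_add, map_smul, map_sum, h x hx' y hy' hxy, smul_add]
      congr 1
      rw [smul_smul, mul_comm, ← smul_smul, smul_comm]
      congr 1
      rw [Finset.smul_sum]
      refine Finset.sum_equiv (swap x y) ?_ ?_
      · intro z
        by_cases hzx : z = x
        · subst hzx; simp [hx', hy']
        by_cases hzy : z = y
        · subst hzy; simp [hx', hy']
        rw [swap_apply_of_ne_of_ne hzx hzy]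
      · intro z hz
        have hpx : p ≠ x := fun e => hp (e ▸ hx')
        have hpy : p ≠ y := fun e => hp (e ▸ hy')
        have : swap x y * swap z p = swap (swap x y z) p * swap x y := by
          have := Equiv.mul_swap_eq_swap_mul (swap x y) z p
          rwa [swap_apply_of_ne_of_ne hpx hpy] at this
        rw [← Module.End.mul_apply, ← map_mul, this, map_mul, Module.End.mul_apply,
          h x hx' y hy' hxy, map_smul]

theorem SwapEigen.perm {ρ : Perm α →* Module.End K W} {s : ℤˣ} {S : Finset α} {w : W}
    (h : SwapEigen ρ s S w) (σ : Perm S) :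
    ρ (Perm.ofSubtype σ) w = (((tw s σ : ℤˣ) : ℤ) : K) • w := by
  induction σ using Perm.swap_induction_on with
  | one => simp
  | swap_mul f x y hxy ih =>
    rw [map_mul, map_mul, Module.End.mul_apply, ih, map_smul, Perm.ofSubtype_swap_eq,
      h x x.2 y y.2 (fun e => hxy (Subtype.ext e)), map_mul, tw_swap s hxy, smul_smul]
    push_cast
    rw [mul_comm]

theorem SwapEigen.perm_univ [Fintype α] {ρ : Perm α →* Module.End K W} {s : ℤˣ} {w : W}
    (h : SwapEigen ρ s Finset.univ w) (σ : Perm α) :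
    ρ σ w = (((tw s σ : ℤˣ) : ℤ) : K) • w := by
  induction σ using Perm.swap_induction_on with
  | one => simp
  | swap_mul f x y hxy ih =>
    rw [map_mul, Module.End.mul_apply, ih, map_smul,
      h x (Finset.mem_univ _) y (Finset.mem_univ _) hxy, map_mul, tw_swap s hxy, smul_smul]
    push_cast
    rw [mul_comm]

variable [CharZero K]

/-- A vector which is antisymmetric in `S`, symmetric in `T`, and neither of these can be
extended, vanishes. -/
theorem SwapEigen.eq_zero {ρ : Perm α →* Module.End K W} {s : ℤˣ} {S T : Finset α} {w : W}
    (hS : ∀ p ∈ T, w + ((s : ℤ) : K) • ∑ x ∈ S, ρ (swap x p) w = 0)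
    (hT : ∀ p ∈ S, w + (((-s : ℤˣ) : ℤ) : K) • ∑ x ∈ T, ρ (swap x p) w = 0)
    (h0 : 0 < S.card) : w = 0 := by
  have hs : ((s : ℤ) : K) * ((s : ℤ) : K) = 1 := units_mul_self_cast s
  have e1 := Finset.sum_congr rfl hS
  have e2 := Finset.sum_congr rfl hT
  rw [Finset.sum_const_zero, Finset.sum_add_distrib, ← Finset.smul_sum, Finset.sum_const] at e1 e2
  rw [Finset.sum_comm] at e2
  have e3 : ∑ y ∈ T, ∑ x ∈ S, ρ (swap y x) w = ∑ y ∈ T, ∑ x ∈ S, ρ (swap x y) w :=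
    Finset.sum_congr rfl fun y _ => Finset.sum_congr rfl fun x _ => by rw [swap_comm]
  rw [e3] at e2
  -- The double sums of transpositions occur with opposite signs and cancel, which leaves `(|T| +
  -- |S|) • w = 0`.
  have e4 := congrArg₂ (· + ·) e1 e2
  simp only [Units.val_neg, Int.cast_neg, neg_smul, add_zero] at e4
  have e5 : ((T.card + S.card : ℕ) : K) • w = 0 := by
    rw [Nat.cast_smul_eq_nsmul, add_smul, ← e4]
    abel
  refine (smul_eq_zero.1 e5).resolve_left ?_
  exact Nat.cast_ne_zero.2 (by omega)

/-- A representation of a symmetric group without vectors antisymmetric in `a + 1` variables or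
symmetric in `b + 1` variables vanishes if there are more than `a * b` variables. -/
theorem eq_zero_of_swapEigen (ρ : Perm α →* Module.End K W) (s : ℤˣ) : ∀ (n a b : ℕ),
    a + b = n → ∀ (P : Finset α) (V : Submodule K W),
    (∀ x ∈ P, ∀ y ∈ P, ∀ w ∈ V, ρ (swap x y) w ∈ V) →
    (∀ S ⊆ P, S.card = a + 1 → ∀ w ∈ V, SwapEigen ρ s S w → w = 0) →
    (∀ S ⊆ P, S.card = b + 1 → ∀ w ∈ V, SwapEigen ρ (-s) S w → w = 0) →
    a * b < P.card → ∀ w ∈ V, w = 0 := by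
  intro n
  induction n with
  | zero =>
    intro a b hab P V hV ha hb hP w hw
    obtain ⟨p, hp⟩ := Finset.card_pos.1 (Nat.zero_lt_of_lt hP)
    refine ha {p} (by simpa using hp) (by simp; omega) w hw ?_
    intro x hx y hy hxy
    simp only [Finset.mem_singleton] at hx hy
    exact absurd (hx.trans hy.symm) hxy
  | succ n ih =>
    intro a b hab P V hV ha hb hP w hw
    obtain ⟨p, hp⟩ := Finset.card_pos.1 (Nat.zero_lt_of_lt hP)
    have hsing : ∀ s : ℤˣ, SwapEigen ρ s {p} w := by
      intro s x hx y hy hxy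
      simp only [Finset.mem_singleton] at hx hy
      exact absurd (hx.trans hy.symm) hxy
    rcases a with _ | a
    · exact ha {p} (by simpa using hp) (by simp) w hw (hsing s)
    rcases b with _ | b
    · exact hb {p} (by simpa using hp) (by simp) w hw (hsing (-s))
    -- In the language of Young diagrams: the shapes have at most `a + 1` rows and `b + 1` columns,
    -- up to exchanging the two, and a full line is removed. If a nonzero vector is an
    -- `s`-eigenvector in a set `S` of the largest allowed size, the argument is repeated with the
    -- variables outside `S` and the vectors which are `s`-eigenvectors in `S`. There `b + 1` drops
    -- to `b` by `SwapEigen.eq_zero`, and more than `(a + 1) * b` variables remain. If there is no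
    -- such vector, `a + 1` drops to `a`.
    by_cases hex : ∃ S ⊆ P, S.card = a + 1 ∧ ∃ w ∈ V, SwapEigen ρ s S w ∧ w ≠ 0
    · exfalso
      obtain ⟨S, hSP, hSc, u, huV, hu, hu0⟩ := hex
      let V' : Submodule K W :=
        { carrier := {w | w ∈ V ∧ SwapEigen ρ s S w}
          add_mem' := fun {v w} hv hw => ⟨V.add_mem hv.1 hw.1, fun x hx y hy hxy => by
            rw [map_add, hv.2 x hx y hy hxy, hw.2 x hx y hy hxy, smul_add]⟩
          zero_mem' := ⟨V.zero_mem, fun x hx y hy hxy => by simp⟩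
          smul_mem' := fun c w hw => ⟨V.smul_mem c hw.1, fun x hx y hy hxy => by
            rw [map_smul, hw.2 x hx y hy hxy, smul_comm]⟩ }
      have hsum : ∀ (T : Finset α) (p : α), T ⊆ P → p ∈ P → ∀ (c : K), ∀ w ∈ V,
          w + c • ∑ x ∈ T, ρ (swap x p) w ∈ V := fun T p hT hp c w hw =>
        V.add_mem hw (V.smul_mem _ (V.sum_mem fun x hx => hV x (hT hx) p hp w hw))
      refine hu0 (ih (a + 1) b (by omega) (P \ S) V' ?_ ?_ ?_ ?_ u ⟨huV, hu⟩)
      · intro x hx y hy w hw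
        rw [Finset.mem_sdiff] at hx hy
        refine ⟨hV x hx.1 y hy.1 w hw.1, fun z hz z' hz' hzz => ?_⟩
        have hc : swap z z' * swap x y = swap x y * swap z z' := by
          have := Equiv.mul_swap_eq_swap_mul (swap x y) z z'
          rw [swap_apply_of_ne_of_ne, swap_apply_of_ne_of_ne] at this
          · exact this.symm
          all_goals (rintro rfl; simp_all)
        rw [← Module.End.mul_apply, ← map_mul, hc, map_mul, Module.End.mul_apply,
          hw.2 z hz z' hz' hzz, map_smul]
      · exact fun T hT hc w hw h => ha T (hT.trans Finset.sdiff_subset) hc w hw.1 h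
      · intro T hT hc w hw h
        have hTP := hT.trans Finset.sdiff_subset
        refine SwapEigen.eq_zero (ρ := ρ) (s := s) (S := S) (T := T) ?_ ?_ (by omega)
        · intro p hp
          have hpS := (Finset.mem_sdiff.1 (hT hp)).2
          refine ha _ (Finset.insert_subset (hTP hp) hSP)
            (by rw [Finset.card_insert_of_notMem hpS, hSc])
            _ (hsum S p hSP (hTP hp) _ w hw.1) (hw.2.insert hpS)
        · intro p hp
          have hpT : p ∉ T := fun h' => (Finset.mem_sdiff.1 (hT h')).2 hp
          refine hb _ (Finset.insert_subset (hSP hp) hTP)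
            (by rw [Finset.card_insert_of_notMem hpT, hc])
            _ (hsum T p hTP (hSP hp) _ w hw.1) (h.insert hpT)
      · rw [Finset.card_sdiff_of_subset hSP, hSc]
        have : (a + 1) * (b + 1) = (a + 1) * b + (a + 1) := by ring
        omega
    · push Not at hex
      refine ih a (b + 1) (by omega) P V hV ?_ hb ?_ w hw
      · exact fun S hS hc w hw h => hex S hS hc w hw h
      · refine lt_of_le_of_lt (Nat.mul_le_mul_right _ (Nat.le_succ a)) hP

/-- The average over the permutations of `S` twisted by the character `tw s`, up to a scalar. -/
def avg (K : Type*) [Field K] (s : ℤˣ) (S : Finset α) : MonoidAlgebra K (Perm α) :=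
  ∑ σ : Perm S, (((tw s σ : ℤˣ) : ℤ) : K) • MonoidAlgebra.of K (Perm α) (Perm.ofSubtype σ)

theorem swap_mul_avg (s : ℤˣ) {S : Finset α} {x y : α} (hx : x ∈ S) (hy : y ∈ S)
    (hxy : x ≠ y) : MonoidAlgebra.of K (Perm α) (swap x y) * avg K s S =
      ((s : ℤ) : K) • avg K s S := by
  have hne : (⟨x, hx⟩ : S) ≠ ⟨y, hy⟩ := fun e => hxy (congrArg Subtype.val e)
  rw [avg, Finset.mul_sum, Finset.smul_sum]
  refine Finset.sum_equiv (Equiv.mulLeft (swap ⟨x, hx⟩ ⟨y, hy⟩)) (by simp) fun σ _ => ?_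
  rw [Equiv.coe_mulLeft, map_mul, map_mul, Perm.ofSubtype_swap_eq, map_mul, tw_swap s hne,
    mul_smul_comm, smul_smul]
  push_cast
  rw [← mul_assoc, units_mul_self_cast, one_mul]

/-- The two conditions confine the irreducible constituents of the two representations to disjoint
sets of shapes once there are more than `a * b` points. This is used without classifying
representations: the sum `J` of the two kernels in the group algebra is a left ideal, the quotient
by `J` satisfies both conditions of `eq_zero_of_swapEigen`, so it vanishes and `1` is a sum of
elements of the two kernels. -/
theorem exists_mem_ker_of_swapEigen [Fintype α] {R₁ R₂ : Type*} [Ring R₁] [Algebra K R₁]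
    [Ring R₂] [Algebra K R₂] (f₁ : Perm α →* R₁) (f₂ : Perm α →* R₂) (s : ℤˣ) (a b : ℕ)
    (h₁ : ∀ S : Finset α, S.card = a + 1 → ∀ z : R₁, (∀ x ∈ S, ∀ y ∈ S, x ≠ y →
      f₁ (swap x y) * z = ((s : ℤ) : K) • z) → z = 0)
    (h₂ : ∀ S : Finset α, S.card = b + 1 → ∀ z : R₂, (∀ x ∈ S, ∀ y ∈ S, x ≠ y →
      f₂ (swap x y) * z = (((-s : ℤˣ) : ℤ) : K) • z) → z = 0)
    (hab : a * b < Fintype.card α) :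
    ∃ y : MonoidAlgebra K (Perm α), MonoidAlgebra.lift K R₁ (Perm α) f₁ y = 0 ∧
      MonoidAlgebra.lift K R₂ (Perm α) f₂ (1 - y) = 0 := by
  set F₁ := MonoidAlgebra.lift K R₁ (Perm α) f₁
  set F₂ := MonoidAlgebra.lift K R₂ (Perm α) f₂
  let J : Submodule K (MonoidAlgebra K (Perm α)) :=
    LinearMap.ker F₁.toLinearMap ⊔ LinearMap.ker F₂.toLinearMap
  have hJ : ∀ x, ∀ y ∈ J, x * y ∈ J := by
    intro x y hy
    obtain ⟨u, hu, v, hv, rfl⟩ := Submodule.mem_sup.1 hy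
    rw [mul_add]
    refine Submodule.add_mem_sup ?_ ?_
    · have : F₁ u = 0 := hu
      show F₁ (x * u) = 0
      rw [map_mul, this, mul_zero]
    · have : F₂ v = 0 := hv
      show F₂ (x * v) = 0
      rw [map_mul, this, mul_zero]
  let ρ : Perm α →* Module.End K (MonoidAlgebra K (Perm α) ⧸ J) :=
    { toFun := fun σ => J.mapQ J (LinearMap.mulLeft K (MonoidAlgebra.of K (Perm α) σ))
        fun y hy => hJ _ y hy
      map_one' := by
        refine LinearMap.ext fun w => ?_
        obtain ⟨y, rfl⟩ := Submodule.mkQ_surjective J w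
        show J.mkQ (MonoidAlgebra.of K (Perm α) 1 * y) = J.mkQ y
        rw [map_one, one_mul]
      map_mul' := fun σ τ => by
        refine LinearMap.ext fun w => ?_
        obtain ⟨y, rfl⟩ := Submodule.mkQ_surjective J w
        show J.mkQ (MonoidAlgebra.of K (Perm α) (σ * τ) * y) =
          J.mkQ (MonoidAlgebra.of K (Perm α) σ * (MonoidAlgebra.of K (Perm α) τ * y))
        rw [map_mul (MonoidAlgebra.of K (Perm α)), mul_assoc] }
  have hρ : ∀ σ y, ρ σ (J.mkQ y) = J.mkQ (MonoidAlgebra.of K (Perm α) σ * y) := fun σ y => rfl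
  have key : ∀ (s : ℤˣ) (S : Finset α), (∀ y, avg K s S * y ∈ J) →
      ∀ w ∈ (⊤ : Submodule K (MonoidAlgebra K (Perm α) ⧸ J)), SwapEigen ρ s S w → w = 0 := by
    intro s S hS w _ hw
    obtain ⟨y, rfl⟩ := Submodule.mkQ_surjective J w
    -- An eigenvector of the transpositions of `S` is, up to the invertible factor `|S|!`, its own
    -- twisted average, and the twisted averages lie in `J`.
    have h3 : J.mkQ (avg K s S * y) = (Fintype.card (Perm S) : K) • J.mkQ y := by
      rw [avg, Finset.sum_mul, map_sum]
      simp_rw [smul_mul_assoc, map_smul, ← hρ, hw.perm, smul_smul, units_mul_self_cast, one_smul]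
      rw [Finset.sum_const, Finset.card_univ, Nat.cast_smul_eq_nsmul]
    have h4 : J.mkQ (avg K s S * y) = 0 := by
      rw [Submodule.mkQ_apply, Submodule.Quotient.mk_eq_zero]
      exact hS y
    rw [h3] at h4
    exact (smul_eq_zero.1 h4).resolve_left (Nat.cast_ne_zero.2 Fintype.card_ne_zero)
  have h1 : (1 : MonoidAlgebra K (Perm α)) ∈ J := by
    rw [← Submodule.Quotient.mk_eq_zero]
    refine eq_zero_of_swapEigen ρ s _ a b rfl Finset.univ ⊤ (fun _ _ _ _ _ _ => trivial)
      (fun S _ hS => key s S fun y => ?_) (fun S _ hS => key (-s) S fun y => ?_) hab _ trivial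
    · refine Submodule.mem_sup_left ?_
      show F₁ _ = 0
      refine h₁ S hS _ fun x hx y' hy hxy => ?_
      have := congrArg F₁ (congrArg (· * y) (swap_mul_avg (K := K) s hx hy hxy))
      simp only [smul_mul_assoc, mul_assoc, map_smul] at this
      rw [← this, map_mul F₁ (MonoidAlgebra.of K _ _),
        show F₁ (MonoidAlgebra.of K _ (swap x y')) = f₁ (swap x y') from MonoidAlgebra.lift_of _ _]
    · refine Submodule.mem_sup_right ?_
      show F₂ _ = 0
      refine h₂ S hS _ fun x hx y' hy hxy => ?_
      have := congrArg F₂ (congrArg (· * y) (swap_mul_avg (K := K) (-s) hx hy hxy))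
      simp only [smul_mul_assoc, mul_assoc, map_smul] at this
      rw [← this, map_mul F₂ (MonoidAlgebra.of K _ _),
        show F₂ (MonoidAlgebra.of K _ (swap x y')) = f₂ (swap x y') from MonoidAlgebra.lift_of _ _]
  obtain ⟨u, hu, v, hv, huv⟩ := Submodule.mem_sup.1 h1
  refine ⟨u, hu, ?_⟩
  rw [← huv, add_sub_cancel_left]
  exact hv

end Swap

/-! ### Induction on permutations and shifted permutations -/

section PermInduction

open Equiv

/-- Permutations are generated by the exchange of the first two elements and extensions. -/
theorem perm_fin_induction {P : ∀ n, Perm (Fin n) → Prop} (one : ∀ n, P n 1)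
    (mul : ∀ n σ τ, P n σ → P n τ → P n (σ * τ)) (first : ∀ n, P (n + 2) (swap 0 1))
    (ext : ∀ n σ, P n σ → P (n + 1) (extPerm σ)) (n : ℕ) (σ : Perm (Fin n)) : P n σ := by
  have hadj : ∀ (n : ℕ) (i : Fin n), P (n + 1) (swap i.castSucc i.succ) := by
    intro n
    induction n with
    | zero => exact fun i => i.elim0
    | succ n ih =>
      intro i
      refine Fin.cases (first n) (fun j => ?_) i
      have := ext _ _ (ih j)
      rwa [extPerm_swap] at this
  rcases n with _ | n
  · rw [Subsingleton.elim σ 1]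
    exact one 0
  · have hσ : σ ∈ Submonoid.closure
        (Set.range fun i : Fin n => swap i.castSucc i.succ) := by
      rw [Perm.mclosure_swap_castSucc_succ]
      trivial
    induction hσ using Submonoid.closure_induction with
    | mem σ h =>
      obtain ⟨i, rfl⟩ := h
      exact hadj n i
    | one => exact one _
    | mul a b _ _ iha ihb => exact mul _ _ _ iha ihb

theorem exists_perm_comp_eq {n N : ℕ} {f g : Fin n → Fin N} (hf : Function.Injective f)
    (hg : Function.Injective g) : ∃ π : Perm (Fin N), ∀ i, π (f i) = g i := by
  classical
  let e : {x // x ∈ Set.range f} ≃ {x // x ∈ Set.range g} :=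
    (Equiv.ofInjective f hf).symm.trans (Equiv.ofInjective g hg)
  refine ⟨e.extendSubtype, fun i => ?_⟩
  rw [Equiv.extendSubtype_apply_of_mem e _ ⟨i, rfl⟩]
  have : (⟨f i, ⟨i, rfl⟩⟩ : {x // x ∈ Set.range f}) = Equiv.ofInjective f hf i := rfl
  rw [this]
  simp [e]

/-- Adding `k` fixed elements at the beginning. -/
def extN {n : ℕ} : (k : ℕ) → Perm (Fin n) → Perm (Fin (n + k))
  | 0, σ => σ
  | k + 1, σ => extPerm (extN k σ)

theorem extN_one {n : ℕ} (k : ℕ) : extN k (1 : Perm (Fin n)) = 1 := by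
  induction k with
  | zero => rfl
  | succ k ih => rw [extN, ih, extPerm_one]

theorem extN_mul {n : ℕ} (k : ℕ) (σ τ : Perm (Fin n)) :
    extN k (σ * τ) = extN k σ * extN k τ := by
  induction k with
  | zero => rfl
  | succ k ih => rw [extN, ih, extPerm_mul]; rfl

theorem extN_swap {n : ℕ} (k : ℕ) (x y : Fin n) :
    extN k (swap x y) = swap (x.addNat k) (y.addNat k) := by
  induction k with
  | zero => rfl
  | succ k ih => rw [extN, ih, extPerm_swap]; rfl

theorem sign_extPerm {n : ℕ} (σ : Perm (Fin n)) : Perm.sign (extPerm σ) = Perm.sign σ := by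
  simp [extPerm]

theorem tw_extPerm {n : ℕ} (s : ℤˣ) (σ : Perm (Fin n)) : tw s (extPerm σ) = tw s σ := by
  rcases Int.units_eq_one_or s with rfl | rfl
  · simp [tw_one]
  · simp only [tw_neg_one, sign_extPerm]

theorem tw_extN {n : ℕ} (s : ℤˣ) (k : ℕ) (σ : Perm (Fin n)) : tw s (extN k σ) = tw s σ := by
  induction k with
  | zero => rfl
  | succ k ih => rw [extN, tw_extPerm, ih]

end PermInduction

/-! ### Tensor powers of morphisms and their equivariance -/

section Pow

open Equiv

variable {C : Type u} [Category.{v} C] [MonoidalCategory C]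

/-- The tensor power of a morphism. -/
def powMap {X Y : C} (f : X ⟶ Y) : (n : ℕ) → (tensorPow X n ⟶ tensorPow Y n)
  | 0 => 𝟙 _
  | n + 1 => f ⊗ₘ powMap f n

theorem powMap_comp {X Y Z : C} (f : X ⟶ Y) (g : Y ⟶ Z) (n : ℕ) :
    powMap (f ≫ g) n = powMap f n ≫ powMap g n := by
  induction n with
  | zero => exact (Category.id_comp (𝟙 (𝟙_ C))).symm
  | succ n ih =>
    exact (congrArg (f ≫ g ⊗ₘ ·) ih).trans (tensorHom_comp_tensorHom _ _ _ _).symm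

theorem powMap_id (X : C) (n : ℕ) : powMap (𝟙 X) n = 𝟙 (tensorPow X n) := by
  induction n with
  | zero => rfl
  | succ n ih => rw [powMap, ih]; exact id_tensorHom_id X (tensorPow X n)

/-- The tensor product of `n` endomorphisms. -/
def tens {M : C} : (n : ℕ) → (Fin n → (M ⟶ M)) → (tensorPow M n ⟶ tensorPow M n)
  | 0, _ => 𝟙 _
  | n + 1, g => g 0 ⊗ₘ tens n (Fin.tail g)

theorem tens_comp {M : C} (n : ℕ) (g h : Fin n → (M ⟶ M)) :
    tens n g ≫ tens n h = tens n (fun i => g i ≫ h i) := by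
  induction n with
  | zero => exact Category.id_comp (𝟙 (𝟙_ C))
  | succ n ih =>
    exact (tensorHom_comp_tensorHom _ _ _ _).trans (congrArg (g 0 ≫ h 0 ⊗ₘ ·) (ih _ _))

theorem tens_const {M : C} (n : ℕ) (f : M ⟶ M) : tens n (fun _ => f) = powMap f n := by
  induction n with
  | zero => rfl
  | succ n ih => rw [tens, powMap, ← ih]; rfl

theorem tens_zero [Preadditive C] [MonoidalPreadditive C] {M : C} (n : ℕ)
    (g : Fin n → (M ⟶ M)) (i : Fin n) (hi : g i = 0) : tens n g = 0 := by
  induction n with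
  | zero => exact i.elim0
  | succ n ih =>
    rw [tens]
    rcases Fin.eq_zero_or_eq_succ i with rfl | ⟨j, rfl⟩
    · rw [hi]
      exact MonoidalPreadditive.zero_tensor _
    · rw [ih (Fin.tail g) j hi]
      exact MonoidalPreadditive.tensor_zero _

/-- Tensoring an endomorphism on the left with the identity of a power. -/
def whiskN {X : C} {n : ℕ} (f : tensorPow X n ⟶ tensorPow X n) :
    (k : ℕ) → (tensorPow X (n + k) ⟶ tensorPow X (n + k))
  | 0 => f
  | k + 1 => X ◁ whiskN f k

variable [SymmetricCategory C]

/-- The action of a permutation, as a morphism. -/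
def pm (X : C) (n : ℕ) (σ : Perm (Fin n)) : tensorPow X n ⟶ tensorPow X n := permAction X n σ

theorem pm_one (X : C) (n : ℕ) : pm X n 1 = 𝟙 _ := map_one (permAction X n)

theorem pm_mul (X : C) (n : ℕ) (σ τ : Perm (Fin n)) : pm X n (σ * τ) = pm X n τ ≫ pm X n σ :=
  map_mul (permAction X n) σ τ

theorem pm_swap (X : C) (n : ℕ) : pm X (n + 2) (swap 0 1) = swapTwo X (tensorPow X n) :=
  permAction_swap X n

theorem pm_extPerm (X : C) (n : ℕ) (σ : Perm (Fin n)) :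
    pm X (n + 1) (extPerm σ) = X ◁ pm X n σ := permAction_extPerm X n σ

theorem pm_extN (X : C) (n k : ℕ) (σ : Perm (Fin n)) :
    pm X (n + k) (extN k σ) = whiskN (pm X n σ) k := by
  induction k with
  | zero => rfl
  | succ k ih => exact (pm_extPerm X (n + k) (extN k σ)).trans (by rw [ih]; rfl)

theorem swapTwo_natural {X Y Z W : C} (f f' : X ⟶ Y) (g : Z ⟶ W) :
    (f ⊗ₘ (f' ⊗ₘ g)) ≫ swapTwo Y W = swapTwo X Z ≫ (f' ⊗ₘ (f ⊗ₘ g)) := by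
  simp only [swapTwo, Category.assoc]
  rw [associator_inv_naturality_assoc, ← associator_naturality]
  have : ((f ⊗ₘ f') ⊗ₘ g) ≫ (β_ Y Y).hom ▷ W = (β_ X X).hom ▷ Z ≫ ((f' ⊗ₘ f) ⊗ₘ g) := by
    rw [← tensorHom_id, ← tensorHom_id, tensorHom_comp_tensorHom, tensorHom_comp_tensorHom,
      BraidedCategory.braiding_naturality, Category.id_comp, Category.comp_id]
  rw [reassoc_of% this]

theorem pm_powMap {X Y : C} (f : X ⟶ Y) (n : ℕ) (σ : Perm (Fin n)) :
    pm X n σ ≫ powMap f n = powMap f n ≫ pm Y n σ := by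
  induction n, σ using perm_fin_induction with
  | one n => rw [pm_one, pm_one, Category.id_comp, Category.comp_id]
  | mul n σ τ h1 h2 =>
    rw [pm_mul, pm_mul, Category.assoc, h1, ← Category.assoc, h2, Category.assoc]
  | first n =>
    rw [pm_swap, pm_swap]
    exact (swapTwo_natural f f (powMap f n)).symm
  | ext n σ h =>
    rw [pm_extPerm, pm_extPerm, powMap, ← id_tensorHom, ← id_tensorHom]
    refine (tensorHom_comp_tensorHom _ _ _ _).trans (Eq.trans ?_
      (tensorHom_comp_tensorHom _ _ _ _).symm)
    rw [h, Category.id_comp, Category.comp_id]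

theorem tens_pm {M : C} (n : ℕ) (σ : Perm (Fin n)) : ∀ (g : Fin n → (M ⟶ M)),
    tens n g ≫ pm M n σ = pm M n σ ≫ tens n (fun i => g (σ⁻¹ i)) := by
  induction n, σ using perm_fin_induction with
  | one n => intro g; rw [pm_one, Category.id_comp, Category.comp_id]; rfl
  | mul n σ τ h1 h2 =>
    intro g
    rw [pm_mul, ← Category.assoc, h2, Category.assoc, h1, Category.assoc, mul_inv_rev]
    rfl
  | first n =>
    intro g
    rw [pm_swap]
    refine (swapTwo_natural (g 0) (g 1) (tens n (Fin.tail (Fin.tail g)))).trans ?_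
    congr 1
  | ext n σ h =>
    intro g
    have hi : ∀ x, (extPerm σ)⁻¹ x = extPerm σ⁻¹ x := fun x => by
      rw [Perm.inv_eq_iff_eq, ← Perm.mul_apply, ← extPerm_mul, mul_inv_cancel, extPerm_one]; rfl
    rw [pm_extPerm, tens, tens, ← id_tensorHom]
    refine (tensorHom_comp_tensorHom _ _ _ _).trans (Eq.trans ?_
      (tensorHom_comp_tensorHom _ _ _ _).symm)
    rw [h, Category.id_comp, Category.comp_id, hi, extPerm_zero]
    congr 2

end Pow

/-! ### Antisymmetrizers and the morphisms which they annihilate -/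

section Alt

open Equiv

variable (K : Type*) [Field K] [CharZero K]
variable {C : Type u} [Category.{v} C] [Preadditive C] [Linear K C] [MonoidalCategory C]
  [SymmetricCategory C]

/-- The antisymmetrizer for `s = 1`, the symmetrizer for `s = -1`. -/
def alt (s : ℤˣ) (M : C) (n : ℕ) : tensorPow M n ⟶ tensorPow M n :=
  (n.factorial : K)⁻¹ • ∑ σ : Perm (Fin n), (((tw (-s) σ : ℤˣ) : ℤ) : K) • pm M n σ

theorem alt_one (M : C) (n : ℕ) : alt K 1 M n = antisymmetrizer K M n := by
  simp only [alt, tw_neg_one]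
  rfl

theorem alt_neg_one (M : C) (n : ℕ) : alt K (-1) M n = symmetrizer K M n := by
  simp only [alt, neg_neg, tw_one, Units.val_one, Int.cast_one, one_smul]
  rfl

theorem alt_idem (s : ℤˣ) (M : C) (n : ℕ) : alt K s M n ≫ alt K s M n = alt K s M n := by
  rcases Int.units_eq_one_or s with rfl | rfl
  · rw [alt_one, antisymmetrizer_idem]
  · rw [alt_neg_one, symmetrizer_idem]

theorem alt_pm (s : ℤˣ) (M : C) (n : ℕ) (τ : Perm (Fin n)) :
    alt K s M n ≫ pm M n τ = (((tw (-s) τ : ℤˣ) : ℤ) : K) • alt K s M n := by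
  rw [alt, Linear.smul_comp, Preadditive.sum_comp,
    smul_comm _ (n.factorial : K)⁻¹]
  congr 1
  rw [Finset.smul_sum]
  refine Fintype.sum_equiv (Equiv.mulLeft τ) _ _ fun σ => ?_
  rw [Equiv.coe_mulLeft, pm_mul, Linear.smul_comp, smul_smul, map_mul]
  push_cast
  rw [← mul_assoc, units_mul_self_cast, one_mul]

theorem pm_alt (s : ℤˣ) (M : C) (n : ℕ) (τ : Perm (Fin n)) :
    pm M n τ ≫ alt K s M n = (((tw (-s) τ : ℤˣ) : ℤ) : K) • alt K s M n := by
  rw [alt, Linear.comp_smul, Preadditive.comp_sum,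
    smul_comm _ (n.factorial : K)⁻¹]
  congr 1
  rw [Finset.smul_sum]
  refine Fintype.sum_equiv (Equiv.mulRight τ) _ _ fun σ => ?_
  rw [Equiv.coe_mulRight, pm_mul, Linear.comp_smul, smul_smul, map_mul]
  push_cast
  rw [mul_comm (((tw (-s) σ : ℤˣ) : ℤ) : K), ← mul_assoc, units_mul_self_cast, one_mul]

theorem alt_powMap (s : ℤˣ) {X Y : C} (f : X ⟶ Y) (n : ℕ) :
    alt K s X n ≫ powMap f n = powMap f n ≫ alt K s Y n := by
  simp only [alt, Linear.smul_comp, Linear.comp_smul, Preadditive.sum_comp, Preadditive.comp_sum,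
    pm_powMap]

/-- The action of the symmetric group on the morphisms to a tensor power. -/
def postRep (Z X : C) (n : ℕ) : Perm (Fin n) →* Module.End K (Z ⟶ tensorPow X n) where
  toFun σ := Linear.rightComp K Z (pm X n σ)
  map_one' := by
    refine LinearMap.ext fun z => ?_
    simp [pm_one]
  map_mul' σ τ := by
    refine LinearMap.ext fun z => ?_
    simp [pm_mul]

theorem postRep_apply (Z X : C) (n : ℕ) (σ : Perm (Fin n)) (z : Z ⟶ tensorPow X n) :
    postRep K Z X n σ z = z ≫ pm X n σ := rfl

variable [MonoidalPreadditive C] [MonoidalLinear K C]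

theorem whiskN_zero (X : C) (n k : ℕ) :
    whiskN (0 : tensorPow X n ⟶ tensorPow X n) k = 0 := by
  induction k with
  | zero => rfl
  | succ k ih => rw [whiskN, ih]; exact MonoidalPreadditive.whiskerLeft_zero

theorem whiskN_alt (s : ℤˣ) (X : C) (n k : ℕ) : whiskN (alt K s X n) k =
    (n.factorial : K)⁻¹ • ∑ σ : Perm (Fin n), (((tw (-s) σ : ℤˣ) : ℤ) : K) •
      pm X (n + k) (extN k σ) := by
  simp_rw [pm_extN]
  induction k with
  | zero => rfl
  | succ k ih =>
    rw [whiskN, ih]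
    refine (MonoidalLinear.whiskerLeft_smul _ _ _).trans ?_
    congr 1
    refine (whiskerLeft_sum _ _ _).trans ?_
    refine Finset.sum_congr rfl fun σ _ => ?_
    exact MonoidalLinear.whiskerLeft_smul _ _ _

/-- A morphism to `X^{⊗ N}` which is antisymmetric in `n` variables is zero if `Λⁿ(X)` is. -/
theorem eq_zero_of_alt_eq_zero (s : ℤˣ) {X : C} {n : ℕ} (h : alt K s X n = 0) {N : ℕ}
    {S : Finset (Fin N)} (hS : S.card = n) {Z : C} {z : Z ⟶ tensorPow X N}
    (hz : SwapEigen (postRep K Z X N) (-s) S z) : z = 0 := by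
  obtain ⟨k, rfl⟩ : ∃ k, N = n + k := by
    have := S.card_le_univ
    rw [hS, Fintype.card_fin] at this
    exact ⟨N - n, by omega⟩
  let e : Fin n ≃ S := (Fintype.equivFinOfCardEq (by simpa using hS)).symm
  -- Conjugation by `π` moves `S` to the last `n` positions, where the antisymmetrizer is the
  -- identity of `X^{⊗ k}` tensored with `alt K s X n`.
  obtain ⟨π, hπ⟩ := exists_perm_comp_eq (f := fun i : Fin n => i.addNat k)
    (g := fun i => (e i : Fin (n + k))) (fun _ _ h => Fin.addNat_inj k |>.1 h)
    (Subtype.val_injective.comp e.injective)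
  set z' := z ≫ pm X (n + k) π⁻¹ with hz'
  have h1 : SwapEigen ((postRep K Z X (n + k)).comp
      (⟨⟨extN k, extN_one k⟩, extN_mul k⟩ : Perm (Fin n) →* Perm (Fin (n + k)))) (-s)
      Finset.univ z' := by
    intro i _ j _ hij
    show z' ≫ pm X (n + k) (extN k (swap i j)) = _
    have h2 : extN k (swap i j) * π⁻¹ = π⁻¹ * swap (e i : Fin (n + k)) (e j) := by
      have := Equiv.mul_swap_eq_swap_mul π⁻¹ (e i : Fin (n + k)) (e j)
      rw [this, extN_swap, ← hπ, ← hπ, Perm.inv_def, Equiv.symm_apply_apply, Equiv.symm_apply_apply]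
    have h3 := hz (e i) (e i).2 (e j) (e j).2
      (fun h => hij (e.injective (Subtype.ext h)))
    rw [postRep_apply] at h3
    rw [hz', Category.assoc, ← pm_mul, h2, pm_mul, ← Category.assoc, h3, Linear.smul_comp]
  -- Each signed permutation fixes `z'`, hence so does their average, which is zero by hypothesis.
  have h2 : z' ≫ whiskN (alt K s X n) k = z' := by
    rw [whiskN_alt, Linear.comp_smul, Preadditive.comp_sum]
    have : ∀ σ : Perm (Fin n), z' ≫ ((((tw (-s) σ : ℤˣ) : ℤ) : K) • pm X (n + k) (extN k σ)) =
        z' := by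
      intro σ
      have := h1.perm_univ σ
      rw [Linear.comp_smul]
      refine (congrArg (_ • ·) this).trans ?_
      rw [smul_smul, units_mul_self_cast, one_smul]
    simp_rw [this]
    rw [Finset.sum_const, Finset.card_univ, Fintype.card_perm, Fintype.card_fin,
      ← Nat.cast_smul_eq_nsmul K, smul_smul,
      inv_mul_cancel₀ (Nat.cast_ne_zero.2 n.factorial_ne_zero), one_smul]
  rw [h, whiskN_zero, comp_zero] at h2
  have h3 : z = z' ≫ pm X (n + k) π := by
    rw [hz', Category.assoc, ← pm_mul, mul_inv_cancel, pm_one, Category.comp_id]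
  rw [h3, ← h2, zero_comp]

/-- The tensor power of a morphism from a positive to a negative object vanishes. -/
theorem exists_powMap_eq_zero {X Y : C} (s : ℤˣ) {a b : ℕ} (hX : alt K s X (a + 1) = 0)
    (hY : alt K (-s) Y (b + 1) = 0) (f : X ⟶ Y) : powMap f (a * b + 1) = 0 := by
  obtain ⟨y, h1, h2⟩ := exists_mem_ker_of_swapEigen (K := K) (permAction X (a * b + 1))
    (permAction Y (a * b + 1)) (-s) a b
    (fun S hS z hz => eq_zero_of_alt_eq_zero K s hX hS hz)
    (fun S hS z hz => eq_zero_of_alt_eq_zero K (-s) hY hS hz) (by simp)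
  -- The power of `f` intertwines the two actions of the group algebra. The element `y` acts as `0`
  -- on the source and as `1` on the target, so the power of `f` vanishes.
  have key : ∀ y : MonoidAlgebra K (Perm (Fin (a * b + 1))),
      End.asHom (MonoidAlgebra.lift K _ _ (permAction X (a * b + 1)) y) ≫ powMap f _ =
      powMap f _ ≫ End.asHom (MonoidAlgebra.lift K _ _ (permAction Y (a * b + 1)) y) := by
    intro y
    induction y using MonoidAlgebra.induction_on with
    | of σ =>
      rw [MonoidAlgebra.lift_of, MonoidAlgebra.lift_of]
      exact pm_powMap f _ σ
    | add x y hx hy =>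
      rw [map_add, map_add]
      exact (Preadditive.add_comp _ _ _ _ _ _).trans ((congrArg₂ (· + ·) hx hy).trans
        (Preadditive.comp_add _ _ _ _ _ _).symm)
    | smul c x hx =>
      rw [map_smul, map_smul]
      exact (Linear.smul_comp _ _ _ _ _ _).trans ((congrArg (c • ·) hx).trans
        (Linear.comp_smul _ _ _ _ _ _).symm)
  have k1 := key y
  rw [h1] at k1
  have k2 := key (1 - y)
  rw [h2] at k2
  have k3 : powMap f (a * b + 1) ≫
      End.asHom (MonoidAlgebra.lift K _ _ (permAction Y (a * b + 1)) y) = 0 :=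
    k1.symm.trans zero_comp
  have k4 := congrArg (fun z => z) (sub_eq_zero.1 ((map_sub _ _ _).symm.trans h2))
  rw [← k4, map_one] at k3
  exact (Category.comp_id _).symm.trans k3

end Alt

/-! ### Scalar traces, Euler characteristics and the dimensions of powers -/

section LinearTrace

open Equiv

variable (K : Type*) [Field K]
variable {C : Type u} [Category.{v} C] [Preadditive C] [Linear K C] [MonoidalCategory C]
  [SymmetricCategory C] [MonoidalPreadditive C] [MonoidalLinear K C] [RigidCategory C]
  [hK : Fact (Function.Bijective (algebraMap K (End (𝟙_ C))))]

/-- The identification of the endomorphisms of the unit object with `K`. -/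
def unitScalar : End (𝟙_ C) ≃ₐ[K] K :=
  (AlgEquiv.ofBijective (Algebra.ofId K (End (𝟙_ C))) hK.out).symm

theorem unitScalar_smul_id (f : 𝟙_ C ⟶ 𝟙_ C) : unitScalar K (C := C) f • 𝟙 (𝟙_ C) = f :=
  (AlgEquiv.ofBijective (Algebra.ofId K (End (𝟙_ C))) hK.out).apply_symm_apply f

/-- The trace of an endomorphism. -/
def tr (X : C) : (X ⟶ X) →ₗ[K] K where
  toFun f := unitScalar K (C := C) (trPair X (Xᘁ) f)
  map_add' f g := by
    have : trPair X (Xᘁ) (f + g) = trPair X (Xᘁ) f + trPair X (Xᘁ) g := by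
      simp [trPair, MonoidalPreadditive.add_whiskerRight]
    rw [this]
    exact map_add (unitScalar K (C := C)) _ _
  map_smul' c f := by
    have : trPair X (Xᘁ) (c • f) = c • trPair X (Xᘁ) f := by
      simp [trPair, MonoidalLinear.smul_whiskerRight]
    rw [this]
    exact map_smul (unitScalar K (C := C)) _ _

/-- The partial trace over the left factor. -/
def ptrace (X Z : C) : (X ⊗ Z ⟶ X ⊗ Z) →ₗ[K] (Z ⟶ Z) where
  toFun f := ptr X (Xᘁ) f
  map_add' f g := by
    simp [ptr, MonoidalPreadditive.whiskerLeft_add]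
  map_smul' c f := by
    simp [ptr, MonoidalLinear.whiskerLeft_smul]

variable {K}

theorem tr_smul_id {X : C} (f : X ⟶ X) : tr K X f • 𝟙 (𝟙_ C) = trPair X (Xᘁ) f :=
  unitScalar_smul_id K _

theorem tr_comm {X Y : C} (f : X ⟶ Y) (g : Y ⟶ X) : tr K X (f ≫ g) = tr K Y (g ≫ f) :=
  congrArg (unitScalar K (C := C)) (trPair_comm f g)

theorem tr_ptrace {X Z : C} (f : X ⊗ Z ⟶ X ⊗ Z) : tr K (X ⊗ Z) f = tr K Z (ptrace K X Z f) :=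
  congrArg (unitScalar K (C := C)) ((trPair_indep (E := Zᘁ ⊗ Xᘁ) f).trans (trPair_tensor f))

theorem ptrace_whisker {X Z : C} (g g' : Z ⟶ Z) (f : X ⊗ Z ⟶ X ⊗ Z) :
    ptrace K X Z (X ◁ g ≫ f ≫ X ◁ g') = g ≫ ptrace K X Z f ≫ g' :=
  ptr_whisker X (Xᘁ) g f g'

theorem ptrace_whiskerRight {X Z : C} (f : X ⟶ X) :
    ptrace K X Z (f ▷ Z) = tr K X f • 𝟙 Z := by
  refine (ptr_whiskerRight X (Xᘁ) f).trans ?_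
  rw [← tr_smul_id (K := K), MonoidalLinear.smul_whiskerRight]
  simp

theorem ptrace_tensor {X Z : C} (f : X ⟶ X) (g : Z ⟶ Z) :
    ptrace K X Z (f ⊗ₘ g) = tr K X f • g := by
  have : (f ⊗ₘ g) = X ◁ 𝟙 Z ≫ f ▷ Z ≫ X ◁ g := by simp [MonoidalCategory.tensorHom_def]
  rw [this, ptrace_whisker, ptrace_whiskerRight]
  simp

theorem tr_tensor {X Z : C} (f : X ⟶ X) (g : Z ⟶ Z) :
    tr K (X ⊗ Z) (f ⊗ₘ g) = tr K X f * tr K Z g := by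
  rw [tr_ptrace, ptrace_tensor, map_smul, smul_eq_mul]

theorem ptrace_swapTwo (X Z : C) : ptrace K X (X ⊗ Z) (swapTwo X Z) = 𝟙 _ :=
  ptr_swapTwo X (Xᘁ) Z

theorem tr_unit (f : 𝟙_ C ⟶ 𝟙_ C) : tr K (𝟙_ C) f • 𝟙 (𝟙_ C) = f := by
  rw [tr_smul_id, trPair_indep (E := 𝟙_ C), trPair]
  show (ρ_ (𝟙_ C)).inv ≫ f ▷ 𝟙_ C ≫ (β_ (𝟙_ C) (𝟙_ C)).hom ≫ (ρ_ (𝟙_ C)).hom = f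
  rw [braiding_rightUnitor, unitors_equal, rightUnitor_naturality, Iso.inv_hom_id_assoc]

theorem id_unit_ne_zero (K : Type*) [Field K] [Linear K C]
    [hK : Fact (Function.Bijective (algebraMap K (End (𝟙_ C))))] : 𝟙 (𝟙_ C) ≠ 0 := by
  intro h
  have h1 : algebraMap K (End (𝟙_ C)) 1 = algebraMap K (End (𝟙_ C)) 0 := by
    rw [map_one, map_zero]
    exact h
  exact one_ne_zero (hK.out.1 h1)

theorem smul_id_unit_injective {a b : K} (h : a • 𝟙 (𝟙_ C) = b • 𝟙 (𝟙_ C)) : a = b := by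
  by_contra hne
  have h1 : (a - b) • 𝟙 (𝟙_ C) = 0 := by rw [sub_smul, h, sub_self]
  exact id_unit_ne_zero K ((smul_eq_zero.1 h1).resolve_left (sub_ne_zero.2 hne))

theorem tr_id_unit : tr K (𝟙_ C) (𝟙 _) = 1 :=
  smul_id_unit_injective (C := C) (by rw [tr_unit, one_smul])

variable (K) in
/-- The Euler characteristic, as an element of `K`. -/
def chi (X : C) : K := tr K X (𝟙 X)

theorem chi_smul_id (X : C) : chi K X • 𝟙 (𝟙_ C) = eulerChar X := by
  rw [chi, tr_smul_id, trPair, id_whiskerRight, Category.id_comp]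
  rfl

theorem tr_of_isIm {X Y : C} {p : X ⟶ X} (h : IsIm p Y) : tr K X p = chi K Y := by
  obtain ⟨i, r, hi, rfl⟩ := h
  rw [tr_comm, hi, chi]

theorem chi_iso {X Y : C} (e : X ≅ Y) : chi K X = chi K Y := by
  rw [chi, ← e.hom_inv_id, tr_comm, e.inv_hom_id, chi]

theorem chi_tensor (X Y : C) : chi K (X ⊗ Y) = chi K X * chi K Y := by
  rw [chi, ← id_tensorHom_id, tr_tensor, chi, chi]

theorem chi_biprod [HasBinaryBiproducts C] (X Y : C) : chi K (X ⊞ Y) = chi K X + chi K Y := by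
  rw [chi, ← biprod.total, map_add, tr_comm, tr_comm (biprod.snd), biprod.inl_fst,
    biprod.inr_snd, chi, chi]

theorem decomposeFin_symm_eq {n : ℕ} (p : Fin (n + 1)) (e : Perm (Fin n)) :
    Perm.decomposeFin.symm (p, e) = swap 0 p * extPerm e := by
  refine Equiv.ext fun x => ?_
  refine Fin.cases ?_ (fun y => ?_) x
  · simp [extPerm_zero]
  · simp [extPerm_succ]

/-- If `p = 0`, the first strand closes to a loop of value `χ(X)`. Otherwise `swap 0 p` is conjugate
to `swap 0 1` by a permutation fixing `0`; such permutations can be pulled out of the partial trace,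
and the partial trace of `swap 0 1` is the identity. -/
theorem ptrace_pm (X : C) (n : ℕ) (p : Fin (n + 1)) (e : Perm (Fin n)) :
    ptrace K X (tensorPow X n) (pm X (n + 1) (swap 0 p * extPerm e)) =
      (if p = 0 then chi K X else 1) • pm X n e := by
  rcases Fin.eq_zero_or_eq_succ p with rfl | ⟨q, rfl⟩
  · rw [swap_self, if_pos rfl]
    have : pm X (n + 1) (Equiv.refl _ * extPerm e) = (𝟙 X ⊗ₘ pm X n e) := by
      rw [id_tensorHom, ← pm_extPerm]; rfl
    exact (congrArg _ this).trans (ptrace_tensor _ _)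
  · rw [if_neg (Fin.succ_ne_zero q), one_smul]
    rcases n with _ | n
    · exact q.elim0
    have h1 : swap 0 q.succ = extPerm (swap 0 q) * swap 0 1 * extPerm (swap 0 q) := by
      have h2 := Equiv.mul_swap_eq_swap_mul (extPerm (swap 0 q)) 0 1
      have h3 : (1 : Fin (n + 2)) = Fin.succ 0 := rfl
      rw [extPerm_zero, h3, extPerm_succ, swap_apply_left, ← h3] at h2
      rw [h2, mul_assoc, ← extPerm_mul, swap_mul_self, extPerm_one, mul_one]
    have h2 : pm X (n + 2) (swap 0 q.succ * extPerm e) =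
        X ◁ (pm X (n + 1) (swap 0 q * e)) ≫ swapTwo X (tensorPow X n) ≫
          X ◁ pm X (n + 1) (swap 0 q) := by
      rw [h1, mul_assoc, ← extPerm_mul, pm_mul, pm_mul, pm_swap, pm_extPerm, pm_extPerm]
      rfl
    refine (congrArg _ h2).trans ((ptrace_whisker _ _ _).trans ?_)
    refine (congrArg (fun f => _ ≫ f ≫ _) (ptrace_swapTwo X (tensorPow X n))).trans ?_
    refine (congrArg (_ ≫ ·) (Category.id_comp _)).trans ?_
    refine (pm_mul X (n + 1) (swap 0 q) (swap 0 q * e)).symm.trans ?_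
    rw [← mul_assoc, swap_mul_self, one_mul]

variable [CharZero K]

theorem alt_zero (s : ℤˣ) (X : C) : alt K s X 0 = 𝟙 _ := by
  rw [alt, Fintype.sum_subsingleton _ 1, pm_one]
  simp

/-- Each permutation of `n + 1` points is `swap 0 p * extPerm e`. The case `p = 0` contributes
`χ(X)`, and each of the `n` other values of `p` contributes the character value `-s`. -/
theorem ptrace_alt (s : ℤˣ) (X : C) (n : ℕ) :
    ptrace K X (tensorPow X n) (alt K s X (n + 1)) =
      (((n + 1 : ℕ) : K)⁻¹ * (chi K X - ((s : ℤ) : K) * n)) • alt K s X n := by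
  have h1 : ptrace K X (tensorPow X n) (alt K s X (n + 1)) = ((n + 1).factorial : K)⁻¹ •
      ∑ q : Fin (n + 1) × Perm (Fin n), (((tw (-s) (swap 0 q.1 * extPerm q.2) : ℤˣ) : ℤ) : K) •
        (if q.1 = 0 then chi K X else 1) • pm X n q.2 := by
    refine (map_smul (ptrace K X (tensorPow X n)) _ _).trans ?_
    congr 1
    refine (map_sum (ptrace K X (tensorPow X n)) _ _).trans ?_
    refine (Fintype.sum_equiv Perm.decomposeFin.symm _ _ fun q => ?_).symm
    obtain ⟨p, e⟩ := q
    rw [decomposeFin_symm_eq]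
    refine Eq.trans ?_ (map_smul (ptrace K X (tensorPow X n)) _ _).symm
    rw [ptrace_pm]
  have h2 : ∀ (p : Fin (n + 1)) (e : Perm (Fin n)),
      (((tw (-s) (swap 0 p * extPerm e) : ℤˣ) : ℤ) : K) •
        (if p = 0 then chi K X else 1) • pm X n e = (if p = 0 then chi K X else -((s : ℤ) : K)) •
        (((tw (-s) e : ℤˣ) : ℤ) : K) • pm X n e := by
    intro p e
    rw [map_mul, tw_extPerm]
    split_ifs with hp
    · subst hp
      rw [swap_self, show (Equiv.refl (Fin (n + 1))) = 1 from rfl, map_one, one_mul, smul_comm]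
    · rw [tw_swap _ (Ne.symm hp), one_smul, smul_smul]
      push_cast
      rfl
  rw [h1, Fintype.sum_prod_type]
  simp_rw [h2, ← Finset.smul_sum]
  rw [← Finset.sum_smul, Fin.sum_univ_succ, alt, smul_smul, smul_smul]
  congr 1
  simp only [if_true, Fin.succ_ne_zero, if_false, Finset.sum_const, Finset.card_univ,
    Fintype.card_fin, nsmul_eq_mul]
  rw [Nat.factorial_succ]
  push_cast
  rw [mul_inv]
  ring

/-- `X` is positive (if `s = 1`) or negative (if `s = -1`) of dimension `d`. -/
structure Signed (K : Type*) [Field K] [CharZero K] [Linear K C] [MonoidalLinear K C]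
    [Fact (Function.Bijective (algebraMap K (End (𝟙_ C))))] (s : ℤˣ) (d : ℕ) (X : C) : Prop where
  alt_eq_zero : alt K s X (d + 1) = 0
  chi_eq : chi K X = ((s : ℤ) : K) * d

/-- By `ptrace_alt`, the vanishing of `alt` at `N + 1` implies that `χ(X) = s N` or that `alt`
already vanishes at `N`. The descent stops because `alt` at `0` is the identity of the unit object,
which is not zero. -/
theorem exists_signed (s : ℤˣ) {X : C} : ∀ {N : ℕ}, alt K s X N = 0 → ∃ d, Signed K s d X
  | 0, h => by
    rw [alt_zero] at h
    exact absurd h (id_unit_ne_zero K)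
  | N + 1, h => by
    have h1 := ptrace_alt (K := K) s X N
    rw [h] at h1
    have h2 := (smul_eq_zero.1 (h1.symm.trans (map_zero _)))
    rcases h2 with h2 | h2
    · refine ⟨N, h, ?_⟩
      have := (mul_eq_zero.1 h2).resolve_left (inv_ne_zero (Nat.cast_ne_zero.2 N.succ_ne_zero))
      exact sub_eq_zero.1 this
    · exact exists_signed s h2

theorem tr_alt_succ (s : ℤˣ) (X : C) (n : ℕ) : tr K _ (alt K s X (n + 1)) =
    ((n + 1 : ℕ) : K)⁻¹ * (chi K X - ((s : ℤ) : K) * n) * tr K _ (alt K s X n) := by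
  refine (tr_ptrace _).trans ?_
  rw [ptrace_alt, map_smul, smul_eq_mul]

/-- The dimension of an exterior power (`t = 1`) or a symmetric power (`t = -1`). -/
theorem tr_alt (t : ℤˣ) (X : C) (n : ℕ) {x : ℤ} (hx : chi K X = x) :
    tr K _ (alt K t X n) = (((t : ℤ) ^ n * Ring.choose ((t : ℤ) * x) n : ℤ) : K) := by
  induction n with
  | zero =>
    rw [alt_zero, Ring.choose_zero_right]
    exact tr_id_unit.trans (by simp)
  | succ n ih =>
    have ht : (t : ℤ) * t = 1 := by rcases Int.units_eq_one_or t with rfl | rfl <;> simp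
    have h1 : ((n + 1 : ℕ) : ℤ) * Ring.choose ((t : ℤ) * x) (n + 1) =
        ((t : ℤ) * x - n) * Ring.choose ((t : ℤ) * x) n := by
      have := Ring.choose_smul_choose ((t : ℤ) * x) (Nat.le_succ n)
      rw [Nat.succ_eq_add_one, Nat.choose_succ_self_right, Nat.add_sub_cancel_left,
        Ring.choose_one_right, nsmul_eq_mul] at this
      rw [this, mul_comm]
    have h2 : ((n + 1 : ℕ) : ℤ) * ((t : ℤ) ^ (n + 1) * Ring.choose ((t : ℤ) * x) (n + 1)) =
        (x - t * n) * ((t : ℤ) ^ n * Ring.choose ((t : ℤ) * x) n) := by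
      linear_combination (t : ℤ) ^ (n + 1) * h1 + (t : ℤ) ^ n * Ring.choose ((t : ℤ) * x) n * x * ht
    have h3 : ((n + 1 : ℕ) : K) ≠ 0 := Nat.cast_ne_zero.2 n.succ_ne_zero
    have h4 := congrArg (fun z : ℤ => (z : K)) h2
    rw [tr_alt_succ, ih, hx, mul_assoc, inv_mul_eq_iff_eq_mul₀ h3]
    push_cast at h4 ⊢
    rw [h4]

end LinearTrace

/-! ### Nilpotence, and uniqueness of the positive and negative parts -/

section Nilpotent

variable {K : Type*} [Field K]
variable {C : Type u} [Category.{v} C] [Preadditive C] [Linear K C] [MonoidalCategory C]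
  [SymmetricCategory C] [MonoidalPreadditive C] [MonoidalLinear K C] [RigidCategory C]
  [hK : Fact (Function.Bijective (algebraMap K (End (𝟙_ C))))]

theorem ptr_tensor_swapTwo {X Z : C} (f h : X ⟶ X) (z : Z ⟶ Z) :
    ptr X (Xᘁ) ((f ⊗ₘ (h ⊗ₘ z)) ≫ swapTwo X Z) = (h ≫ f) ⊗ₘ z := by
  have h1 : (f ⊗ₘ (h ⊗ₘ z)) ≫ swapTwo X Z =
      X ◁ (h ⊗ₘ z) ≫ swapTwo X Z ≫ X ◁ (f ⊗ₘ 𝟙 Z) := by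
    have h2 := swapTwo_natural f (𝟙 X) (𝟙 Z)
    rw [← id_tensorHom, ← id_tensorHom, ← h2, ← Category.assoc, tensorHom_comp_tensorHom]
    simp
  rw [h1, ptr_whisker, ptr_swapTwo, Category.id_comp, tensorHom_comp_tensorHom,
    Category.comp_id]

/-- Exchanging the first two factors of `h ^ a ⊗ h ⊗ ⋯` and closing the first strand joins the two
factors into `h ^ (a + 1)`. Repeating this consumes the tensor power and leaves a vanishing power of
`h`. -/
theorem exists_pow_eq_zero_of_tensor_powMap {X : C} (h : End X) (m : ℕ) : ∀ a : ℕ,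
    End.asHom (h ^ a) ⊗ₘ powMap (End.asHom h) m = 0 → ∃ N : ℕ, h ^ N = 0 := by
  induction m with
  | zero =>
    intro a ha
    refine ⟨a, ?_⟩
    have h1 : End.asHom (h ^ a) ▷ 𝟙_ C = 0 := by
      rw [← tensorHom_id]
      exact ha
    rw [whiskerRight_id] at h1
    have h2 := congrArg (fun x => (ρ_ X).inv ≫ x ≫ (ρ_ X).hom) h1
    simp only [Category.assoc, Iso.inv_hom_id_assoc, Iso.inv_hom_id, Category.comp_id,
      zero_comp, comp_zero] at h2
    exact h2
  | succ m ih =>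
    intro a ha
    refine ih (a + 1) ?_
    have h1 := ptr_tensor_swapTwo (End.asHom (h ^ a)) (End.asHom h)
      (powMap (End.asHom h) m)
    have h2 : End.asHom (h ^ a) ⊗ₘ (End.asHom h ⊗ₘ powMap (End.asHom h) m) = 0 := ha
    have h3 : ptr X (Xᘁ) (0 : X ⊗ (X ⊗ tensorPow X m) ⟶ X ⊗ (X ⊗ tensorPow X m)) = 0 := by
      simp [ptr]
    rw [h2, zero_comp, h3] at h1
    rw [pow_succ]
    exact h1.symm

theorem isNilpotent_of_powMap_eq_zero {X : C} (h : End X) {n : ℕ}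
    (hn : powMap (End.asHom h) n = 0) : IsNilpotent h := by
  refine exists_pow_eq_zero_of_tensor_powMap h n 0 ?_
  refine (congrArg (End.asHom (h ^ 0) ⊗ₘ ·) hn).trans ?_
  exact MonoidalPreadditive.tensor_zero _

theorem powMap_comp_eq_zero {X Y Z : C} (f : X ⟶ Y) (g : Y ⟶ Z) {n : ℕ} (hf : powMap f n = 0) :
    powMap (f ≫ g) n = 0 := by
  rw [powMap_comp, hf, zero_comp]

theorem isIso_of_isNilpotent_sub {X Y : C} (u : X ⟶ Y) (v : Y ⟶ X) {h : End X} {h' : End Y}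
    (hn : IsNilpotent h) (hn' : IsNilpotent h') (huv : u ≫ v = (1 - h : End X))
    (hvu : v ≫ u = (1 - h' : End Y)) : Nonempty (X ≅ Y) := by
  have h1 : IsIso (u ≫ v) := by
    rw [huv]
    exact (isUnit_iff_isIso _).1 hn.isUnit_one_sub
  have h2 : IsIso (v ≫ u) := by
    rw [hvu]
    exact (isUnit_iff_isIso _).1 hn'.isUnit_one_sub
  have h3 : IsSplitMono u := ⟨⟨v ≫ inv (u ≫ v), by rw [← Category.assoc, IsIso.hom_inv_id]⟩⟩
  have h4 : IsSplitEpi u := ⟨⟨inv (v ≫ u) ≫ v, by rw [Category.assoc, IsIso.inv_hom_id]⟩⟩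
  have := isIso_of_mono_of_isSplitEpi u
  exact ⟨asIso u⟩

variable [CharZero K] [HasBinaryBiproducts C]

/-- The composite `P ⟶ P' ⟶ P` of the components of `e` and its inverse differs from the identity by
a map through `N'`. This map factors through an object of the opposite sign, so its tensor powers
eventually vanish and it is nilpotent. The same holds for `P' ⟶ P ⟶ P'`. -/
theorem iso_of_biprod_iso {s : ℤˣ} {P N P' N' : C} {a b a' b' : ℕ} (e : P ⊞ N ≅ P' ⊞ N')
    (hP : alt K s P (a + 1) = 0) (hN : alt K (-s) N (b + 1) = 0)
    (hP' : alt K s P' (a' + 1) = 0) (hN' : alt K (-s) N' (b' + 1) = 0) : Nonempty (P ≅ P') := by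
  have key {P N P' N' : C} {a b' : ℕ} (e : P ⊞ N ≅ P' ⊞ N')
      (hP : alt K s P (a + 1) = 0) (hN' : alt K (-s) N' (b' + 1) = 0) :
      ∃ h : End P, IsNilpotent h ∧
      (biprod.inl ≫ e.hom ≫ biprod.fst) ≫ (biprod.inl ≫ e.inv ≫ biprod.fst) =
        (1 - h : End P) := by
    refine ⟨(biprod.inl ≫ e.hom ≫ biprod.snd) ≫ (biprod.inr ≫ e.inv ≫ biprod.fst), ?_, ?_⟩
    · exact isNilpotent_of_powMap_eq_zero _ (powMap_comp_eq_zero _ _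
        (exists_powMap_eq_zero K s hP hN' _))
    · have h := congrArg (fun x => (biprod.inl : P ⟶ _) ≫ e.hom ≫ x ≫ e.inv ≫ biprod.fst)
        (biprod.total (X := P') (Y := N'))
      simp only [Preadditive.add_comp, Preadditive.comp_add, Category.id_comp,
        Iso.hom_inv_id_assoc, biprod.inl_fst] at h
      refine eq_sub_of_add_eq (Eq.trans ?_ h)
      simp only [Category.assoc]
  obtain ⟨h, hn, huv⟩ := key e hP hN'
  obtain ⟨h', hn', hvu⟩ := key e.symm hP' hN
  exact isIso_of_isNilpotent_sub _ _ hn hn' huv hvu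

end Nilpotent

/-! ### Tensor powers of a tensor product -/

section MulPow

open Equiv

variable {C : Type u} [Category.{v} C] [MonoidalCategory C] [SymmetricCategory C]

/-- The isomorphism `(X ⊗ Z) ⊗ (Y ⊗ W) ≅ (X ⊗ Y) ⊗ (Z ⊗ W)`. -/
def tensorμIso (X Z Y W : C) : (X ⊗ Z) ⊗ (Y ⊗ W) ≅ (X ⊗ Y) ⊗ (Z ⊗ W) where
  hom := tensorμ X Z Y W
  inv := tensorδ X Z Y W

/-- The isomorphism `X^{⊗ n} ⊗ Y^{⊗ n} ≅ (X ⊗ Y)^{⊗ n}`. -/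
def mulPow (X Y : C) : (n : ℕ) → (tensorPow X n ⊗ tensorPow Y n ≅ tensorPow (X ⊗ Y) n)
  | 0 => λ_ (𝟙_ C)
  | n + 1 => tensorμIso X (tensorPow X n) Y (tensorPow Y n) ≪≫
      whiskerLeftIso (X ⊗ Y) (mulPow X Y n)

theorem tensorμ_swapTwo (X Y P Q : C) :
    (swapTwo X P ⊗ₘ swapTwo Y Q) ≫ tensorμ X (X ⊗ P) Y (Y ⊗ Q) ≫
        (X ⊗ Y) ◁ tensorμ X P Y Q =
      (tensorμ X (X ⊗ P) Y (Y ⊗ Q) ≫ (X ⊗ Y) ◁ tensorμ X P Y Q) ≫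
        swapTwo (X ⊗ Y) (P ⊗ Q) := by
  have h1 := associator_monoidal X X P Y Y Q
  have h2 : tensorμ X (X ⊗ P) Y (Y ⊗ Q) ≫ (X ⊗ Y) ◁ tensorμ X P Y Q =
      ((α_ X X P).inv ⊗ₘ (α_ Y Y Q).inv) ≫ tensorμ (X ⊗ X) P (Y ⊗ Y) Q ≫
        tensorμ X X Y Y ▷ (P ⊗ Q) ≫ (α_ (X ⊗ Y) (X ⊗ Y) (P ⊗ Q)).hom := by
    rw [h1, ← Category.assoc, tensorHom_comp_tensorHom, Iso.inv_hom_id, Iso.inv_hom_id]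
    simp
  rw [h2]
  have h3 : (swapTwo X P ⊗ₘ swapTwo Y Q) ≫ ((α_ X X P).inv ⊗ₘ (α_ Y Y Q).inv) =
      ((α_ X X P).inv ⊗ₘ (α_ Y Y Q).inv) ≫
        (((β_ X X).hom ⊗ₘ 𝟙 P) ⊗ₘ ((β_ Y Y).hom ⊗ₘ 𝟙 Q)) := by
    rw [tensorHom_comp_tensorHom, tensorHom_comp_tensorHom]
    simp [swapTwo]
  rw [reassoc_of% h3, tensorμ_natural_assoc]
  simp only [swapTwo, Category.assoc, Iso.hom_inv_id_assoc]
  congr 2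
  rw [← comp_whiskerRight_assoc, SymmetricCategory.tensorμ_braid_swap]
  simp

/-- Permuting the factors of `(X ⊗ Y)^{⊗ n}` is the diagonal action on `X^{⊗ n} ⊗ Y^{⊗ n}`. The
essential case is the exchange of the first two factors, which is the compatibility of `tensorμ`
with the braiding. -/
theorem mulPow_pm (X Y : C) (n : ℕ) (σ : Perm (Fin n)) :
    (pm X n σ ⊗ₘ pm Y n σ) ≫ (mulPow X Y n).hom = (mulPow X Y n).hom ≫ pm (X ⊗ Y) n σ := by
  induction n, σ using perm_fin_induction with
  | one n =>
    rw [pm_one, pm_one, pm_one, Category.comp_id, id_tensorHom_id, Category.id_comp]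
  | mul n σ τ h1 h2 =>
    rw [pm_mul, pm_mul, pm_mul, ← tensorHom_comp_tensorHom, Category.assoc, h1, reassoc_of% h2]
  | first n =>
    rw [pm_swap, pm_swap, pm_swap]
    have h0 : (mulPow X Y (n + 2)).hom =
        (tensorμ X (X ⊗ tensorPow X n) Y (Y ⊗ tensorPow Y n) ≫
        (X ⊗ Y) ◁ tensorμ X (tensorPow X n) Y (tensorPow Y n)) ≫
        ((X ⊗ Y) ◁ (X ⊗ Y) ◁ (mulPow X Y n).hom) := by
      rw [Category.assoc, ← whiskerLeft_comp]
      rfl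
    rw [h0]
    refine (Category.assoc _ _ _).symm.trans ?_
    refine (congrArg (· ≫ _) (tensorμ_swapTwo X Y (tensorPow X n) (tensorPow Y n))).trans ?_
    refine (Category.assoc _ _ _).trans (Eq.trans ?_ (Category.assoc _ _ _).symm)
    exact congrArg (_ ≫ ·) (swapTwo_naturality (X ⊗ Y) (mulPow X Y n).hom).symm
  | ext n σ h =>
    rw [pm_extPerm, pm_extPerm, pm_extPerm]
    have h0 : (mulPow X Y (n + 1)).hom = tensorμ X (tensorPow X n) Y (tensorPow Y n) ≫
      (X ⊗ Y) ◁ (mulPow X Y n).hom := rfl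
    rw [h0]
    have h1 := tensorμ_natural (𝟙 X) (pm X n σ) (𝟙 Y) (pm Y n σ)
    rw [id_tensorHom, id_tensorHom, id_tensorHom_id, id_tensorHom] at h1
    refine (Category.assoc _ _ _).symm.trans ?_
    refine (congrArg (· ≫ _) h1).trans ?_
    refine (Category.assoc _ _ _).trans (Eq.trans ?_ (Category.assoc _ _ _).symm)
    refine congrArg (_ ≫ ·) ?_
    refine (whiskerLeft_comp _ _ _).symm.trans (Eq.trans ?_ (whiskerLeft_comp _ _ _))
    rw [h]

end MulPow

/-! ### Tensor products of signed objects; objects of dimension one -/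

section SignedTensor

open Equiv

variable (K : Type*) [Field K] [CharZero K]
variable {C : Type u} [Category.{v} C] [Preadditive C] [Linear K C] [MonoidalCategory C]
  [SymmetricCategory C]

/-- The action of the symmetric group on the morphisms from a tensor power. -/
def preRep (Z X : C) (n : ℕ) : Perm (Fin n) →* Module.End K (tensorPow X n ⟶ Z) where
  toFun σ := Linear.leftComp K Z (pm X n σ⁻¹)
  map_one' := by
    refine LinearMap.ext fun z => ?_
    simp [pm_one]
  map_mul' σ τ := by
    refine LinearMap.ext fun z => ?_
    simp [pm_mul]

theorem preRep_apply (Z X : C) (n : ℕ) (σ : Perm (Fin n)) (z : tensorPow X n ⟶ Z) :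
    preRep K Z X n σ z = pm X n σ⁻¹ ≫ z := rfl

variable [MonoidalPreadditive C] [MonoidalLinear K C]

/-- A morphism from `X^{⊗ N}` which is antisymmetric in `n` variables is zero if `Λⁿ(X)` is. -/
theorem eq_zero_of_alt_eq_zero_left (s : ℤˣ) {X : C} {n : ℕ} (h : alt K s X n = 0) {N : ℕ}
    {S : Finset (Fin N)} (hS : S.card = n) {Z : C} {z : tensorPow X N ⟶ Z}
    (hz : ∀ x ∈ S, ∀ y ∈ S, x ≠ y → pm X N (swap x y) ≫ z = (((-s : ℤˣ) : ℤ) : K) • z) :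
    z = 0 := by
  -- The twisted average is itself a morphism to `X^{⊗ N}` with the required symmetry in `S`, so it
  -- is zero. On `z` it acts as the nonzero scalar `|S|!`.
  have h1 : MonoidAlgebra.lift K _ _ (permAction X N) (avg K (-s) S) = 0 := by
    refine eq_zero_of_alt_eq_zero K s h hS fun x hx y hy hxy => ?_
    have := congrArg (MonoidAlgebra.lift K _ _ (permAction X N))
      (swap_mul_avg (K := K) (-s) hx hy hxy)
    rw [map_mul, map_smul, MonoidAlgebra.lift_of] at this
    exact this
  have h2 : SwapEigen (preRep K Z X N) (-s) S z := fun x hx y hy hxy => by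
    rw [preRep_apply, swap_inv, hz x hx y hy hxy]
  have h3 : End.asHom (MonoidAlgebra.lift K _ _ (permAction X N) (avg K (-s) S)) ≫ z =
      (Fintype.card (Perm S) : K) • z := by
    have : ∀ σ : Perm S, (((tw (-s) σ : ℤˣ) : ℤ) : K) • (pm X N (Perm.ofSubtype σ) ≫ z) = z := by
      intro σ
      have h4 := h2.perm σ⁻¹
      rw [preRep_apply, ← map_inv, inv_inv] at h4
      rw [h4, smul_smul, map_inv, Int.units_inv_eq_self, units_mul_self_cast, one_smul]
    have h5 : End.asHom (MonoidAlgebra.lift K _ _ (permAction X N) (avg K (-s) S)) =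
        ∑ σ : Perm S, (((tw (-s) σ : ℤˣ) : ℤ) : K) • pm X N (Perm.ofSubtype σ) := by
      rw [avg, map_sum]
      refine Finset.sum_congr rfl fun σ _ => ?_
      rw [map_smul, MonoidAlgebra.lift_of]
      rfl
    rw [h5, Preadditive.sum_comp]
    simp_rw [Linear.smul_comp, this]
    rw [Finset.sum_const, Finset.card_univ, Nat.cast_smul_eq_nsmul]
  rw [h1] at h3
  exact (smul_eq_zero.1 (h3.symm.trans zero_comp)).resolve_left
    (Nat.cast_ne_zero.2 Fintype.card_ne_zero)

theorem alt_of_retract (s : ℤˣ) {X Y : C} {i : Y ⟶ X} {r : X ⟶ Y} (h : i ≫ r = 𝟙 Y) {n : ℕ}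
    (hX : alt K s X n = 0) : alt K s Y n = 0 := by
  have h1 : powMap i n ≫ powMap r n = 𝟙 _ := by rw [← powMap_comp, h, powMap_id]
  rw [← Category.id_comp (alt K s Y n), ← h1, Category.assoc, ← alt_powMap, hX, zero_comp,
    comp_zero]

/-- The sum `∑ ε(σ) σ ⊗ σ` acting on `X^{⊗ n} ⊗ Y^{⊗ n}`. -/
def diagSum (ε : ℤˣ) (X Y : C) (n : ℕ) :
    tensorPow X n ⊗ tensorPow Y n ⟶ tensorPow X n ⊗ tensorPow Y n :=
  ∑ σ : Perm (Fin n), (((tw ε σ : ℤˣ) : ℤ) : K) • (pm X n σ ⊗ₘ pm Y n σ)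

theorem mulPow_alt (s : ℤˣ) (X Y : C) (n : ℕ) : (mulPow X Y n).hom ≫ alt K s (X ⊗ Y) n =
    ((n.factorial : K)⁻¹ • diagSum K (-s) X Y n) ≫ (mulPow X Y n).hom := by
  rw [alt, diagSum]
  simp only [Linear.smul_comp, Linear.comp_smul, Preadditive.sum_comp, Preadditive.comp_sum,
    mulPow_pm]

/-- The substitution `σ ↦ τ * σ` in the sum. It lets group algebra elements move from the left
tensor factor to the right one, where `τ` becomes `ε(τ) τ⁻¹`. -/
theorem diagSum_comp (ε : ℤˣ) (X Y : C) (n : ℕ) (τ : Perm (Fin n)) :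
    diagSum K ε X Y n ≫ pm X n τ ▷ tensorPow Y n =
      diagSum K ε X Y n ≫ tensorPow X n ◁ ((((tw ε τ : ℤˣ) : ℤ) : K) • pm Y n τ⁻¹) := by
  rw [MonoidalLinear.whiskerLeft_smul, Linear.comp_smul, diagSum, Preadditive.sum_comp,
    Preadditive.sum_comp, Finset.smul_sum]
  refine Fintype.sum_equiv (Equiv.mulLeft τ) _ _ fun σ => ?_
  rw [Equiv.coe_mulLeft, Linear.smul_comp, Linear.smul_comp, smul_smul, map_mul]
  push_cast
  rw [← mul_assoc, units_mul_self_cast, one_mul, ← id_tensorHom, ← tensorHom_id,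
    tensorHom_comp_tensorHom, tensorHom_comp_tensorHom, Category.comp_id, Category.comp_id,
    ← pm_mul, ← pm_mul, inv_mul_cancel_left]

/-- The action `τ ↦ ε(τ) τ⁻¹` of the symmetric group on a tensor power, as a right action. -/
def opRep (ε : ℤˣ) (Y : C) (n : ℕ) : Perm (Fin n) →* (End (tensorPow Y n))ᵐᵒᵖ where
  toFun τ := MulOpposite.op ((((tw ε τ : ℤˣ) : ℤ) : K) • permAction Y n τ⁻¹)
  map_one' := by simp
  map_mul' σ τ := by
    rw [← MulOpposite.op_mul, smul_mul_smul_comm, ← map_mul, mul_inv_rev, map_mul (tw ε)]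
    push_cast
    rw [mul_comm]

theorem diagSum_comp_lift (ε : ℤˣ) (X Y : C) (n : ℕ) (y : MonoidAlgebra K (Perm (Fin n))) :
    diagSum K ε X Y n ≫
        End.asHom (MonoidAlgebra.lift K _ _ (permAction X n) y) ▷ tensorPow Y n =
      diagSum K ε X Y n ≫
        tensorPow X n ◁ End.asHom (MonoidAlgebra.lift K _ _ (opRep K ε Y n) y).unop := by
  induction y using MonoidAlgebra.induction_on with
  | of σ =>
    rw [MonoidAlgebra.lift_of, MonoidAlgebra.lift_of]
    exact diagSum_comp K ε X Y n σ
  | add x y hx hy =>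
    rw [map_add, map_add, MulOpposite.unop_add]
    refine (congrArg (_ ≫ ·) (MonoidalPreadditive.add_whiskerRight _ _)).trans ?_
    refine Eq.trans ?_ (congrArg (_ ≫ ·) (MonoidalPreadditive.whiskerLeft_add _ _)).symm
    rw [Preadditive.comp_add, Preadditive.comp_add]
    exact congrArg₂ (· + ·) hx hy
  | smul c x hx =>
    rw [map_smul, map_smul, MulOpposite.unop_smul]
    refine (congrArg (_ ≫ ·) (MonoidalLinear.smul_whiskerRight _ _ _)).trans ?_
    refine Eq.trans ?_ (congrArg (_ ≫ ·) (MonoidalLinear.whiskerLeft_smul _ _ _)).symm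
    rw [Linear.comp_smul, Linear.comp_smul]
    exact congrArg (c • ·) hx

/-- Take `y` acting as zero on the left factor, with `1 - y` acting as zero on the right factor
through `opRep`. Then `1 - y` is the identity on the left and becomes zero when moved to the right.
The twist by `-(s * t)` turns the condition on `s`-eigenvectors of `opRep` into the antisymmetry
which `alt K t Y (b + 1) = 0` excludes. -/
theorem diagSum_eq_zero (s t : ℤˣ) {X Y : C} {a b : ℕ} (hX : alt K s X (a + 1) = 0)
    (hY : alt K t Y (b + 1) = 0) : diagSum K (-(s * t)) X Y (a * b + 1) = 0 := by
  obtain ⟨y, h1, h2⟩ := exists_mem_ker_of_swapEigen (K := K) (permAction X (a * b + 1))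
    (opRep K (-(s * t)) Y (a * b + 1)) (-s) a b
    (fun S hS z hz => eq_zero_of_alt_eq_zero K s hX hS hz)
    (fun S hS z hz => by
      refine MulOpposite.unop_injective (eq_zero_of_alt_eq_zero_left K t hY hS
        (z := End.asHom z.unop) fun p hp q hq hpq => ?_)
      have h := congrArg MulOpposite.unop (hz p hp q hq hpq)
      have h' : (((tw (-(s * t)) (swap p q) : ℤˣ) : ℤ) : K) •
          (pm Y (a * b + 1) (swap p q)⁻¹ ≫ End.asHom z.unop) =
          (((- -s : ℤˣ) : ℤ) : K) • End.asHom z.unop := by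
        rw [← Linear.smul_comp]
        exact h
      rw [tw_swap _ hpq, swap_inv] at h'
      have h3 := congrArg ((((-(s * t) : ℤˣ) : ℤ) : K) • ·) h'
      simp only [smul_smul, units_mul_self_cast, one_smul] at h3
      rw [h3]
      congr 1
      rcases Int.units_eq_one_or s with rfl | rfl <;> simp) (by simp)
  have k1 := diagSum_comp_lift K (-(s * t)) X Y (a * b + 1) y
  have k2 := diagSum_comp_lift K (-(s * t)) X Y (a * b + 1) (1 - y)
  rw [h2] at k2
  have k3 : MonoidAlgebra.lift K _ _ (permAction X (a * b + 1)) (1 - y) = 1 := by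
    rw [map_sub, h1, map_one, sub_zero]
  rw [k3] at k2
  refine (Category.comp_id _).symm.trans (Eq.trans ?_ (k2.trans ?_))
  · exact congrArg (_ ≫ ·) (id_whiskerRight _ _).symm
  · refine (congrArg (_ ≫ ·) (MonoidalPreadditive.whiskerLeft_zero)).trans comp_zero

theorem alt_tensor_eq_zero (s t : ℤˣ) {X Y : C} {a b : ℕ} (hX : alt K s X (a + 1) = 0)
    (hY : alt K t Y (b + 1) = 0) : alt K (s * t) (X ⊗ Y) (a * b + 1) = 0 := by
  have h := mulPow_alt K (s * t) X Y (a * b + 1)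
  rw [diagSum_eq_zero K s t hX hY, smul_zero, zero_comp] at h
  rw [← Category.id_comp (alt K (s * t) (X ⊗ Y) (a * b + 1)), ← (mulPow X Y _).inv_hom_id,
    Category.assoc, h, comp_zero]

variable {K} [RigidCategory C] [hK : Fact (Function.Bijective (algebraMap K (End (𝟙_ C))))]

theorem Signed.tensor {s t : ℤˣ} {X Y : C} {a b : ℕ} (hX : Signed K s a X)
    (hY : Signed K t b Y) : Signed K (s * t) (a * b) (X ⊗ Y) := by
  refine ⟨alt_tensor_eq_zero K s t hX.1 hY.1, ?_⟩
  rw [chi_tensor, hX.2, hY.2]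
  push_cast
  ring

theorem Signed.eq {s : ℤˣ} {X : C} {a b : ℕ} (hX : Signed K s a X) (hX' : Signed K s b X) :
    a = b := by
  have h := congrArg (((s : ℤ) : K) * ·) (hX.2.symm.trans hX'.2)
  simp only [← mul_assoc, units_mul_self_cast, one_mul] at h
  exact_mod_cast h

theorem Signed.of_iso {s : ℤˣ} {X Y : C} {a : ℕ} (hX : Signed K s a X) (e : X ≅ Y) :
    Signed K s a Y :=
  ⟨alt_of_retract K s e.inv_hom_id hX.1, by rw [← chi_iso e, hX.2]⟩

variable (K) in
theorem alt_two (s : ℤˣ) (X : C) : alt K s X 2 =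
    (2 : K)⁻¹ • (𝟙 (tensorPow X 2) - ((s : ℤ) : K) • pm X 2 (swap 0 1)) := by
  have h : (Finset.univ : Finset (Perm (Fin 2))) = {1, swap 0 1} := by decide
  have h1 : (1 : Perm (Fin 2)) ≠ swap 0 1 := by decide
  rw [alt, h, Finset.sum_pair h1, map_one, tw_swap _ (by decide), pm_one]
  simp [sub_eq_add_neg]

theorem alt_two_eq_zero_iff (s : ℤˣ) (X : C) :
    alt K s X 2 = 0 ↔ swapTwo X (𝟙_ C) = ((s : ℤ) : K) • 𝟙 (X ⊗ (X ⊗ 𝟙_ C)) := by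
  have h0 : pm X 2 (swap 0 1) = ((s : ℤ) : K) • 𝟙 (tensorPow X 2) ↔
      swapTwo X (𝟙_ C) = ((s : ℤ) : K) • 𝟙 (X ⊗ (X ⊗ 𝟙_ C)) := by
    have h2 : pm X 2 (swap 0 1) = swapTwo X (𝟙_ C) := pm_swap X 0
    rw [h2]
    rfl
  rw [← h0, alt_two]
  constructor
  · intro h
    have h1 := sub_eq_zero.1 ((smul_eq_zero.1 h).resolve_left (inv_ne_zero two_ne_zero))
    rw [h1, smul_smul, units_mul_self_cast, one_smul]
  · intro h
    rw [h, smul_smul, units_mul_self_cast, one_smul, sub_self, smul_zero]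

theorem braiding_of_alt_two {s : ℤˣ} {X : C} (h : alt K s X 2 = 0) :
    (β_ X X).hom = ((s : ℤ) : K) • 𝟙 _ := by
  have h2 := (alt_two_eq_zero_iff s X).1 h
  have h3 : (β_ X X).hom = X ◁ (ρ_ X).inv ≫ swapTwo X (𝟙_ C) ≫ X ◁ (ρ_ X).hom := by
    rw [swapTwo, whiskerRight_id]
    monoidal_nf
    simp
  rw [h3, h2, Linear.smul_comp, Linear.comp_smul, Category.id_comp]
  congr 1
  rw [← whiskerLeft_comp, Iso.inv_hom_id, whiskerLeft_id]

theorem alt_two_of_braiding {s : ℤˣ} {X : C} (h : (β_ X X).hom = ((s : ℤ) : K) • 𝟙 _) :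
    alt K s X 2 = 0 := by
  refine (alt_two_eq_zero_iff s X).2 ?_
  rw [swapTwo, h, MonoidalLinear.smul_whiskerRight, Linear.smul_comp, Linear.comp_smul]
  simp

theorem signed_unit : Signed K 1 1 (𝟙_ C) := by
  refine ⟨alt_two_of_braiding ?_, ?_⟩
  · have h := braiding_leftUnitor (𝟙_ C)
    rw [← unitors_equal] at h
    have h2 := (cancel_mono (λ_ (𝟙_ C)).hom).1 (h.trans (Category.id_comp _).symm)
    rw [h2]
    simp
  · rw [chi, tr_id_unit]
    simp

/-- An object of dimension one is invertible, with its dual as inverse. -/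
theorem Signed.tensor_dual {s : ℤˣ} {L : C} (h : Signed K s 1 L) :
    Nonempty (L ⊗ Lᘁ ≅ 𝟙_ C) := by
  have hb := braiding_of_alt_two h.1
  set c : L ⊗ Lᘁ ⟶ 𝟙_ C := (β_ L (Lᘁ)).hom ≫ ε_ L (Lᘁ) with hc
  have h1 : η_ L (Lᘁ) ≫ c = ((s : ℤ) : K) • 𝟙 _ := by
    have := chi_smul_id (K := K) L
    rw [h.2, Nat.cast_one, mul_one] at this
    exact this.symm
  -- Checked after transposing `Lᘁ` to the source: naturality of the braiding moves `c` past the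
  -- extra strand `L`, the self-braiding of `L` contributes the sign `s`, and a triangle identity
  -- finishes.
  have h2 : c ≫ η_ L (Lᘁ) = ((s : ℤ) : K) • 𝟙 _ := by
    refine (tensorRightHomEquiv (L ⊗ Lᘁ) L (Lᘁ) L).symm.injective ?_
    have e1 : c ▷ L ≫ (λ_ L).hom = ((s : ℤ) : K) • ((α_ _ _ _).hom ≫ L ◁ ε_ L (Lᘁ) ≫
        (ρ_ L).hom) := by
      have e2 := BraidedCategory.braiding_naturality_left c L
      have e3 : (β_ (𝟙_ C) L).hom ≫ (ρ_ L).hom = (λ_ L).hom := braiding_rightUnitor L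
      rw [← e3, reassoc_of% e2, BraidedCategory.braiding_tensor_left_hom, hb,
        MonoidalLinear.smul_whiskerRight]
      simp only [Linear.comp_smul, Linear.smul_comp, id_whiskerRight, Category.id_comp,
        Category.assoc, Iso.inv_hom_id_assoc, hc]
      rw [← whiskerLeft_comp_assoc]
      simp
    have e4 : η_ L (Lᘁ) ▷ L ≫ (α_ L (Lᘁ) L).hom ≫ L ◁ ε_ L (Lᘁ) = (λ_ L).hom ≫ (ρ_ L).inv :=
      ExactPairing.evaluation_coevaluation (X := L) (Y := Lᘁ)
    simp only [tensorRightHomEquiv, Equiv.coe_fn_symm_mk, comp_whiskerRight, Category.assoc,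
      MonoidalLinear.smul_whiskerRight, id_whiskerRight, Category.id_comp, Linear.smul_comp]
    rw [← e1, reassoc_of% e4, Iso.inv_hom_id, Category.comp_id]
  refine ⟨⟨((s : ℤ) : K) • c, η_ L (Lᘁ), ?_, ?_⟩⟩
  · rw [Linear.smul_comp, h2, smul_smul, units_mul_self_cast, one_smul]
  · rw [Linear.comp_smul, h1, smul_smul, units_mul_self_cast, one_smul]

theorem Signed.tensorPow {s : ℤˣ} {X : C} {d : ℕ} (hX : Signed K s d X) (n : ℕ) :
    Signed K (s ^ n) (d ^ n) (TensorDet.tensorPow X n) := by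
  induction n with
  | zero =>
    rw [pow_zero, pow_zero]
    exact signed_unit
  | succ n ih =>
    rw [pow_succ', pow_succ']
    exact hX.tensor ih

theorem Signed.exists_of_isIm {s : ℤˣ} {X Y : C} {d : ℕ} (hX : Signed K s d X) {p : X ⟶ X}
    (h : IsIm p Y) : ∃ e, Signed K s e Y := by
  obtain ⟨i, r, hi, -⟩ := h
  exact exists_signed s (alt_of_retract K s hi hX.1)

end SignedTensor

/-! ### Regularity of the group algebra and comparison of summands -/

section Regular

/-- The group algebra of a finite group is von Neumann regular in characteristic zero. -/
theorem exists_mul_mul_eq_self {K G : Type*} [Field K] [CharZero K] [Group G] [Finite G]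
    (a : MonoidAlgebra K G) : ∃ b, a * b * a = a := by
  have : NeZero (Nat.card G : K) := ⟨Nat.cast_ne_zero.2 Nat.card_pos.ne'⟩
  let I : Submodule (MonoidAlgebra K G) (MonoidAlgebra K G) := Submodule.span _ {a}
  obtain ⟨J, hJ⟩ := exists_isCompl I
  let p := I.projectionOnto J hJ
  -- By semisimplicity the left ideal generated by `a` has a complement. With `p` the projection
  -- onto the ideal, `p 1 = b * a`, and `a = p a = a * p 1 = a * b * a`.
  obtain ⟨b, hb⟩ := Submodule.mem_span_singleton.1 (p 1).2
  refine ⟨b, ?_⟩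
  have h1 : p a = ⟨a, Submodule.mem_span_singleton_self a⟩ :=
    Submodule.projectionOnto_apply_left hJ ⟨a, Submodule.mem_span_singleton_self a⟩
  have h2 : p a = a • p 1 := by rw [← map_smul, smul_eq_mul, mul_one]
  have h3 := congrArg Subtype.val (h2.symm.trans h1)
  rw [Submodule.coe_smul, ← hb, smul_eq_mul, smul_eq_mul, ← mul_assoc] at h3
  exact h3

theorem exists_comp_comp_eq_self {K G C : Type*} [Category C] [Preadditive C] [Field K]
    [CharZero K] [Linear K C] [Group G] [Finite G] {Z : C} (ρ : G →* End Z) {x : Z ⟶ Z}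
    (hx : (x : End Z) ∈ (MonoidAlgebra.lift K (End Z) G ρ).range) : ∃ y, x ≫ y ≫ x = x := by
  obtain ⟨a, ha⟩ := hx
  obtain ⟨b, hb⟩ := exists_mul_mul_eq_self a
  refine ⟨End.asHom (MonoidAlgebra.lift K (End Z) G ρ b), ?_⟩
  have h := congrArg (MonoidAlgebra.lift K (End Z) G ρ) hb
  rw [map_mul, map_mul] at h
  have ha' : MonoidAlgebra.lift K (End Z) G ρ a = x := ha
  rw [ha'] at h
  exact h

variable {K C : Type*} [Category C] [Preadditive C] [Field K] [Linear K C]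

/-- All endomorphisms of `L` are scalars. -/
def IsScalar (K : Type*) {C : Type*} [Category C] [Preadditive C] [Field K] [Linear K C]
    (L : C) : Prop := ∀ f : L ⟶ L, ∃ c : K, f = c • 𝟙 L

/-- The morphism `x` induces a nonzero `g : L ⟶ L'`, and `y` induces some `g'` with `g ≫ g' ≫ g =
g`. The two composites of `g` and `g'` are scalars, and this relation forces both to be `1`. -/
theorem IsIm.iso_of_regular {Z L L' : C} {p q x y : Z ⟶ Z} (hL : IsIm p L)
    (hL' : IsIm q L') (h : IsScalar K L) (h' : IsScalar K L') (hx : x ≠ 0) (hp : p ≫ x = x)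
    (hq : x ≫ q = x) (hy : x ≫ y ≫ x = x) : Nonempty (L ≅ L') := by
  obtain ⟨i, r, hi, rfl⟩ := hL
  obtain ⟨i', r', hi', rfl⟩ := hL'
  have hgg : (i ≫ x ≫ r') ≫ (i' ≫ y ≫ r) ≫ (i ≫ x ≫ r') = i ≫ x ≫ r' := by
    calc _ = i ≫ (x ≫ r' ≫ i') ≫ y ≫ ((r ≫ i) ≫ x) ≫ r' := by simp only [Category.assoc]
      _ = i ≫ (x ≫ y ≫ x) ≫ r' := by rw [hq, hp]; simp only [Category.assoc]
      _ = _ := by rw [hy]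
  have hg0 : i ≫ x ≫ r' ≠ 0 := by
    intro h0
    apply hx
    calc x = (r ≫ i) ≫ x ≫ (r' ≫ i') := by rw [hq, hp]
      _ = r ≫ (i ≫ x ≫ r') ≫ i' := by simp only [Category.assoc]
      _ = 0 := by rw [h0]; simp
  obtain ⟨c, hc⟩ := h ((i ≫ x ≫ r') ≫ (i' ≫ y ≫ r))
  obtain ⟨c', hc'⟩ := h' ((i' ≫ y ≫ r) ≫ (i ≫ x ≫ r'))
  refine ⟨⟨i ≫ x ≫ r', i' ≫ y ≫ r, ?_, ?_⟩⟩
  · have h1 : (c - 1) • (i ≫ x ≫ r') = 0 := by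
      have h2 := hgg
      rw [← Category.assoc, hc, Linear.smul_comp, Category.id_comp] at h2
      rw [sub_smul, one_smul, h2, sub_self]
    rw [hc, sub_eq_zero.1 ((smul_eq_zero.1 h1).resolve_right hg0), one_smul]
  · have h1 : (c' - 1) • (i ≫ x ≫ r') = 0 := by
      have h2 := hgg
      rw [hc', Linear.comp_smul, Category.comp_id] at h2
      rw [sub_smul, one_smul, h2, sub_self]
    rw [hc', sub_eq_zero.1 ((smul_eq_zero.1 h1).resolve_right hg0), one_smul]

end Regular

/-! ### Tensoring with an invertible object -/

section Invertible

variable {C : Type u} [Category.{v} C] [MonoidalCategory C] [SymmetricCategory C]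

/-- Tensoring with an invertible object is an equivalence. -/
def tensorRightEquivalence {L T : C} (e : L ⊗ T ≅ 𝟙_ C) : C ≌ C :=
  let η : 𝟭 C ≅ tensorRight L ⋙ tensorRight T :=
    NatIso.ofComponents (fun X => (ρ_ X).symm ≪≫ whiskerLeftIso X e.symm ≪≫ (α_ X L T).symm)
      (fun {X Y} f => by
        show f ≫ (ρ_ Y).inv ≫ Y ◁ e.inv ≫ (α_ Y L T).inv =
          ((ρ_ X).inv ≫ X ◁ e.inv ≫ (α_ X L T).inv) ≫ f ▷ L ▷ T
        rw [rightUnitor_inv_naturality_assoc, ← whisker_exchange_assoc,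
          associator_inv_naturality_left]
        simp only [Category.assoc])
  let ε : tensorRight T ⋙ tensorRight L ≅ 𝟭 C :=
    NatIso.ofComponents (fun X => α_ X T L ≪≫ whiskerLeftIso X (β_ T L ≪≫ e) ≪≫ ρ_ X)
      (fun {X Y} f => by
        show f ▷ T ▷ L ≫ (α_ Y T L).hom ≫ Y ◁ ((β_ T L).hom ≫ e.hom) ≫ (ρ_ Y).hom =
          ((α_ X T L).hom ≫ X ◁ ((β_ T L).hom ≫ e.hom) ≫ (ρ_ X).hom) ≫ f
        rw [associator_naturality_left_assoc, ← whisker_exchange_assoc, rightUnitor_naturality]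
        simp only [Category.assoc])
  CategoryTheory.Equivalence.mk (tensorRight L) (tensorRight T) η ε

theorem exists_whiskerRight_eq {L T : C} (e : L ⊗ T ≅ 𝟙_ C) {X Y : C} (f : X ⊗ L ⟶ Y ⊗ L) :
    ∃ g : X ⟶ Y, f = g ▷ L := by
  obtain ⟨g, hg⟩ := (tensorRightEquivalence e).functor.map_surjective f
  exact ⟨g, hg.symm⟩

end Invertible

/-! ### Partial traces over all factors but the first -/

section RightTrace

open Equiv

variable {K : Type*} [Field K]
variable {C : Type u} [Category.{v} C] [Preadditive C] [Linear K C] [MonoidalCategory C]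
  [SymmetricCategory C] [MonoidalPreadditive C] [MonoidalLinear K C] [RigidCategory C]
  [hK : Fact (Function.Bijective (algebraMap K (End (𝟙_ C))))]

/-- An endomorphism of `L` is one of `𝟙_ C ⊗ L`, and the equivalence `- ⊗ L` makes it come from an
endomorphism of the unit object. -/
theorem isScalar_of_invertible {L T : C} (e : L ⊗ T ≅ 𝟙_ C) : IsScalar K L := by
  intro f
  obtain ⟨g, hg⟩ := exists_whiskerRight_eq e ((λ_ L).hom ≫ f ≫ (λ_ L).inv)
  refine ⟨tr K _ g, ?_⟩
  rw [← tr_unit (K := K) g, MonoidalLinear.smul_whiskerRight, id_whiskerRight] at hg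
  have h1 : f = (λ_ L).inv ≫ ((λ_ L).hom ≫ f ≫ (λ_ L).inv) ≫ (λ_ L).hom := by simp
  rw [h1, hg]
  simp

variable (K) in
/-- The partial trace over the right factor. -/
def rightTrace (A W : C) : (A ⊗ W ⟶ A ⊗ W) →ₗ[K] (A ⟶ A) where
  toFun h := ptrace K W A ((β_ W A).hom ≫ h ≫ (β_ A W).hom)
  map_add' f g := by rw [Preadditive.add_comp, Preadditive.comp_add, map_add]
  map_smul' c f := by rw [Linear.smul_comp, Linear.comp_smul, map_smul]; rfl

theorem rightTrace_apply (A W : C) (h : A ⊗ W ⟶ A ⊗ W) : rightTrace K A W h =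
    ptrace K W A ((β_ W A).hom ≫ h ≫ (β_ A W).hom) := rfl

theorem rightTrace_whiskerRight_comp {A W : C} (f : A ⟶ A) (h : A ⊗ W ⟶ A ⊗ W) :
    rightTrace K A W (f ▷ W ≫ h) = f ≫ rightTrace K A W h := by
  rw [rightTrace_apply, rightTrace_apply]
  have h1 : (β_ W A).hom ≫ (f ▷ W ≫ h) ≫ (β_ A W).hom =
      W ◁ f ≫ ((β_ W A).hom ≫ h ≫ (β_ A W).hom) ≫ W ◁ 𝟙 A := by
    rw [whiskerLeft_id, Category.comp_id, Category.assoc,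
      ← BraidedCategory.braiding_naturality_right_assoc]
  rw [h1, ptrace_whisker, Category.comp_id]

theorem rightTrace_tensor {A W : C} (f : A ⟶ A) (w : W ⟶ W) :
    rightTrace K A W (f ⊗ₘ w) = tr K W w • f := by
  rw [rightTrace_apply, BraidedCategory.braiding_naturality, SymmetricCategory.symmetry_assoc,
    ptrace_tensor]

theorem tr_rightTrace {A W : C} (h : A ⊗ W ⟶ A ⊗ W) :
    tr K A (rightTrace K A W h) = tr K (A ⊗ W) h := by
  rw [rightTrace_apply, ← tr_ptrace, tr_comm, Category.assoc, SymmetricCategory.symmetry,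
    Category.comp_id]

variable (K) in
/-- The partial trace over all factors of a tensor power but the first. -/
def tailTrace (X : C) : (m : ℕ) → (tensorPow X (m + 1) ⟶ tensorPow X (m + 1)) →ₗ[K] (X ⟶ X)
  | 0 => rightTrace K X (𝟙_ C)
  -- Conjugating by the exchange of the first two factors brings the second factor to the front,
  -- where it can be closed; the distinguished factor stays first afterwards.
  | m + 1 => tailTrace X m ∘ₗ ptrace K X (tensorPow X (m + 1)) ∘ₗ
      Linear.leftComp K _ (pm X (m + 2) (swap 0 1)) ∘ₗ
      Linear.rightComp K _ (pm X (m + 2) (swap 0 1))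

theorem tailTrace_succ (X : C) (m : ℕ) (h : tensorPow X (m + 2) ⟶ tensorPow X (m + 2)) :
    tailTrace K X (m + 1) h = tailTrace K X m (ptrace K X (tensorPow X (m + 1))
      (pm X (m + 2) (swap 0 1) ≫ h ≫ pm X (m + 2) (swap 0 1))) := rfl

theorem tailTrace_whiskerRight_comp {X : C} (f : X ⟶ X) (m : ℕ) :
    ∀ (h : tensorPow X (m + 1) ⟶ tensorPow X (m + 1)),
    tailTrace K X m (f ▷ tensorPow X m ≫ h) = f ≫ tailTrace K X m h := by
  induction m with
  | zero => exact fun h => rightTrace_whiskerRight_comp f h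
  | succ m ih =>
    intro h
    rw [tailTrace_succ, tailTrace_succ, ← ih]
    congr 1
    refine Eq.trans (congrArg (ptrace K X (tensorPow X (m + 1))) ?_) ((ptrace_whisker
      (f ▷ tensorPow X m) (𝟙 (tensorPow X (m + 1))) _).trans
        (congrArg (_ ≫ ·) (Category.comp_id _)))
    rw [pm_swap]
    have h1 := swapTwo_natural (𝟙 X) f (𝟙 (tensorPow X m))
    have h2 : swapTwo X (tensorPow X m) ≫ (f ▷ (X ⊗ tensorPow X m)) =
        X ◁ (f ▷ tensorPow X m) ≫ swapTwo X (tensorPow X m) := by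
      simpa using h1.symm
    refine (congrArg (_ ≫ ·) (Category.assoc _ _ _)).trans ?_
    refine (Category.assoc _ _ _).symm.trans ?_
    refine (congrArg (· ≫ _) h2).trans ?_
    refine (Category.assoc _ _ _).trans ?_
    refine congrArg (_ ≫ ·) ?_
    refine Eq.trans ?_ (congrArg (_ ≫ ·) (whiskerLeft_id _ _)).symm
    exact (Category.comp_id _).symm

theorem tr_tailTrace {X : C} (m : ℕ) : ∀ (h : tensorPow X (m + 1) ⟶ tensorPow X (m + 1)),
    tr K X (tailTrace K X m h) = tr K _ h := by
  induction m with
  | zero => exact fun h => tr_rightTrace h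
  | succ m ih =>
    intro h
    have h1 : ∀ h : tensorPow X (m + 2) ⟶ tensorPow X (m + 2), tr K (tensorPow X (m + 2))
        (pm X (m + 2) (swap 0 1) ≫ h ≫ pm X (m + 2) (swap 0 1)) = tr K _ h := fun h => by
      rw [tr_comm, Category.assoc, ← pm_mul, swap_mul_self, pm_one, Category.comp_id]
    rw [tailTrace_succ, ih]
    exact (tr_ptrace _).symm.trans (h1 h)

/-- Each partial trace of a permutation is a scalar times a smaller permutation, by `ptrace_pm`. In
the end only a multiple of the identity of `X` remains. -/
theorem tailTrace_pm (X : C) (m : ℕ) : ∀ σ : Perm (Fin (m + 1)),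
    ∃ c : K, tailTrace K X m (pm X (m + 1) σ) = c • 𝟙 X := by
  induction m with
  | zero =>
    intro σ
    have : σ = 1 := (inferInstance : Subsingleton (Perm (Fin 1))).elim _ _
    refine ⟨tr K (𝟙_ C) (𝟙 _), ?_⟩
    rw [this, pm_one]
    refine Eq.trans (congrArg _ ?_) (rightTrace_tensor (𝟙 X) (𝟙 (𝟙_ C)))
    exact (id_tensorHom_id _ _).symm
  | succ m ih =>
    intro σ
    have h1 : ∀ σ : Perm (Fin (m + 2)), pm X (m + 2) (swap 0 1) ≫ pm X (m + 2) σ ≫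
        pm X (m + 2) (swap 0 1) = pm X (m + 2) (swap 0 1 * σ * swap 0 1) := fun σ => by
      rw [pm_mul, pm_mul]
    obtain ⟨⟨p, e⟩, he⟩ := Perm.decomposeFin.symm.surjective (swap 0 1 * σ * swap 0 1)
    obtain ⟨c, hc⟩ := ih e
    refine ⟨(if p = 0 then chi K X else 1) * c, ?_⟩
    rw [tailTrace_succ]
    refine (congrArg (fun f => tailTrace K X m (ptrace K X (tensorPow X (m + 1)) f))
      (h1 σ)).trans ?_
    rw [← he, decomposeFin_symm_eq, ptrace_pm, map_smul, hc, smul_smul]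

end RightTrace

/-! ### Extending the antisymmetry of a block by one more point -/

section Contraction

open Equiv

variable {K : Type*} [Field K] {W : Type*} [AddCommGroup W] [Module K W]

/-- The embedding of the permutations of the last `n` of `n + k` points. -/
def extNHom (n k : ℕ) : Perm (Fin n) →* Perm (Fin (n + k)) :=
  ⟨⟨extN k, extN_one k⟩, extN_mul k⟩

theorem extNHom_apply (n k : ℕ) (σ : Perm (Fin n)) : extNHom n k σ = extN k σ := rfl

/-- If the antisymmetry of `x` in `S` cannot be extended to a further point of `R`, and the other
points contribute a scalar to the Jucys-Murphy element, then it cannot be extended by `0`. -/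
theorem smul_eq_zero_of_contraction {m : ℕ} (ρ : Perm (Fin (m + 1)) →* Module.End K W) (s : ℤˣ)
    {x : W} {κ c : K} {S R : Finset (Fin m)} (hS : SwapEigen (ρ.comp (extNHom m 1)) (-s) S x)
    (hd : Disjoint S R)
    (hJ : c • x + ∑ p ∈ R, ρ (swap 0 p.succ) x + ∑ p ∈ S, ρ (swap 0 p.succ) x = κ • x)
    (hR : ∀ p ∈ R, x = ((s : ℤ) : K) • ∑ q ∈ S, ρ (swap q.succ p.succ) x) :
    (κ - c + ((s : ℤ) : K) * S.card) •
      (x - ((s : ℤ) : K) • ∑ q ∈ S, ρ (swap 0 q.succ) x) = 0 := by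
  have hs : ((s : ℤ) : K) * ((s : ℤ) : K) = 1 := units_mul_self_cast s
  set B : W →ₗ[K] W := ∑ q ∈ S, ρ (swap 0 q.succ) with hB
  have hBa : ∀ w, ∑ q ∈ S, ρ (swap 0 q.succ) w = B w := fun w => by
    rw [hB, LinearMap.sum_apply]
  have h1 : ∑ p ∈ R, ρ (swap 0 p.succ) x = (κ - c) • x - B x := by
    rw [hBa] at hJ
    rw [sub_smul, ← hJ]
    abel
  -- Each `x` in the sum is replaced by its expression from `hR`. Writing `0`, `p`, `q` for the
  -- three points involved, `(0 p)(q p) = (0 q)(0 p)` pulls out `B`. Hence `(κ - c) x - B x = s B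
  -- ((κ - c) x - B x)`.
  have h2 : ∑ p ∈ R, ρ (swap 0 p.succ) x = ((s : ℤ) : K) • B ((κ - c) • x - B x) := by
    rw [← h1, ← hBa]
    simp_rw [map_sum]
    rw [Finset.sum_comm, Finset.smul_sum]
    refine Finset.sum_congr rfl fun p hp => ?_
    conv_lhs => rw [hR p hp]
    rw [map_smul, map_sum]
    congr 1
    refine Finset.sum_congr rfl fun q hq => ?_
    have hqp : q.succ ≠ p.succ := fun h =>
      Finset.disjoint_left.1 hd hq ((Fin.succ_inj.1 h) ▸ hp)
    rw [← Module.End.mul_apply, ← Module.End.mul_apply, ← map_mul, ← map_mul,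
      swap_comm 0 p.succ, swap_comm 0 q.succ,
      swap_mul_swap_conj (x := q.succ) (p := 0) (t := p.succ) (Fin.succ_ne_zero q) hqp]
  have h3 : SwapEigen ρ (-s) (S.map (Fin.succEmb m)) x := by
    intro a ha b hb hab
    obtain ⟨a', ha', rfl⟩ := Finset.mem_map.1 ha
    obtain ⟨b', hb', rfl⟩ := Finset.mem_map.1 hb
    have := hS a' ha' b' hb' (fun h => hab (congrArg _ h))
    rw [MonoidHom.comp_apply, extNHom_apply, extN_swap] at this
    exact this
  have h0 : (0 : Fin (m + 1)) ∉ S.map (Fin.succEmb m) := by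
    simp [Fin.succ_ne_zero]
  set w := x - ((s : ℤ) : K) • B x with hw
  -- Antisymmetry including the point `0` makes `w` an eigenvector of `B` with eigenvalue `-s |S|`.
  -- The relation `h2` gives the eigenvalue `κ - c` instead, and comparing the two proves the claim.
  have h4 : SwapEigen ρ (-s) (insert 0 (S.map (Fin.succEmb m))) w := by
    have h5 := h3.insert h0
    have h6 : x + (((-s : ℤˣ) : ℤ) : K) • ∑ y ∈ S.map (Fin.succEmb m), ρ (swap y 0) x = w := by
      rw [hw, ← hBa, Finset.sum_map]
      simp [sub_eq_add_neg, swap_comm]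
    rwa [h6] at h5
  have h5 : B w = -(((s : ℤ) : K) * S.card) • w := by
    rw [← hBa]
    have : ∀ q ∈ S, ρ (swap 0 q.succ) w = (((-s : ℤˣ) : ℤ) : K) • w := fun q hq =>
      h4 _ (Finset.mem_insert_self _ _) _ (Finset.mem_insert_of_mem
        (Finset.mem_map_of_mem (Fin.succEmb m) hq)) (Fin.succ_ne_zero q).symm
    rw [Finset.sum_congr rfl this, Finset.sum_const, ← Nat.cast_smul_eq_nsmul K, smul_smul]
    congr 1
    push_cast
    ring
  have h6 : B w = (κ - c) • w := by
    have h7 := h1.symm.trans h2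
    have h8 : B w = B x - ((s : ℤ) : K) • B (B x) := by rw [hw, map_sub, map_smul]
    have h9 : ((s : ℤ) : K) • B ((κ - c) • x - B x) =
        (κ - c) • ((s : ℤ) : K) • B x - ((s : ℤ) : K) • B (B x) := by
      rw [map_sub, map_smul, smul_sub, smul_comm]
    rw [h9] at h7
    rw [h8, hw, smul_sub]
    have := congrArg (fun z => B x + z - (κ - c) • ((s : ℤ) : K) • B x) h7
    rw [← sub_eq_zero] at this ⊢
    rw [← neg_eq_zero, ← this]
    abel
  rw [hBa, ← hw, add_smul, ← h6, h5, neg_smul, neg_add_cancel]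

variable (d : ℕ)

/-- `w` is an eigenvector, with eigenvalue `s`, of the transpositions of two points less than `n`
in the same block of `d` points. -/
def BlockEigen {m : ℕ} (ρ : Perm (Fin m) →* Module.End K W) (s : ℤˣ) (n : ℕ) (w : W) : Prop :=
  ∀ x y : Fin m, (x : ℕ) < n → (y : ℕ) < n → x ≠ y → (x : ℕ) / d = (y : ℕ) / d →
    ρ (swap x y) w = ((s : ℤ) : K) • w

variable {d}

/-- The points less than `n` in the block of `n`. -/
def curBlock (d m n : ℕ) : Finset (Fin m) :=
  Finset.univ.filter fun x => (x : ℕ) < n ∧ (x : ℕ) / d = n / d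

theorem mem_curBlock {m n : ℕ} {x : Fin m} :
    x ∈ curBlock d m n ↔ (x : ℕ) < n ∧ (x : ℕ) / d = n / d := by
  simp [curBlock]

theorem BlockEigen.swapEigen {m n : ℕ} {ρ : Perm (Fin m) →* Module.End K W} {s : ℤˣ} {w : W}
    (h : BlockEigen d ρ s n w) : SwapEigen ρ s (curBlock d m n) w := fun x hx y hy hxy =>
  h x y (mem_curBlock.1 hx).1 (mem_curBlock.1 hy).1 hxy
    ((mem_curBlock.1 hx).2.trans (mem_curBlock.1 hy).2.symm)

/-- The argument of `swap p ⟨n, hn⟩` is antisymmetric in the current block together with `p` by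
`SwapEigen.insert`, and the transposition then brings `p` to position `n`. Transpositions inside the
earlier blocks commute with everything used here, so the earlier antisymmetry persists. -/
theorem BlockEigen.succ {m n : ℕ} {ρ : Perm (Fin m) →* Module.End K W} {s : ℤˣ} {w : W}
    (h : BlockEigen d ρ s n w) (hn : n < m) {p : Fin m} (hp : n ≤ p) :
    BlockEigen d ρ s (n + 1) (ρ (swap p ⟨n, hn⟩)
      (w + ((s : ℤ) : K) • ∑ q ∈ curBlock d m n, ρ (swap q p) w)) := by
  set v := w + ((s : ℤ) : K) • ∑ q ∈ curBlock d m n, ρ (swap q p) w with hv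
  set N : Fin m := ⟨n, hn⟩
  have hpS : p ∉ curBlock d m n := fun hp' => by
    have := (mem_curBlock.1 hp').1
    omega
  have h1 : SwapEigen ρ s (insert p (curBlock d m n)) v := h.swapEigen.insert hpS
  have conj : ∀ x y : Fin m, ρ (swap x y) (ρ (swap p N) v) =
      ρ (swap p N) (ρ (swap (swap p N x) (swap p N y)) v) := by
    intro x y
    rw [← Module.End.mul_apply, ← Module.End.mul_apply, ← map_mul, ← map_mul]
    congr 2
    have := Equiv.swap_mul_eq_mul_swap (swap p N) x y
    rwa [swap_inv] at this
  have fix : ∀ x : Fin m, (x : ℕ) < n → swap p N x = x := fun x hx =>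
    swap_apply_of_ne_of_ne (fun e => by rw [e] at hx; omega) (fun e => by
      rw [e] at hx
      exact absurd hx (lt_irrefl n))
  intro x y hx hy hxy hxy'
  rw [conj]
  by_cases hb : (x : ℕ) / d = n / d
  · have mem : ∀ z : Fin m, (z : ℕ) < n + 1 → (z : ℕ) / d = n / d →
        swap p N z ∈ insert p (curBlock d m n) := by
      intro z hz hz'
      rcases Nat.lt_succ_iff_lt_or_eq.1 hz with hz1 | hz1
      · rw [fix z hz1]
        exact Finset.mem_insert_of_mem (mem_curBlock.2 ⟨hz1, hz'⟩)
      · have : z = N := Fin.ext hz1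
        rw [this, swap_apply_right]
        exact Finset.mem_insert_self _ _
    rw [h1 _ (mem x hx hb) _ (mem y hy (hxy'.symm.trans hb)) (fun e => hxy ((swap p N).injective e)),
      map_smul]
  · have lt : ∀ z : Fin m, (z : ℕ) < n + 1 → (z : ℕ) / d ≠ n / d → (z : ℕ) < n := by
      intro z hz hz'
      rcases Nat.lt_succ_iff_lt_or_eq.1 hz with hz1 | hz1
      · exact hz1
      · exact absurd (by rw [hz1]) hz'
    have hx1 := lt x hx hb
    have hy1 := lt y hy (fun e => hb (hxy'.trans e))
    rw [fix x hx1, fix y hy1, ← map_smul]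
    congr 1
    have comm : ∀ q ∈ curBlock d m n, ρ (swap x y) (ρ (swap q p) w) =
        ((s : ℤ) : K) • ρ (swap q p) w := by
      intro q hq
      have ne : ∀ z : Fin m, (z : ℕ) < n → (z : ℕ) / d ≠ n / d → swap q p z = z := by
        intro z hz hz'
        refine swap_apply_of_ne_of_ne (fun e => ?_) (fun e => ?_)
        · rw [e] at hz'
          exact hz' (mem_curBlock.1 hq).2
        · rw [e] at hz
          omega
      have h5 := Equiv.swap_mul_eq_mul_swap (swap q p) x y
      rw [swap_inv, ne x hx1 hb, ne y hy1 (fun e => hb (hxy'.trans e))] at h5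
      rw [← Module.End.mul_apply, ← map_mul, h5, map_mul, Module.End.mul_apply,
        h x y hx1 hy1 hxy hxy', map_smul]
    rw [hv, map_add, map_smul, map_sum, Finset.sum_congr rfl comm, h x y hx1 hy1 hxy hxy',
      ← Finset.smul_sum, smul_add]

/-- A sum over the complete blocks before `n`. -/
theorem sum_eq_blocks {m n : ℕ} (f : Fin m → W) :
    ∑ p, f p = (∑ i ∈ Finset.range (n / d), ∑ p ∈ Finset.univ.filter
        (fun p : Fin m => (p : ℕ) < n ∧ (p : ℕ) / d = i), f p) +
      ∑ p ∈ Finset.univ.filter (fun p : Fin m => n ≤ p), f p + ∑ p ∈ curBlock d m n, f p := by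
  have h1 := Finset.sum_fiberwise_of_maps_to (s := Finset.univ.filter fun p : Fin m => (p : ℕ) < n)
    (t := Finset.range (n / d + 1)) (g := fun p => (p : ℕ) / d) (fun p hp =>
      Finset.mem_range.2 (Nat.lt_succ_of_le (Nat.div_le_div_right
        (Finset.mem_filter.1 hp).2.le))) f
  rw [Finset.sum_range_succ] at h1
  simp_rw [Finset.filter_filter] at h1
  rw [← Finset.sum_filter_add_sum_filter_not Finset.univ (fun p : Fin m => (p : ℕ) < n), ← h1,
    curBlock]
  simp_rw [not_lt]
  abel

theorem card_curBlock (hd : 0 < d) {m n : ℕ} (hn : n < m) : (curBlock d m n).card = n % d := by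
  have h : (curBlock d m n).map Fin.valEmbedding = Finset.Ico (n / d * d) n := by
    ext x
    simp only [Finset.mem_map, mem_curBlock, Fin.valEmbedding_apply, Finset.mem_Ico]
    constructor
    · rintro ⟨y, ⟨h1, h2⟩, rfl⟩
      exact ⟨h2 ▸ Nat.div_mul_le_self _ _, h1⟩
    · rintro ⟨h1, h2⟩
      refine ⟨⟨x, h2.trans hn⟩, ⟨h2, le_antisymm (Nat.div_le_div_right h2.le) ?_⟩, rfl⟩
      exact (Nat.le_div_iff_mul_le hd).2 h1
  rw [← Finset.card_map Fin.valEmbedding, h, Nat.card_Ico]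
  have := Nat.div_add_mod' n d
  omega

theorem card_block (hd : 0 < d) {m n i : ℕ} (hn : n ≤ m) (hi : i < n / d) :
    (Finset.univ.filter fun p : Fin m => (p : ℕ) < n ∧ (p : ℕ) / d = i).card = d := by
  have h : (Finset.univ.filter fun p : Fin m => (p : ℕ) < n ∧ (p : ℕ) / d = i).map
      Fin.valEmbedding = Finset.Ico (i * d) (i * d + d) := by
    have h0 : (i + 1) * d ≤ n := (Nat.le_div_iff_mul_le hd).1 hi
    ext x
    simp only [Finset.mem_map, Finset.mem_filter, Finset.mem_univ, true_and,
      Fin.valEmbedding_apply, Finset.mem_Ico]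
    constructor
    · rintro ⟨y, ⟨h1, h2⟩, rfl⟩
      have := (Nat.div_eq_iff hd).1 h2
      constructor <;> omega
    · rintro ⟨h1, h2⟩
      have h3 : x < n := by
        rw [add_mul] at h0
        omega
      refine ⟨⟨x, h3.trans_le hn⟩, ⟨h3, (Nat.div_eq_iff hd).2 ?_⟩, rfl⟩
      constructor <;> dsimp only <;> omega
  rw [← Finset.card_map Fin.valEmbedding, h, Nat.card_Ico, Nat.add_sub_cancel_left]

end Contraction

/-! ### Permutations of an initial segment -/

section Pad

open Equiv

/-- The first `i` of `j + i` points. -/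
def firstEmb (i j : ℕ) : Fin i ↪ Fin (j + i) :=
  ⟨Fin.castLE (Nat.le_add_left i j), Fin.castLE_injective _⟩

theorem firstEmb_val (i j : ℕ) (x : Fin i) : (firstEmb i j x : ℕ) = x := rfl

/-- The embedding of the permutations of the first `i` of `j + i` points. -/
def padHom (i j : ℕ) : Perm (Fin i) →* Perm (Fin (j + i)) :=
  Perm.viaEmbeddingHom (firstEmb i j)

theorem padHom_apply_first {i j : ℕ} (σ : Perm (Fin i)) (x : Fin i) :
    padHom i j σ (firstEmb i j x) = firstEmb i j (σ x) :=
  Perm.viaEmbedding_apply σ (firstEmb i j) x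

theorem padHom_apply_of_le {i j : ℕ} (σ : Perm (Fin i)) {x : Fin (j + i)} (hx : i ≤ x) :
    padHom i j σ x = x :=
  Perm.viaEmbedding_apply_of_notMem σ (firstEmb i j) x (by
    rintro ⟨y, rfl⟩
    rw [firstEmb_val] at hx
    exact absurd y.2 (not_lt.2 hx))

theorem fin_add_cases {i j : ℕ} (x : Fin (j + i)) : (∃ y, x = firstEmb i j y) ∨ i ≤ (x : ℕ) := by
  by_cases h : (x : ℕ) < i
  · exact Or.inl ⟨⟨x, h⟩, Fin.ext rfl⟩
  · exact Or.inr (not_lt.1 h)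

theorem padHom_swap {i j : ℕ} (x y : Fin i) :
    padHom i j (swap x y) = swap (firstEmb i j x) (firstEmb i j y) := by
  refine Equiv.ext fun z => ?_
  rcases fin_add_cases z with ⟨z, rfl⟩ | hz
  · rw [padHom_apply_first, (firstEmb i j).injective.swap_apply]
  · rw [padHom_apply_of_le _ hz, swap_apply_of_ne_of_ne]
    · rintro rfl
      exact absurd x.2 (not_lt.2 hz)
    · rintro rfl
      exact absurd y.2 (not_lt.2 hz)

theorem padHom_extPerm {i j : ℕ} (σ : Perm (Fin i)) :
    padHom (i + 1) j (extPerm σ) = extPerm (padHom i j σ) := by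
  refine Equiv.ext fun z => ?_
  rcases fin_add_cases z with ⟨z, rfl⟩ | hz
  · rw [padHom_apply_first]
    refine Fin.cases ?_ (fun y => ?_) z
    · rw [extPerm_zero]
      exact (extPerm_zero (padHom i j σ)).symm
    · rw [extPerm_succ]
      have h1 : firstEmb (i + 1) j y.succ = (firstEmb i j y).succ := rfl
      rw [h1, extPerm_succ, padHom_apply_first]
      rfl
  · rw [padHom_apply_of_le _ hz]
    revert hz
    refine Fin.cases (fun hz => ?_) (fun y hz => ?_) z
    · exact absurd hz (by simp)
    · rw [extPerm_succ, padHom_apply_of_le _ (by simpa using hz)]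

end Pad

/-! ### Products of antisymmetrizers of blocks -/

section BlockAlt

open Equiv

variable {K : Type*} [Field K]

/-- The map of group algebras given by a homomorphism of groups. -/
def mapAlg (K : Type*) [Field K] {G H : Type*} [Group G] [Group H] (f : G →* H) :
    MonoidAlgebra K G →ₐ[K] MonoidAlgebra K H :=
  MonoidAlgebra.lift K _ G ((MonoidAlgebra.of K H).comp f)

theorem lift_mapAlg {G H : Type*} [Group G] [Group H] (f : G →* H) {R : Type*} [Ring R]
    [Algebra K R] (ρ : H →* R) (y : MonoidAlgebra K G) :
    MonoidAlgebra.lift K R H ρ (mapAlg K f y) = MonoidAlgebra.lift K R G (ρ.comp f) y := by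
  induction y using MonoidAlgebra.induction_on with
  | of g =>
    rw [mapAlg, MonoidAlgebra.lift_of, MonoidAlgebra.lift_of, MonoidHom.comp_apply,
      MonoidAlgebra.lift_of]
    rfl
  | add x y hx hy => rw [map_add, map_add, map_add, hx, hy]
  | smul c x hx => rw [map_smul, map_smul, map_smul, hx]

/-- The antisymmetrizer (for `s = 1`) as an element of the group algebra. -/
def altElt (K : Type*) [Field K] (s : ℤˣ) (n : ℕ) : MonoidAlgebra K (Perm (Fin n)) :=
  (n.factorial : K)⁻¹ • ∑ σ : Perm (Fin n), (((tw (-s) σ : ℤˣ) : ℤ) : K) • MonoidAlgebra.of K _ σ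

/-- The product of the antisymmetrizers of `k` blocks of `d` points. -/
def blockAlt (K : Type*) [Field K] (s : ℤˣ) (d : ℕ) :
    (k : ℕ) → MonoidAlgebra K (Perm (Fin (d * k)))
  | 0 => 1
  | k + 1 => mapAlg K (extNHom (d * k) d) (blockAlt K s d k) *
      mapAlg K (padHom d (d * k)) (altElt K s d)

variable [CharZero K] {W : Type*} [AddCommGroup W] [Module K W]

theorem lift_altElt_apply {s : ℤˣ} {n : ℕ} {ρ : Perm (Fin n) →* Module.End K W} {w : W}
    (h : ∀ σ, ρ σ w = (((tw (-s) σ : ℤˣ) : ℤ) : K) • w) :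
    MonoidAlgebra.lift K _ _ ρ (altElt K s n) w = w := by
  rw [altElt, map_smul, map_sum, LinearMap.smul_apply, LinearMap.sum_apply]
  simp_rw [map_smul, MonoidAlgebra.lift_of, LinearMap.smul_apply, h, smul_smul,
    units_mul_self_cast, one_smul]
  rw [Finset.sum_const, Finset.card_univ, Fintype.card_perm, Fintype.card_fin,
    ← Nat.cast_smul_eq_nsmul K, smul_smul,
    inv_mul_cancel₀ (Nat.cast_ne_zero.2 n.factorial_ne_zero), one_smul]

theorem extN_swap_comp (n k : ℕ) (x y : Fin n) :
    extNHom n k (swap x y) = swap (x.addNat k) (y.addNat k) := extN_swap k x y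

/-- Each factor of `blockAlt` averages over the signed permutations of one block, and all of these
fix `w`. The first block is handled through `padHom`, and the others by induction after a shift by
`d`. -/
theorem BlockEigen.lift_blockAlt {s : ℤˣ} {d : ℕ} (hd : 0 < d) (k : ℕ) :
    ∀ (ρ : Perm (Fin (d * k)) →* Module.End K W) (w : W), BlockEigen d ρ (-s) (d * k) w →
    MonoidAlgebra.lift K _ _ ρ (blockAlt K s d k) w = w := by
  induction k with
  | zero =>
    intro ρ w _
    rw [blockAlt, map_one]
    rfl
  | succ k ih =>
    intro ρ w h
    rw [blockAlt, map_mul, lift_mapAlg, lift_mapAlg, Module.End.mul_apply, lift_altElt_apply,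
      ih]
    · intro x y _ _ hxy hxy'
      rw [MonoidHom.comp_apply, extN_swap_comp]
      refine h _ _ (Fin.is_lt _) (Fin.is_lt _) (fun e => hxy (Fin.addNat_inj d |>.1 e)) ?_
      rw [Fin.val_addNat, Fin.val_addNat, Nat.add_div_right _ hd, Nat.add_div_right _ hd, hxy']
    · intro σ
      refine SwapEigen.perm_univ (ρ := ρ.comp (padHom d (d * k))) (fun x _ y _ hxy => ?_) σ
      rw [MonoidHom.comp_apply, padHom_swap]
      refine h _ _ (Fin.is_lt _) (Fin.is_lt _) (fun e => hxy ((firstEmb _ _).injective e)) ?_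
      rw [firstEmb_val, firstEmb_val, Nat.div_eq_of_lt x.2, Nat.div_eq_of_lt y.2]

end BlockAlt

/-! ### Concatenation of tensor powers -/

section Cat

open Equiv

variable {C : Type u} [Category.{v} C] [MonoidalCategory C]

/-- The isomorphism `X^{⊗ i} ⊗ X^{⊗ j} ≅ X^{⊗ (j + i)}`. -/
def catIso (X : C) : (i j : ℕ) → (tensorPow X i ⊗ tensorPow X j ≅ tensorPow X (j + i))
  | 0, j => λ_ (tensorPow X j)
  | i + 1, j => α_ X (tensorPow X i) (tensorPow X j) ≪≫ whiskerLeftIso X (catIso X i j)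

theorem catIso_succ_hom (X : C) (i j : ℕ) : (catIso X (i + 1) j).hom =
    (α_ X (tensorPow X i) (tensorPow X j)).hom ≫ X ◁ (catIso X i j).hom := rfl

variable [SymmetricCategory C]

theorem whiskerLeft_pm_catIso (X : C) (i : ℕ) {j : ℕ} (τ : Perm (Fin j)) :
    tensorPow X i ◁ pm X j τ ≫ (catIso X i j).hom =
      (catIso X i j).hom ≫ pm X (j + i) (extNHom j i τ) := by
  induction i with
  | zero => exact leftUnitor_naturality (pm X j τ)
  | succ i ih =>
    have h1 : pm X (j + (i + 1)) (extNHom j (i + 1) τ) = X ◁ pm X (j + i) (extNHom j i τ) :=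
      pm_extPerm X (j + i) (extNHom j i τ)
    have h2 : (X ⊗ tensorPow X i) ◁ pm X j τ ≫ (α_ X (tensorPow X i) (tensorPow X j)).hom ≫
        X ◁ (catIso X i j).hom = ((α_ X (tensorPow X i) (tensorPow X j)).hom ≫
        X ◁ (catIso X i j).hom) ≫ X ◁ pm X (j + i) (extNHom j i τ) := by
      rw [associator_naturality_right_assoc, ← whiskerLeft_comp, ih, whiskerLeft_comp,
        Category.assoc]
    rw [h1]
    exact h2

theorem pm_whiskerRight_catIso (X : C) {i : ℕ} (j : ℕ) (σ : Perm (Fin i)) :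
    pm X i σ ▷ tensorPow X j ≫ (catIso X i j).hom =
      (catIso X i j).hom ≫ pm X (j + i) (padHom i j σ) := by
  induction i, σ using perm_fin_induction with
  | one n => rw [map_one, pm_one, pm_one, id_whiskerRight, Category.id_comp, Category.comp_id]
  | mul n σ τ h1 h2 =>
    rw [map_mul, pm_mul, pm_mul, comp_whiskerRight, Category.assoc, h1, reassoc_of% h2]
  | first n =>
    have h0 : padHom (n + 2) j (swap 0 1) = swap 0 1 := padHom_swap 0 1
    have h1 : pm X (j + (n + 2)) (padHom (n + 2) j (swap 0 1)) =
        swapTwo X (tensorPow X (j + n)) := by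
      rw [h0]
      exact pm_swap X (j + n)
    have h2 : (catIso X (n + 2) j).hom = (α_ X (X ⊗ tensorPow X n) (tensorPow X j)).hom ≫
        X ◁ (α_ X (tensorPow X n) (tensorPow X j)).hom ≫ X ◁ X ◁ (catIso X n j).hom := by
      rw [catIso_succ_hom, catIso_succ_hom]
      exact congrArg (_ ≫ ·) (whiskerLeft_comp X _ _)
    have h3 : swapTwo X (tensorPow X n) ▷ tensorPow X j ≫
        (α_ X (X ⊗ tensorPow X n) (tensorPow X j)).hom ≫
          X ◁ (α_ X (tensorPow X n) (tensorPow X j)).hom =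
        ((α_ X (X ⊗ tensorPow X n) (tensorPow X j)).hom ≫
          X ◁ (α_ X (tensorPow X n) (tensorPow X j)).hom) ≫
            swapTwo X (tensorPow X n ⊗ tensorPow X j) := by
      simp only [swapTwo, comp_whiskerRight]
      monoidal
    rw [h1, h2, pm_swap]
    have h4 := swapTwo_naturality X (catIso X n j).hom
    have h5 : swapTwo X (tensorPow X n) ▷ tensorPow X j ≫
        (α_ X (X ⊗ tensorPow X n) (tensorPow X j)).hom ≫
          X ◁ (α_ X (tensorPow X n) (tensorPow X j)).hom ≫ X ◁ X ◁ (catIso X n j).hom =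
        ((α_ X (X ⊗ tensorPow X n) (tensorPow X j)).hom ≫
          X ◁ (α_ X (tensorPow X n) (tensorPow X j)).hom ≫ X ◁ X ◁ (catIso X n j).hom) ≫
            swapTwo X (tensorPow X (j + n)) := by
      rw [Category.assoc, Category.assoc, h4]
      rw [reassoc_of% h3]
    exact h5
  | ext n σ h =>
    have h1 : pm X (j + (n + 1)) (padHom (n + 1) j (extPerm σ)) =
        X ◁ pm X (j + n) (padHom n j σ) := by
      rw [padHom_extPerm]
      exact pm_extPerm X (j + n) (padHom n j σ)
    have h2 : (X ◁ pm X n σ) ▷ tensorPow X j ≫ (α_ X (tensorPow X n) (tensorPow X j)).hom ≫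
        X ◁ (catIso X n j).hom = ((α_ X (tensorPow X n) (tensorPow X j)).hom ≫
        X ◁ (catIso X n j).hom) ≫ X ◁ pm X (j + n) (padHom n j σ) := by
      rw [associator_naturality_middle_assoc, ← whiskerLeft_comp, h, whiskerLeft_comp,
        Category.assoc]
    rw [h1, pm_extPerm]
    exact h2

end Cat

/-! ### Jucys-Murphy eigenvectors and nonvanishing block antisymmetrization -/

section JucysMurphy

open Equiv

variable (K : Type*) [Field K]
variable {C : Type u} [Category.{v} C] [Preadditive C] [Linear K C] [MonoidalCategory C]
  [SymmetricCategory C] [MonoidalPreadditive C] [MonoidalLinear K C]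

/-- The action of the symmetric group on the morphisms to `X^{⊗ n} ⊗ W`. -/
def tensRep (Z X W : C) (n : ℕ) : Perm (Fin n) →* Module.End K (Z ⟶ tensorPow X n ⊗ W) where
  toFun σ := Linear.rightComp K Z (pm X n σ ▷ W)
  map_one' := by
    refine LinearMap.ext fun z => ?_
    simp [pm_one]
  map_mul' σ τ := by
    refine LinearMap.ext fun z => ?_
    simp [pm_mul]

theorem tensRep_apply (Z X W : C) (n : ℕ) (σ : Perm (Fin n)) (z : Z ⟶ tensorPow X n ⊗ W) :
    tensRep K Z X W n σ z = z ≫ pm X n σ ▷ W := rfl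

/-- The sum of the transpositions exchanging the first factor with another one. -/
def jm {C : Type u} [Category.{v} C] [Preadditive C] [MonoidalCategory C] [SymmetricCategory C]
    (X : C) (m : ℕ) : tensorPow X (m + 1) ⟶ tensorPow X (m + 1) :=
  ∑ p : Fin m, pm X (m + 1) (swap 0 p.succ)

theorem jm_comm (X : C) {m : ℕ} (σ : Perm (Fin m)) :
    pm X (m + 1) (extPerm σ) ≫ jm X m = jm X m ≫ pm X (m + 1) (extPerm σ) := by
  rw [jm, Preadditive.sum_comp, Preadditive.comp_sum]
  simp_rw [← pm_mul]
  refine (Fintype.sum_equiv σ _ _ fun p => ?_).symm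
  rw [Equiv.mul_swap_eq_swap_mul, extPerm_zero, extPerm_succ]

/-- Adding a factor `X` to a morphism to `X^{⊗ m} ⊗ W`. -/
def upMap (X : C) {L W : C} {m : ℕ} :
    (L ⟶ tensorPow X m ⊗ W) →ₗ[K] (X ⊗ L ⟶ tensorPow X (m + 1) ⊗ W) where
  toFun u := X ◁ u ≫ (α_ X (tensorPow X m) W).inv
  map_add' u u' := by
    rw [MonoidalPreadditive.whiskerLeft_add]
    exact Preadditive.add_comp _ _ _ _ _ _
  map_smul' c u := by
    rw [MonoidalLinear.whiskerLeft_smul]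
    exact Linear.smul_comp _ _ _ _ _ _

theorem upMap_apply (X : C) {L W : C} {m : ℕ} (u : L ⟶ tensorPow X m ⊗ W) :
    upMap K X u = X ◁ u ≫ (α_ X (tensorPow X m) W).inv := rfl

theorem upMap_tensRep (X : C) {L W : C} {m : ℕ} (u : L ⟶ tensorPow X m ⊗ W)
    (σ : Perm (Fin m)) : upMap K X (tensRep K L X W m σ u) =
      tensRep K (X ⊗ L) X W (m + 1) (extPerm σ) (upMap K X u) := by
  rw [tensRep_apply, tensRep_apply, upMap_apply, upMap_apply, whiskerLeft_comp, pm_extPerm,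
    Category.assoc]
  refine (congrArg (_ ≫ ·) (associator_inv_naturality_middle _ _ _)).trans ?_
  exact (Category.assoc _ _ _).symm

/-- The morphism `u` is an eigenvector of the Jucys-Murphy element. -/
def JMEigen (X : C) {L W : C} {m : ℕ} (κ : K) (u : L ⟶ tensorPow X m ⊗ W) : Prop :=
  ∑ p : Fin m, tensRep K (X ⊗ L) X W (m + 1) (swap 0 p.succ) (upMap K X u) = κ • upMap K X u

variable {K}

/-- The sum of the transpositions `(0 p)` commutes with the permutations fixing `0`, so the
eigenvectors are stable under the permutations of the `m` old factors. -/
theorem JMEigen.tensRep {X L W : C} {m : ℕ} {κ : K} {u : L ⟶ tensorPow X m ⊗ W}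
    (h : JMEigen K X κ u) (σ : Perm (Fin m)) :
    JMEigen K X κ (tensRep K L X W m σ u) := by
  rw [JMEigen, upMap_tensRep, ← map_smul, ← h, map_sum]
  refine Fintype.sum_equiv σ.symm _ _ fun p => ?_
  rw [← Module.End.mul_apply, ← Module.End.mul_apply, ← map_mul, ← map_mul,
    Equiv.mul_swap_eq_swap_mul, extPerm_zero, extPerm_succ, apply_symm_apply]

theorem JMEigen.lift {X L W : C} {m : ℕ} {κ : K} {u : L ⟶ tensorPow X m ⊗ W}
    (h : JMEigen K X κ u) (y : MonoidAlgebra K (Perm (Fin m))) :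
    JMEigen K X κ (MonoidAlgebra.lift K _ _ (TensorDet.tensRep K L X W m) y u) := by
  induction y using MonoidAlgebra.induction_on with
  | of σ =>
    rw [MonoidAlgebra.lift_of]
    exact h.tensRep σ
  | add x y hx hy =>
    rw [JMEigen] at hx hy ⊢
    rw [map_add, LinearMap.add_apply, map_add, smul_add, ← hx, ← hy, ← Finset.sum_add_distrib]
    simp only [map_add]
  | smul c x hx =>
    rw [JMEigen] at hx ⊢
    rw [map_smul, LinearMap.smul_apply, map_smul, smul_comm, ← hx, Finset.smul_sum]
    simp only [map_smul]

variable [CharZero K] [RigidCategory C]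

/-- A morphism to `X^{⊗ N} ⊗ W` which is antisymmetric in `n` variables is zero if `Λⁿ(X)` is. -/
theorem tensRep_eq_zero (s : ℤˣ) {X : C} {n : ℕ} (h : alt K s X n = 0) {N : ℕ}
    {S : Finset (Fin N)} (hS : S.card = n) {Z W : C} {z : Z ⟶ tensorPow X N ⊗ W}
    (hz : SwapEigen (tensRep K Z X W N) (-s) S z) : z = 0 := by
  -- Duality moves `W` to the source and reduces the claim to morphisms to `X^{⊗ N}`.
  let e (Y : C) := tensorRightHomEquiv Z (ᘁW) W Y
  have e_smul : ∀ (c : K) (f : Z ⊗ (ᘁW) ⟶ tensorPow X N), e _ (c • f) = c • e _ f := by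
    intro c f
    simp [e, tensorRightHomEquiv, MonoidalLinear.smul_whiskerRight]
  obtain ⟨z0, rfl⟩ := (e _).surjective z
  have h1 : z0 = 0 := by
    refine eq_zero_of_alt_eq_zero K s h hS fun x hx y hy hxy => (e _).injective ?_
    rw [e_smul, postRep_apply]
    refine (tensorRightHomEquiv_naturality _ _).trans ?_
    exact hz x hx y hy hxy
  have h2 := e_smul 0 0
  rw [zero_smul, zero_smul] at h2
  rw [h1, h2]

variable [hK : Fact (Function.Bijective (algebraMap K (End (𝟙_ C))))]

/-- The hypothesis reads `X ◁ u ≫ Ω = 0`. Closing the added strand turns `Ω` into `χ(X) - s |S| = s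
(d - |S|)`, which is nonzero because `|S| < d`. -/
theorem eq_zero_of_upMap {X L W : C} {m : ℕ} {s : ℤˣ} {d : ℕ} (hX : Signed K s d X)
    (S : Finset (Fin m)) (hS : S.card < d) (u : L ⟶ tensorPow X m ⊗ W)
    (h : upMap K X u - ((s : ℤ) : K) • ∑ q ∈ S,
      tensRep K (X ⊗ L) X W (m + 1) (swap 0 q.succ) (upMap K X u) = 0) : u = 0 := by
  let A (f : tensorPow X (m + 1) ⟶ tensorPow X (m + 1)) :
      X ⊗ (tensorPow X m ⊗ W) ⟶ X ⊗ (tensorPow X m ⊗ W) :=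
    (α_ X (tensorPow X m) W).inv ≫ f ▷ W ≫ (α_ X (tensorPow X m) W).hom
  have hA : ∀ f, ptrace K X _ (A f) = ptrace K X _ f ▷ W := fun f => ptr_assoc X (Xᘁ) f
  let Ω := 𝟙 (X ⊗ (tensorPow X m ⊗ W)) - ((s : ℤ) : K) • ∑ q ∈ S,
    A (pm X (m + 1) (swap 0 q.succ))
  have h1 : X ◁ u ≫ Ω = 0 := by
    have h2 := congrArg (· ≫ (α_ X (tensorPow X m) W).hom) h
    have h3 : (upMap K X u - ((s : ℤ) : K) • ∑ q ∈ S,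
      tensRep K (X ⊗ L) X W (m + 1) (swap 0 q.succ) (upMap K X u)) ≫
        (α_ X (tensorPow X m) W).hom = X ◁ u ≫ Ω := by
      refine (Preadditive.sub_comp _ _ _).trans ?_
      rw [Preadditive.comp_sub, Linear.comp_smul, Preadditive.comp_sum]
      congr 1
      · rw [upMap_apply]
        refine (Category.assoc _ _ _).trans (congrArg (_ ≫ ·) ?_)
        exact Iso.inv_hom_id _
      · refine (Linear.smul_comp _ _ _ _ _ _).trans ?_
        congr 1
        refine (Preadditive.sum_comp _ _ _).trans (Finset.sum_congr rfl fun q _ => ?_)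
        rw [tensRep_apply, upMap_apply]
        exact (Category.assoc _ _ _).trans (Category.assoc _ _ _)
    rw [← h3]
    exact h2.trans zero_comp
  have h2 : ptrace K X _ Ω = (((s : ℤ) : K) * (d - S.card)) • 𝟙 _ := by
    have h4 : ∀ q ∈ S, ptrace K X _ (A (pm X (m + 1) (swap 0 q.succ))) = 𝟙 _ := by
      intro q _
      have h5 := ptrace_pm (K := K) X m q.succ 1
      rw [extPerm_one, mul_one, if_neg (Fin.succ_ne_zero q), one_smul, pm_one] at h5
      rw [hA, h5, id_whiskerRight]
    have h5 : ptrace K X (tensorPow X m ⊗ W) (𝟙 (X ⊗ (tensorPow X m ⊗ W))) =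
        chi K X • 𝟙 _ := by
      rw [← id_whiskerRight, ptrace_whiskerRight, chi]
    rw [map_sub, map_smul, map_sum, Finset.sum_congr rfl h4, h5, hX.2, Finset.sum_const,
      ← Nat.cast_smul_eq_nsmul K, smul_smul, ← sub_smul, mul_sub]
  have h3 := ptr_whisker X (Xᘁ) u Ω (𝟙 _)
  have h4 : ptr X (Xᘁ) (0 : X ⊗ L ⟶ X ⊗ (tensorPow X m ⊗ W)) = 0 := by simp [ptr]
  rw [whiskerLeft_id, Category.comp_id, h1, h4, Category.comp_id] at h3
  have h5 : u ≫ ptrace K X _ Ω = 0 := h3.symm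
  rw [h2, Linear.comp_smul, Category.comp_id] at h5
  refine (smul_eq_zero.1 h5).resolve_left (mul_ne_zero ?_ ?_)
  · exact fun h => one_ne_zero ((units_mul_self_cast (K := K) s).symm.trans (by rw [h, zero_mul]))
  · rw [sub_ne_zero]
    exact fun h => hS.ne' (Nat.cast_injective h)

/-- A complete block of `d` points cannot be extended by the new point `0`, since `alt K s X (d + 1)
= 0`. The vanishing of the extension says that the block contributes exactly `s` to the Jucys-Murphy
sum. -/
theorem sum_swap_upMap {X L W : C} {m : ℕ} {s : ℤˣ} {d : ℕ} (hX : Signed K s d X)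
    {S : Finset (Fin m)} (hS : S.card = d) {u : L ⟶ tensorPow X m ⊗ W}
    (h : SwapEigen (tensRep K L X W m) (-s) S u) :
    ∑ q ∈ S, tensRep K (X ⊗ L) X W (m + 1) (swap 0 q.succ) (upMap K X u) =
      ((s : ℤ) : K) • upMap K X u := by
  have h3 : SwapEigen (tensRep K (X ⊗ L) X W (m + 1)) (-s) (S.map (Fin.succEmb m))
      (upMap K X u) := by
    intro a ha b hb hab
    obtain ⟨a', ha', rfl⟩ := Finset.mem_map.1 ha
    obtain ⟨b', hb', rfl⟩ := Finset.mem_map.1 hb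
    have := upMap_tensRep K X u (swap a' b')
    rw [h a' ha' b' hb' (fun h => hab (congrArg _ h)), map_smul, extPerm_swap] at this
    exact this.symm
  have h0 : (0 : Fin (m + 1)) ∉ S.map (Fin.succEmb m) := by
    simp [Fin.succ_ne_zero]
  have h4 := tensRep_eq_zero s hX.1 (by rw [Finset.card_insert_of_notMem h0, Finset.card_map, hS])
    (h3.insert h0)
  rw [Finset.sum_map] at h4
  simp only [Fin.coe_succEmb, swap_comm _ (0 : Fin (m + 1))] at h4
  have h5 := congrArg (((s : ℤ) : K) • ·) h4
  simp only [smul_add, smul_smul, smul_zero] at h5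
  have h6 : ((s : ℤ) : K) * (((-s : ℤˣ) : ℤ) : K) = -1 := by
    have := units_mul_self_cast (K := K) s
    push_cast
    rw [mul_neg, this]
  rw [h6, neg_one_smul] at h5
  exact (sub_eq_zero.1 ((sub_eq_add_neg _ _).trans h5)).symm

/-- The positions are adjoined one at a time. If no `p ≥ n` extended the current block, the
Jucys-Murphy relation would prevent its extension by the new point `0` as well. Since the block is
incomplete, `eq_zero_of_upMap` would then make the vector zero. -/
theorem exists_blockEigen {X L W : C} {s : ℤˣ} {d k : ℕ} (hd : 0 < d) (hX : Signed K s d X)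
    {u : L ⟶ tensorPow X (d * k) ⊗ W} (hu : u ≠ 0) (hJ : JMEigen K X (((s : ℤ) : K) * k) u)
    (n : ℕ) : n ≤ d * k → ∃ y, MonoidAlgebra.lift K _ _ (tensRep K L X W (d * k)) y u ≠ 0 ∧
      BlockEigen d (tensRep K L X W (d * k)) (-s) n
        (MonoidAlgebra.lift K _ _ (tensRep K L X W (d * k)) y u) := by
  induction n with
  | zero => exact fun _ => ⟨1, by rwa [map_one], fun x _ hx => absurd hx (Nat.not_lt_zero _)⟩
  | succ n ih =>
    intro hn
    obtain ⟨y, hy, hb⟩ := ih (Nat.le_of_succ_le hn)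
    have hJ' := hJ.lift y
    set v := MonoidAlgebra.lift K _ _ (tensRep K L X W (d * k)) y u
    set ρ := tensRep K L X W (d * k) with hρ
    set S := curBlock d (d * k) n with hS
    have hnk : n / d < k := Nat.div_lt_of_lt_mul hn
    have key : ∃ p : Fin (d * k), n ≤ p ∧
        v + (((-s : ℤˣ) : ℤ) : K) • ∑ q ∈ S, ρ (swap q p) v ≠ 0 := by
      by_contra hcon
      push Not at hcon
      have hj : S.card = n % d := card_curBlock hd hn
      -- The `n / d` complete blocks contribute `s` each, whence the value of `c`. The set `S` is
      -- the current block and `R` consists of the positions not yet used.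
      have h1 := smul_eq_zero_of_contraction (tensRep K (X ⊗ L) X W (d * k + 1)) s
        (x := upMap K X v) (κ := ((s : ℤ) : K) * k) (c := ((s : ℤ) : K) * (n / d : ℕ)) (S := S)
        (R := Finset.univ.filter fun p : Fin (d * k) => n ≤ p) ?_ ?_ ?_ ?_
      · have h2 : ((s : ℤ) : K) * k - ((s : ℤ) : K) * (n / d : ℕ) + ((s : ℤ) : K) * S.card ≠ 0 := by
          rw [← mul_sub, ← mul_add]
          refine mul_ne_zero (fun h => one_ne_zero ((units_mul_self_cast (K := K) s).symm.trans
            (by rw [h, zero_mul]))) ?_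
          rw [← Nat.cast_sub hnk.le, ← Nat.cast_add]
          exact Nat.cast_ne_zero.2 (by omega)
        exact hy (eq_zero_of_upMap hX S (by rw [hj]; exact Nat.mod_lt _ hd) v
          ((smul_eq_zero.1 h1).resolve_left h2))
      · intro a ha b hb' hab
        rw [MonoidHom.comp_apply]
        refine (upMap_tensRep K X v (swap a b)).symm.trans ?_
        rw [← hρ, hb.swapEigen a ha b hb' hab, map_smul]
      · refine Finset.disjoint_left.2 fun p hp hp' => ?_
        have h2 := (mem_curBlock.1 hp).1
        have h3 := (Finset.mem_filter.1 hp').2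
        omega
      · refine Eq.trans ?_ hJ'
        rw [sum_eq_blocks (d := d) (n := n)]
        congr 2
        have h2 : ∀ i ∈ Finset.range (n / d), ∑ p ∈ Finset.univ.filter
            (fun p : Fin (d * k) => (p : ℕ) < n ∧ (p : ℕ) / d = i),
            tensRep K (X ⊗ L) X W (d * k + 1) (swap 0 p.succ) (upMap K X v) =
              ((s : ℤ) : K) • upMap K X v := by
          intro i hi
          refine sum_swap_upMap hX (card_block hd (Nat.le_of_succ_le hn) (Finset.mem_range.1 hi))
            fun a ha b hb' hab => ?_
          have ha' := (Finset.mem_filter.1 ha).2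
          have hb'' := (Finset.mem_filter.1 hb').2
          exact hb a b ha'.1 hb''.1 hab (ha'.2.trans hb''.2.symm)
        rw [Finset.sum_congr rfl h2, Finset.sum_const, Finset.card_range,
          ← Nat.cast_smul_eq_nsmul K, smul_smul, mul_comm ((s : ℤ) : K)]
      · intro p hp
        have h2 := congrArg (upMap K X) (hcon p (Finset.mem_filter.1 hp).2)
        rw [map_add, map_smul, map_sum, map_zero] at h2
        simp only [hρ, upMap_tensRep, extPerm_swap] at h2
        rw [Units.val_neg, Int.cast_neg, neg_smul] at h2
        exact sub_eq_zero.1 ((sub_eq_add_neg _ _).trans h2)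
    obtain ⟨p, hp, hne⟩ := key
    -- The group algebra element which antisymmetrizes `p` with the current block and then moves `p`
    -- to position `n`.
    refine ⟨MonoidAlgebra.of K _ (swap p ⟨n, hn⟩) * (1 + (((-s : ℤˣ) : ℤ) : K) •
      ∑ q ∈ S, MonoidAlgebra.of K _ (swap q p)) * y, ?_⟩
    have h1 : MonoidAlgebra.lift K _ _ ρ (MonoidAlgebra.of K _ (swap p ⟨n, hn⟩) *
        (1 + (((-s : ℤˣ) : ℤ) : K) • ∑ q ∈ S, MonoidAlgebra.of K _ (swap q p)) * y) u =
        ρ (swap p ⟨n, hn⟩) (v + (((-s : ℤˣ) : ℤ) : K) • ∑ q ∈ S, ρ (swap q p) v) := by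
      rw [map_mul, map_mul, MonoidAlgebra.lift_of, map_add, map_one, map_smul, map_sum]
      simp only [MonoidAlgebra.lift_of, Module.End.mul_apply, LinearMap.add_apply,
        LinearMap.smul_apply, LinearMap.sum_apply, Module.End.one_apply]
      rfl
    rw [h1]
    refine ⟨fun h => hne ?_, hb.succ hn hp⟩
    have h2 := congrArg (ρ (swap p ⟨n, hn⟩)) h
    rwa [← Module.End.mul_apply, ← map_mul, swap_mul_self, map_one, map_zero] at h2

/-- A nonzero eigenvector of the Jucys-Murphy element has a nonzero image under a permutation
followed by the antisymmetrizers of the blocks. -/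
theorem exists_lift_blockAlt {X L W : C} {s : ℤˣ} {d k : ℕ} (hd : 0 < d) (hX : Signed K s d X)
    {u : L ⟶ tensorPow X (d * k) ⊗ W} (hu : u ≠ 0) (hJ : JMEigen K X (((s : ℤ) : K) * k) u) :
    ∃ y, MonoidAlgebra.lift K _ _ (tensRep K L X W (d * k)) (blockAlt K s d k * y) u ≠ 0 := by
  obtain ⟨y, hy, hb⟩ := exists_blockEigen hd hX hu hJ (d * k) le_rfl
  refine ⟨y, ?_⟩
  rwa [map_mul, Module.End.mul_apply, hb.lift_blockAlt hd k]

end JucysMurphy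

/-! ### Invertible summands are Jucys-Murphy eigenvectors -/

section Invertible

open Equiv

variable (K : Type*) [Field K]
variable {C : Type u} [Category.{v} C] [Preadditive C] [Linear K C] [MonoidalCategory C]
  [SymmetricCategory C]

/-- The span of the endomorphisms `σ ⊗ w` of `X^{⊗ m} ⊗ W`. -/
def permSpan (X : C) (m : ℕ) (W : C) :
    Submodule K (tensorPow X m ⊗ W ⟶ tensorPow X m ⊗ W) :=
  Submodule.span K (Set.range fun x : Perm (Fin m) × (W ⟶ W) => pm X m x.1 ⊗ₘ x.2)

variable {K}
variable [MonoidalPreadditive C] [MonoidalLinear K C]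

/-- The isomorphism `X^{⊗ (m + 1)} ⊗ W ≅ X ⊗ (X^{⊗ m} ⊗ W)`. -/
def tailIso {C : Type u} [Category.{v} C] [MonoidalCategory C] (X : C) (m : ℕ) (W : C) :
    tensorPow X (m + 1) ⊗ W ≅ X ⊗ (tensorPow X m ⊗ W) :=
  α_ X (tensorPow X m) W

/-- The endomorphism of `X ⊗ (X^{⊗ m} ⊗ W)` given by one of `X^{⊗ (m + 1)} ⊗ W`. -/
def assocConj {X : C} {m : ℕ} {W : C} (g : tensorPow X (m + 1) ⊗ W ⟶ tensorPow X (m + 1) ⊗ W) :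
    X ⊗ (tensorPow X m ⊗ W) ⟶ X ⊗ (tensorPow X m ⊗ W) :=
  (tailIso X m W).inv ≫ g ≫ (tailIso X m W).hom

theorem assocConj_comp {X : C} {m : ℕ} {W : C}
    (g h : tensorPow X (m + 1) ⊗ W ⟶ tensorPow X (m + 1) ⊗ W) :
    assocConj (g ≫ h) = assocConj g ≫ assocConj h := by
  simp [assocConj]

theorem whiskerLeft_pm_tensor (X : C) {m : ℕ} {W : C} (σ : Perm (Fin m)) (w : W ⟶ W) :
    X ◁ (pm X m σ ⊗ₘ w) = assocConj (pm X (m + 1) (extPerm σ) ⊗ₘ w) := by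
  rw [pm_extPerm, ← id_tensorHom, ← id_tensorHom]
  have : (𝟙 X ⊗ₘ (pm X m σ ⊗ₘ w)) ≫ (tailIso X m W).inv = (tailIso X m W).inv ≫
      ((𝟙 X ⊗ₘ pm X m σ) ⊗ₘ w) := associator_inv_naturality (𝟙 X) (pm X m σ) w
  rw [assocConj]
  refine Eq.trans ?_ ((congrArg (· ≫ _) this).trans (Category.assoc _ _ _))
  rw [Category.assoc, Iso.inv_hom_id, Category.comp_id]

variable [RigidCategory C] [hK : Fact (Function.Bijective (algebraMap K (End (𝟙_ C))))]

variable (K) in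
/-- The partial trace over all factors of `X ⊗ (X^{⊗ m} ⊗ W)` but the first. -/
def headTrace (X : C) (m : ℕ) (W : C) (h : X ⊗ (tensorPow X m ⊗ W) ⟶ X ⊗ (tensorPow X m ⊗ W)) :
    X ⟶ X :=
  tailTrace K X m (rightTrace K (tensorPow X (m + 1)) W
    ((tailIso X m W).hom ≫ h ≫ (tailIso X m W).inv))

theorem headTrace_add {X : C} {m : ℕ} {W : C}
    (g h : X ⊗ (tensorPow X m ⊗ W) ⟶ X ⊗ (tensorPow X m ⊗ W)) :
    headTrace K X m W (g + h) = headTrace K X m W g + headTrace K X m W h := by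
  rw [headTrace, headTrace, headTrace, ← map_add, ← map_add, Preadditive.add_comp,
    Preadditive.comp_add]

theorem headTrace_smul {X : C} {m : ℕ} {W : C} (c : K)
    (h : X ⊗ (tensorPow X m ⊗ W) ⟶ X ⊗ (tensorPow X m ⊗ W)) :
    headTrace K X m W (c • h) = c • headTrace K X m W h := by
  rw [headTrace, headTrace, ← map_smul, ← map_smul, Linear.smul_comp, Linear.comp_smul]

theorem headTrace_whiskerRight_comp {X : C} {m : ℕ} {W : C} (f : X ⟶ X)
    (h : X ⊗ (tensorPow X m ⊗ W) ⟶ X ⊗ (tensorPow X m ⊗ W)) :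
    headTrace K X m W (f ▷ (tensorPow X m ⊗ W) ≫ h) = f ≫ headTrace K X m W h := by
  let g : tensorPow X (m + 1) ⟶ tensorPow X (m + 1) := f ▷ tensorPow X m
  have h1 : (tailIso X m W).hom ≫ f ▷ (tensorPow X m ⊗ W) = g ▷ W ≫ (tailIso X m W).hom :=
    (associator_naturality_left f (tensorPow X m) W).symm
  rw [headTrace, headTrace, Category.assoc, reassoc_of% h1, rightTrace_whiskerRight_comp]
  exact tailTrace_whiskerRight_comp f m _

theorem tr_headTrace {X : C} {m : ℕ} {W : C}
    (h : X ⊗ (tensorPow X m ⊗ W) ⟶ X ⊗ (tensorPow X m ⊗ W)) :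
    tr K X (headTrace K X m W h) = tr K _ h := by
  rw [headTrace, tr_tailTrace, tr_rightTrace]
  refine (tr_comm _ _).trans ?_
  rw [Category.assoc, Iso.inv_hom_id, Category.comp_id]

theorem headTrace_assocConj {X : C} {m : ℕ} {W : C} (σ : Perm (Fin (m + 1))) (w : W ⟶ W) :
    ∃ c : K, headTrace K X m W (assocConj (pm X (m + 1) σ ⊗ₘ w)) = c • 𝟙 X := by
  obtain ⟨c, hc⟩ := tailTrace_pm (K := K) X m σ
  refine ⟨tr K W w * c, ?_⟩
  have h1 : ∀ g : tensorPow X (m + 1) ⊗ W ⟶ tensorPow X (m + 1) ⊗ W,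
      (tailIso X m W).hom ≫ ((tailIso X m W).inv ≫ g ≫
        (tailIso X m W).hom) ≫ (tailIso X m W).inv = g := by
    intro g
    simp
  rw [headTrace, assocConj, h1]
  rw [rightTrace_tensor, map_smul, hc, smul_smul]

variable (K) in
/-- The endomorphisms whose partial trace over all factors but the first is a scalar. -/
def scalarTrace (X : C) (m : ℕ) (W : C) :
    Submodule K (X ⊗ (tensorPow X m ⊗ W) ⟶ X ⊗ (tensorPow X m ⊗ W)) where
  carrier := {h | ∃ c : K, headTrace K X m W h = c • 𝟙 X}
  add_mem' := by
    rintro a b ⟨c, hc⟩ ⟨c', hc'⟩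
    exact ⟨c + c', by rw [headTrace_add, hc, hc', add_smul]⟩
  zero_mem' := ⟨0, by
    have := headTrace_smul (K := K) (X := X) (m := m) (W := W) 0 0
    rwa [zero_smul, zero_smul, ← zero_smul K (𝟙 X)] at this⟩
  smul_mem' := by
    rintro a b ⟨c, hc⟩
    exact ⟨a * c, by rw [headTrace_smul, hc, smul_smul]⟩

/-- It suffices to check the spanning elements `σ ⊗ w`. Multiplied by the Jucys-Murphy sum they
remain sums of such elements in one more variable, whose traces over all factors but the first are
scalars; the commutation is `jm_comm`. -/
theorem whiskerLeft_permSpan {X : C} {m : ℕ} {W : C} {p : tensorPow X m ⊗ W ⟶ tensorPow X m ⊗ W}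
    (hp : p ∈ permSpan K X m W) :
    X ◁ p ∈ scalarTrace K X m W ∧ X ◁ p ≫ assocConj (jm X m ▷ W) ∈ scalarTrace K X m W ∧
      X ◁ p ≫ assocConj (jm X m ▷ W) = assocConj (jm X m ▷ W) ≫ X ◁ p := by
  induction hp using Submodule.span_induction with
  | mem p hp =>
    obtain ⟨⟨σ, w⟩, rfl⟩ := hp
    rw [whiskerLeft_pm_tensor, ← assocConj_comp, ← assocConj_comp]
    refine ⟨headTrace_assocConj _ _, ?_, ?_⟩
    · have h1 : assocConj ((pm X (m + 1) (extPerm σ) ⊗ₘ w) ≫ jm X m ▷ W) =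
          ∑ p : Fin m, assocConj (pm X (m + 1) (swap 0 p.succ * extPerm σ) ⊗ₘ w) := by
        have h2 : (pm X (m + 1) (extPerm σ) ⊗ₘ w) ≫ jm X m ▷ W =
            ∑ p : Fin m, (pm X (m + 1) (swap 0 p.succ * extPerm σ) ⊗ₘ w) := by
          rw [← tensorHom_id, tensorHom_comp_tensorHom, Category.comp_id, jm,
            Preadditive.comp_sum, sum_tensor]
          simp_rw [← pm_mul]
        rw [h2, assocConj, Preadditive.sum_comp, Preadditive.comp_sum]
        rfl
      rw [h1]
      exact Submodule.sum_mem _ fun p _ => headTrace_assocConj _ _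
    · congr 1
      rw [← tensorHom_id, tensorHom_comp_tensorHom, tensorHom_comp_tensorHom, jm_comm,
        Category.id_comp, Category.comp_id]
  | zero =>
    rw [MonoidalPreadditive.whiskerLeft_zero, zero_comp, comp_zero]
    exact ⟨zero_mem _, zero_mem _, rfl⟩
  | add p q _ _ hp hq =>
    rw [MonoidalPreadditive.whiskerLeft_add, Preadditive.add_comp, Preadditive.comp_add,
      hp.2.2, hq.2.2]
    refine ⟨add_mem hp.1 hq.1, add_mem ?_ ?_, rfl⟩
    · rw [← hp.2.2]
      exact hp.2.1
    · rw [← hq.2.2]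
      exact hq.2.1
  | smul c p _ hp =>
    rw [MonoidalLinear.whiskerLeft_smul, Linear.smul_comp, Linear.comp_smul, hp.2.2]
    refine ⟨Submodule.smul_mem _ _ hp.1, Submodule.smul_mem _ _ ?_, rfl⟩
    rw [← hp.2.2]
    exact hp.2.1

theorem sum_tensRep_upMap (X : C) {L W : C} {m : ℕ} (u : L ⟶ tensorPow X m ⊗ W) :
    (∑ p : Fin m, tensRep K (X ⊗ L) X W (m + 1) (swap 0 p.succ) (upMap K X u)) ≫
      (tailIso X m W).hom = X ◁ u ≫ assocConj (jm X m ▷ W) := by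
  have h1 : jm X m ▷ W = ∑ p : Fin m, pm X (m + 1) (swap 0 p.succ) ▷ W := by
    rw [jm, ← tensorHom_id, sum_tensor]
    simp
  have h2 : ∑ p : Fin m, tensRep K (X ⊗ L) X W (m + 1) (swap 0 p.succ) (upMap K X u) =
      upMap K X u ≫ jm X m ▷ W := by
    rw [h1, Preadditive.comp_sum]
    rfl
  rw [h2, assocConj, upMap_apply]
  exact (Category.assoc _ _ _).trans (Category.assoc _ _ _)

/-- The inclusion of an invertible direct summand is an eigenvector of the Jucys-Murphy element. -/
theorem jmEigen_of_invertible {X L T W : C} {m : ℕ} (e : L ⊗ T ≅ 𝟙_ C) (hX : chi K X ≠ 0)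
    {u : L ⟶ tensorPow X m ⊗ W} {r : tensorPow X m ⊗ W ⟶ L} (hur : u ≫ r = 𝟙 L)
    (hp : r ≫ u ∈ permSpan K X m W) {κ' : K} (hκ' : κ' * chi K X = m) :
    JMEigen K X κ' u := by
  obtain ⟨⟨c2, hc2⟩, ⟨c1, hc1⟩, hcomm⟩ := whiskerLeft_permSpan hp
  set J := assocConj (W := W) (jm X m ▷ W) with hJ
  have hL : chi K L ≠ 0 := by
    have h1 := chi_iso (K := K) e
    rw [chi_tensor, chi, chi, chi, tr_id_unit] at h1
    exact left_ne_zero_of_mul_eq_one h1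
  have hL0 : 𝟙 L ≠ 0 := fun h => hL (by rw [chi, h, map_zero])
  have hXX : 𝟙 X ≠ 0 := fun h => hX (by rw [chi, h, map_zero])
  -- The compression of `J` to `X ⊗ L` has the form `f ▷ L` because `L` is invertible.
  obtain ⟨f, hf⟩ := exists_whiskerRight_eq e (X ◁ u ≫ J ≫ X ◁ r)
  have hidem : X ◁ u ≫ X ◁ (r ≫ u) = X ◁ u := by
    rw [← whiskerLeft_comp, ← Category.assoc, hur, Category.id_comp]
  have h1 : X ◁ u ≫ J = X ◁ u ≫ f ▷ (tensorPow X m ⊗ W) := by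
    calc X ◁ u ≫ J = X ◁ u ≫ X ◁ (r ≫ u) ≫ J := by rw [← Category.assoc, hidem]
      _ = (X ◁ u ≫ J ≫ X ◁ r) ≫ X ◁ u := by rw [hcomm, whiskerLeft_comp]; simp
      _ = _ := by rw [hf, ← whisker_exchange]
  have h2 : X ◁ (r ≫ u) ≫ J = f ▷ (tensorPow X m ⊗ W) ≫ X ◁ (r ≫ u) := by
    rw [← whisker_exchange, whiskerLeft_comp, Category.assoc, h1, Category.assoc]
  -- The full trace of `X ◁ (r ≫ u)` is `χ(X) χ(L)`, which is also `c2 χ(X)`; and `χ(L) ≠ 0` as `L`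
  -- is invertible.
  have hc2' : c2 ≠ 0 := by
    have h3 := congrArg (tr K X) hc2
    rw [tr_headTrace, ← id_tensorHom, tr_tensor, map_smul, tr_comm, hur] at h3
    intro h4
    rw [h4, zero_smul] at h3
    exact mul_ne_zero hX hL h3
  -- The trace over all factors but the first, applied to `X ◁ (r ≫ u) ≫ J = f ▷ _ ≫ X ◁ (r ≫ u)`,
  -- gives `c1 • 𝟙 X = c2 • f`.
  have h3 : f = (c2⁻¹ * c1) • 𝟙 X := by
    rw [h2, headTrace_whiskerRight_comp, hc2, Linear.comp_smul, Category.comp_id] at hc1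
    rw [mul_smul, ← hc1, smul_smul, inv_mul_cancel₀ hc2', one_smul]
  set κ := c2⁻¹ * c1 with hκ
  have h4 : X ◁ u ≫ J = κ • X ◁ u := by
    rw [h1, h3, MonoidalLinear.smul_whiskerRight, Linear.comp_smul, id_whiskerRight,
      Category.comp_id]
  -- Closing the first strand instead: each of the `m` transpositions in `J` becomes an identity,
  -- while the scalar `κ` becomes `κ χ(X)`.
  have h5 : κ * chi K X = m := by
    have hJm : ptrace K X _ J = (m : K) • 𝟙 _ := by
      have h6 : ptrace K X _ J = ptrace K X _ (jm X m) ▷ W := ptr_assoc X (Xᘁ) (jm X m)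
      have h7 : ptrace K X _ (jm X m) = (m : K) • 𝟙 _ := by
        have h8 : ∀ q : Fin m, ptrace K X _ (pm X (m + 1) (swap 0 q.succ)) = 𝟙 _ := fun q => by
          have h5 := ptrace_pm (K := K) X m q.succ 1
          rwa [extPerm_one, mul_one, if_neg (Fin.succ_ne_zero q), one_smul, pm_one] at h5
        refine (map_sum (ptrace K X (tensorPow X m)) _ _).trans ?_
        rw [Finset.sum_congr rfl fun q _ => h8 q, Finset.sum_const, Finset.card_univ,
          Fintype.card_fin, Nat.cast_smul_eq_nsmul]
      rw [h6, h7, MonoidalLinear.smul_whiskerRight, id_whiskerRight]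
    have h9 := ptr_whisker X (Xᘁ) u J (𝟙 _)
    have h10 := ptr_whisker X (Xᘁ) u (κ • 𝟙 _) (𝟙 _)
    rw [whiskerLeft_id, Category.comp_id, Category.comp_id] at h9 h10
    rw [h4] at h9
    rw [Linear.comp_smul, Category.comp_id, h9] at h10
    have h11 : ptr X (Xᘁ) (κ • 𝟙 (X ⊗ (tensorPow X m ⊗ W))) = (κ * chi K X) • 𝟙 _ := by
      refine (map_smul (ptrace K X (tensorPow X m ⊗ W)) _ _).trans ?_
      rw [← id_whiskerRight, ptrace_whiskerRight, smul_smul, chi]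
    rw [h11] at h10
    have h12 : u ≫ ((m : K) • 𝟙 _) = u ≫ ((κ * chi K X) • 𝟙 _) := by
      rw [← hJm]
      exact h10
    rw [Linear.comp_smul, Linear.comp_smul, Category.comp_id] at h12
    have h13 : ((m : K) - κ * chi K X) • u = 0 := by rw [sub_smul, h12, sub_self]
    refine (sub_eq_zero.1 ((smul_eq_zero.1 h13).resolve_right fun h => hL0 ?_)).symm
    rw [← hur, h, zero_comp]
  have h6 : κ = κ' := mul_right_cancel₀ hX (h5.trans hκ'.symm)
  rw [JMEigen, ← h6]
  refine (cancel_mono (tailIso X m W).hom).1 ?_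
  refine (sum_tensRep_upMap X u).trans (h4.trans ?_)
  refine Eq.trans ?_ (Linear.smul_comp _ _ _ _ _ _).symm
  refine congrArg (κ • ·) (Eq.symm ?_)
  refine (Category.assoc _ _ _).trans ((congrArg (X ◁ u ≫ ·) ?_).trans (Category.comp_id _))
  exact Iso.inv_hom_id _

end Invertible

/-! ### Permutations of blocks of factors -/

section BlockSwap

open Equiv

variable {C : Type u} [Category.{v} C] [MonoidalCategory C] [SymmetricCategory C]

/-- The commutativity constraint `A ⊗ (B ⊗ Z) ⟶ B ⊗ (A ⊗ Z)`. -/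
def swapLeft (A B Z : C) : A ⊗ (B ⊗ Z) ⟶ B ⊗ (A ⊗ Z) :=
  (α_ A B Z).inv ≫ (β_ A B).hom ▷ Z ≫ (α_ B A Z).hom

theorem swapLeft_naturality {A B Z Z' : C} (f : Z ⟶ Z') :
    A ◁ B ◁ f ≫ swapLeft A B Z' = swapLeft A B Z ≫ B ◁ A ◁ f := by
  simp only [swapLeft, Category.assoc]
  rw [associator_inv_naturality_right_assoc, whisker_exchange_assoc, associator_naturality_right]

theorem swapLeft_tensor_left (X A B Z : C) : swapLeft (X ⊗ A) B Z =
    (α_ X A (B ⊗ Z)).hom ≫ X ◁ swapLeft A B Z ≫ swapLeft X B (A ⊗ Z) ≫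
      B ◁ (α_ X A Z).inv := by
  simp only [swapLeft, BraidedCategory.braiding_tensor_left_hom, comp_whiskerRight,
    whiskerLeft_comp, Category.assoc]
  monoidal

theorem swapLeft_tensor_right (X B Z : C) : swapLeft X (X ⊗ B) Z =
    X ◁ (α_ X B Z).hom ≫ swapTwo X (B ⊗ Z) ≫ X ◁ swapLeft X B Z ≫ (α_ X B (X ⊗ Z)).inv := by
  simp only [swapLeft, swapTwo, BraidedCategory.braiding_tensor_right_hom, comp_whiskerRight,
    whiskerLeft_comp, Category.assoc]
  monoidal

theorem swapLeft_unit_right (X Z : C) :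
    X ◁ (λ_ Z).inv ≫ swapLeft X (𝟙_ C) Z ≫ (λ_ (X ⊗ Z)).hom = 𝟙 _ := by
  have h : (β_ X (𝟙_ C)).hom = (ρ_ X).hom ≫ (λ_ X).inv := by
    rw [← braiding_leftUnitor, Category.assoc, Iso.hom_inv_id, Category.comp_id]
  rw [swapLeft, h]
  monoidal

theorem swapLeft_unit_left (B Z : C) :
    swapLeft (𝟙_ C) B Z = (λ_ (B ⊗ Z)).hom ≫ B ◁ (λ_ Z).inv := by
  have h : (β_ (𝟙_ C) B).hom = (λ_ B).hom ≫ (ρ_ B).inv := by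
    rw [← braiding_rightUnitor, Category.assoc, Iso.hom_inv_id, Category.comp_id]
  rw [swapLeft, h]
  monoidal

/-- The isomorphism `f` of tensor powers of `X` is given by a permutation. -/
def IsPerm (X : C) {a b : ℕ} (f : tensorPow X a ⟶ tensorPow X b) : Prop :=
  ∃ (h : a = b) (σ : Perm (Fin a)), f = pm X a σ ≫ eqToHom (congrArg (tensorPow X) h)

theorem isPerm_pm (X : C) {n : ℕ} (σ : Perm (Fin n)) : IsPerm X (pm X n σ) :=
  ⟨rfl, σ, by simp⟩

theorem isPerm_id (X : C) {n : ℕ} : IsPerm X (𝟙 (tensorPow X n)) := by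
  rw [← pm_one]
  exact isPerm_pm X 1

theorem IsPerm.exists_eq {X : C} {n : ℕ} {f : tensorPow X n ⟶ tensorPow X n} (h : IsPerm X f) :
    ∃ σ, f = pm X n σ := by
  obtain ⟨_, σ, h⟩ := h
  exact ⟨σ, by simpa using h⟩

theorem IsPerm.comp {X : C} {a b c : ℕ} {f : tensorPow X a ⟶ tensorPow X b}
    {g : tensorPow X b ⟶ tensorPow X c} (hf : IsPerm X f) (hg : IsPerm X g) :
    IsPerm X (f ≫ g) := by
  obtain ⟨rfl, σ, rfl⟩ := hf
  obtain ⟨rfl, τ, rfl⟩ := hg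
  refine ⟨rfl, τ * σ, ?_⟩
  rw [pm_mul]
  simp

theorem IsPerm.whiskerLeft {X : C} {a b : ℕ} {f : tensorPow X a ⟶ tensorPow X b}
    (hf : IsPerm X f) (i : ℕ) :
    IsPerm X ((catIso X i a).inv ≫ tensorPow X i ◁ f ≫ (catIso X i b).hom) := by
  obtain ⟨rfl, σ, rfl⟩ := hf
  refine ⟨rfl, extNHom a i σ, ?_⟩
  simp [whiskerLeft_pm_catIso]

theorem IsPerm.succ {X : C} {a b : ℕ} {f : tensorPow X a ⟶ tensorPow X b}
    (hf : IsPerm X f) : IsPerm X (a := a + 1) (b := b + 1) (X ◁ f) := by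
  obtain ⟨rfl, σ, rfl⟩ := hf
  refine ⟨rfl, extPerm σ, ?_⟩
  rw [pm_extPerm]
  have h1 : X ◁ (pm X a σ ≫ 𝟙 _) = X ◁ pm X a σ ≫ 𝟙 _ := by simp
  exact h1

/-- The isomorphism `X^{⊗ i} ⊗ (X^{⊗ i'} ⊗ X^{⊗ j}) ≅ X^{⊗ (j + i' + i)}`. -/
def catTwo (X : C) (i i' j : ℕ) :
    tensorPow X i ⊗ (tensorPow X i' ⊗ tensorPow X j) ≅ tensorPow X (j + i' + i) :=
  whiskerLeftIso (tensorPow X i) (catIso X i' j) ≪≫ catIso X i (j + i')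

/-- One factor is moved past the `i'` others by successive exchanges with its neighbour. The two
sides have propositionally equal numbers of factors, whence the transport in `IsPerm`. -/
theorem isPerm_swapLeft_one (X : C) (i' : ℕ) : ∀ j : ℕ, IsPerm X (a := j + i' + 1)
    (b := j + 1 + i') (X ◁ (catIso X i' j).inv ≫ swapLeft X (tensorPow X i') (tensorPow X j) ≫
      (catIso X i' (j + 1)).hom) := by
  induction i' with
  | zero =>
    intro j
    have h := swapLeft_unit_right X (tensorPow X j)
    exact (congrArg (IsPerm X (a := j + 1) (b := j + 1)) h).mpr (isPerm_id X)
  | succ i' ih =>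
    intro j
    have h1 : X ◁ (X ◁ (catIso X i' j).inv ≫ (α_ X (tensorPow X i') (tensorPow X j)).inv) ≫
        swapLeft X (X ⊗ tensorPow X i') (tensorPow X j) ≫
        ((α_ X (tensorPow X i') (X ⊗ tensorPow X j)).hom ≫ X ◁ (catIso X i' (j + 1)).hom) =
        swapTwo X (tensorPow X (j + i')) ≫ X ◁ (X ◁ (catIso X i' j).inv ≫
          swapLeft X (tensorPow X i') (tensorPow X j) ≫ (catIso X i' (j + 1)).hom) := by
      have h2 := swapTwo_naturality X (catIso X i' j).inv
      rw [swapLeft_tensor_right]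
      simp only [whiskerLeft_comp, Category.assoc, Iso.inv_hom_id_assoc]
      rw [← reassoc_of% h2]
      simp only [← whiskerLeft_comp_assoc, Iso.inv_hom_id, Category.comp_id]
      exact congrArg (fun f => X ◁ X ◁ (catIso X i' j).inv ≫
        swapTwo X (tensorPow X i' ⊗ tensorPow X j) ≫ f) (whiskerLeft_comp X _ _).symm
    have h2 : IsPerm X (a := j + i' + 2) (b := j + i' + 2) (swapTwo X (tensorPow X (j + i'))) := by
      rw [← pm_swap]
      exact isPerm_pm X _
    exact (congrArg (IsPerm X (a := j + i' + 2) (b := j + 1 + (i' + 1))) h1).mpr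
      (h2.comp (ih j).succ)

theorem isPerm_swapLeft (X : C) (i : ℕ) : ∀ i' j : ℕ, IsPerm X ((catTwo X i i' j).inv ≫
    swapLeft (tensorPow X i) (tensorPow X i') (tensorPow X j) ≫ (catTwo X i' i j).hom) := by
  induction i with
  | zero =>
    intro i' j
    have h : ((λ_ (tensorPow X (j + i'))).inv ≫ 𝟙_ C ◁ (catIso X i' j).inv) ≫
        swapLeft (𝟙_ C) (tensorPow X i') (tensorPow X j) ≫
        tensorPow X i' ◁ (λ_ (tensorPow X j)).hom ≫ (catIso X i' j).hom =
        𝟙 (tensorPow X (j + i')) := by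
      rw [swapLeft_unit_left]
      simp only [Category.assoc]
      rw [← whiskerLeft_comp_assoc, Iso.inv_hom_id, whiskerLeft_id, Category.id_comp,
        leftUnitor_naturality_assoc, Iso.inv_hom_id_assoc, Iso.inv_hom_id]
    exact (congrArg (IsPerm X (a := j + i') (b := j + i')) h).mpr (isPerm_id X)
  | succ i ih =>
    intro i' j
    set A := tensorPow X i
    set B := tensorPow X i'
    set Z := tensorPow X j
    have h1 {D : C} (c : B ⊗ (X ⊗ tensorPow X (j + i)) ⟶ D) :
        ((X ◁ (catIso X i (j + i')).inv ≫ (α_ X A (tensorPow X (j + i'))).inv) ≫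
        (X ⊗ A) ◁ (catIso X i' j).inv) ≫ swapLeft (X ⊗ A) B Z ≫
        (B ◁ ((α_ X A Z).hom ≫ X ◁ (catIso X i j).hom) ≫ c) =
        X ◁ ((catTwo X i i' j).inv ≫ swapLeft A B Z ≫ (catTwo X i' i j).hom) ≫
          (X ◁ (catIso X i' (j + i)).inv ≫ swapLeft X B (tensorPow X (j + i)) ≫ c) := by
      have h2 := swapLeft_naturality (A := X) (B := B) (catIso X i j).hom
      have h3 : X ◁ (catTwo X i' i j).hom ≫ X ◁ (catIso X i' (j + i)).inv ≫
          swapLeft X B (tensorPow X (j + i)) = swapLeft X B (A ⊗ Z) ≫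
            B ◁ X ◁ (catIso X i j).hom := by
        rw [← h2, ← whiskerLeft_comp_assoc]
        simp [catTwo, B]
      rw [swapLeft_tensor_left]
      simp only [whiskerLeft_comp, Category.assoc] at h3 ⊢
      rw [reassoc_of% h3]
      simp only [catTwo, Iso.trans_inv, whiskerLeftIso_inv, whiskerLeft_comp, Category.assoc]
      rw [associator_naturality_right_assoc, Iso.inv_hom_id_assoc, ← whiskerLeft_comp_assoc B,
        Iso.inv_hom_id, whiskerLeft_id, Category.id_comp]
    exact (congrArg (IsPerm X (a := j + i' + (i + 1)) (b := j + (i + 1) + i'))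
      (h1 (catIso X i' (j + i + 1)).hom)).mpr
      ((ih i' j).succ.comp (isPerm_swapLeft_one X i' (j + i)))

/-- The isomorphism `(X^{⊗ i})^{⊗ n} ≅ X^{⊗ i n}`. -/
def powPow (X : C) (i : ℕ) : (n : ℕ) → (tensorPow (tensorPow X i) n ≅ tensorPow X (i * n))
  | 0 => Iso.refl _
  | n + 1 => whiskerLeftIso (tensorPow X i) (powPow X i n) ≪≫ catIso X i (i * n)

/-- Through this, the idempotent of an exterior or symmetric power of a power of `X` becomes an
element of the group algebra acting on `X^{⊗ i n}`, as needed for `iso_tensorPow_det`. The case of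
two neighbouring blocks is `isPerm_swapLeft`. -/
theorem isPerm_powPow (X : C) (i : ℕ) {n : ℕ} (σ : Perm (Fin n)) :
    IsPerm X ((powPow X i n).inv ≫ pm (tensorPow X i) n σ ≫ (powPow X i n).hom) := by
  induction n, σ using perm_fin_induction with
  | one n =>
    rw [pm_one, Category.id_comp, Iso.inv_hom_id]
    exact isPerm_id X
  | mul n σ τ h1 h2 =>
    have := h2.comp h1
    rw [pm_mul]
    simpa using this
  | first n =>
    have h1 := isPerm_swapLeft X i i (i * n)
    have h2 : ((catTwo X i i (i * n)).inv ≫ tensorPow X i ◁ tensorPow X i ◁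
        (powPow X i n).inv) ≫ swapTwo (tensorPow X i) (tensorPow (tensorPow X i) n) ≫
          (tensorPow X i ◁ tensorPow X i ◁ (powPow X i n).hom ≫ (catTwo X i i (i * n)).hom) =
        (catTwo X i i (i * n)).inv ≫ swapLeft (tensorPow X i) (tensorPow X i)
          (tensorPow X (i * n)) ≫ (catTwo X i i (i * n)).hom := by
      have h3 := swapTwo_naturality (tensorPow X i) (powPow X i n).hom
      rw [Category.assoc, ← reassoc_of% h3, ← whiskerLeft_comp_assoc, ← whiskerLeft_comp,
        Iso.inv_hom_id]
      simp
      rfl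
    have h4 : (powPow X i (n + 2)).inv = (catTwo X i i (i * n)).inv ≫ tensorPow X i ◁
        tensorPow X i ◁ (powPow X i n).inv :=
      (congrArg (fun f => (catIso X i (i * n + i)).inv ≫ f)
        (whiskerLeft_comp (tensorPow X i) _ _)).trans (Category.assoc _ _ _).symm
    have h5 : (powPow X i (n + 2)).hom = tensorPow X i ◁ tensorPow X i ◁ (powPow X i n).hom ≫
        (catTwo X i i (i * n)).hom :=
      (congrArg (fun f => f ≫ (catIso X i (i * n + i)).hom)
        (whiskerLeft_comp (tensorPow X i) _ _)).trans (Category.assoc _ _ _)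
    rw [h4, h5, pm_swap]
    exact (congrArg (IsPerm X (a := i * n + i + i) (b := i * n + i + i)) h2).mpr h1
  | ext n σ h =>
    have h1 := h.whiskerLeft i
    have h2 : ((catIso X i (i * n)).inv ≫ tensorPow X i ◁ (powPow X i n).inv) ≫
        tensorPow X i ◁ pm (tensorPow X i) n σ ≫ (tensorPow X i ◁ (powPow X i n).hom ≫
        (catIso X i (i * n)).hom) = (catIso X i (i * n)).inv ≫ tensorPow X i ◁
          ((powPow X i n).inv ≫ pm (tensorPow X i) n σ ≫ (powPow X i n).hom) ≫
            (catIso X i (i * n)).hom := by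
      simp
    rw [pm_extPerm]
    exact (congrArg (IsPerm X (a := i * n + i) (b := i * n + i)) h2).mpr h1

end BlockSwap

/-! ### The action of group algebras on tensor powers -/

section GroupAlgebra

open Equiv

variable {K : Type*} [Field K]
variable {C : Type u} [Category.{v} C] [Preadditive C] [Linear K C] [MonoidalCategory C]
  [SymmetricCategory C]

/-- The endomorphism of `X^{⊗ n}` given by an element of the group algebra. -/
def actMap (X : C) {n : ℕ} (y : MonoidAlgebra K (Perm (Fin n))) :
    tensorPow X n ⟶ tensorPow X n :=
  End.asHom (MonoidAlgebra.lift K _ _ (permAction X n) y)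

theorem actMap_of (X : C) {n : ℕ} (σ : Perm (Fin n)) :
    actMap X (MonoidAlgebra.of K _ σ) = pm X n σ := by
  rw [actMap, MonoidAlgebra.lift_of]
  rfl

theorem actMap_add (X : C) {n : ℕ} (y z : MonoidAlgebra K (Perm (Fin n))) :
    actMap X (y + z) = actMap X y + actMap X z := by
  rw [actMap, map_add]
  rfl

theorem actMap_smul (X : C) {n : ℕ} (c : K) (y : MonoidAlgebra K (Perm (Fin n))) :
    actMap X (c • y) = c • actMap X y := by
  rw [actMap, map_smul]
  rfl

theorem actMap_one (X : C) {n : ℕ} : actMap X (1 : MonoidAlgebra K (Perm (Fin n))) = 𝟙 _ := by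
  rw [actMap, map_one]
  rfl

theorem actMap_mul (X : C) {n : ℕ} (y z : MonoidAlgebra K (Perm (Fin n))) :
    actMap X (y * z) = actMap X z ≫ actMap X y := by
  rw [actMap, map_mul]
  rfl

theorem actMap_sum (X : C) {n : ℕ} {ι : Type*} (s : Finset ι)
    (y : ι → MonoidAlgebra K (Perm (Fin n))) :
    actMap X (∑ i ∈ s, y i) = ∑ i ∈ s, actMap X (y i) := by
  classical
  induction s using Finset.induction_on with
  | empty =>
    rw [Finset.sum_empty, Finset.sum_empty, actMap, map_zero]
  | insert i s hi ih => rw [Finset.sum_insert hi, Finset.sum_insert hi, actMap_add, ih]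

theorem actMap_altElt (s : ℤˣ) (X : C) (n : ℕ) : actMap X (altElt K s n) = alt K s X n := by
  rw [altElt, actMap_smul, actMap_sum, alt]
  simp_rw [actMap_smul, actMap_of]

variable [MonoidalPreadditive C] [MonoidalLinear K C]

theorem lift_tensRep_apply {L X W : C} {n : ℕ} (y : MonoidAlgebra K (Perm (Fin n)))
    (u : L ⟶ tensorPow X n ⊗ W) :
    MonoidAlgebra.lift K _ _ (tensRep K L X W n) y u = u ≫ actMap X y ▷ W := by
  induction y using MonoidAlgebra.induction_on with
  | of σ => rw [MonoidAlgebra.lift_of, actMap_of, tensRep_apply]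
  | add x y hx hy =>
    rw [map_add, LinearMap.add_apply, hx, hy, actMap_add, MonoidalPreadditive.add_whiskerRight,
      Preadditive.comp_add]
  | smul c x hx =>
    rw [map_smul, LinearMap.smul_apply, hx, actMap_smul, MonoidalLinear.smul_whiskerRight,
      Linear.comp_smul]

theorem actMap_whiskerRight_catIso (X : C) {i : ℕ} (j : ℕ)
    (y : MonoidAlgebra K (Perm (Fin i))) : actMap X y ▷ tensorPow X j ≫ (catIso X i j).hom =
      (catIso X i j).hom ≫ actMap X (mapAlg K (padHom i j) y) := by
  induction y using MonoidAlgebra.induction_on with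
  | of σ =>
    rw [actMap_of, pm_whiskerRight_catIso, mapAlg, MonoidAlgebra.lift_of, MonoidHom.comp_apply,
      actMap_of]
  | add x y hx hy =>
    rw [actMap_add, MonoidalPreadditive.add_whiskerRight, Preadditive.add_comp, hx, hy, map_add,
      actMap_add, Preadditive.comp_add]
  | smul c x hx =>
    rw [actMap_smul, MonoidalLinear.smul_whiskerRight, Linear.smul_comp, hx, map_smul,
      actMap_smul, Linear.comp_smul]

theorem whiskerLeft_actMap_catIso (X : C) (i : ℕ) {j : ℕ}
    (y : MonoidAlgebra K (Perm (Fin j))) : tensorPow X i ◁ actMap X y ≫ (catIso X i j).hom =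
      (catIso X i j).hom ≫ actMap X (mapAlg K (extNHom j i) y) := by
  induction y using MonoidAlgebra.induction_on with
  | of σ =>
    rw [actMap_of, whiskerLeft_pm_catIso, mapAlg, MonoidAlgebra.lift_of, MonoidHom.comp_apply,
      actMap_of]
  | add x y hx hy =>
    rw [actMap_add, MonoidalPreadditive.whiskerLeft_add, Preadditive.add_comp, hx, hy, map_add,
      actMap_add, Preadditive.comp_add]
  | smul c x hx =>
    rw [actMap_smul, MonoidalLinear.whiskerLeft_smul, Linear.smul_comp, hx, map_smul,
      actMap_smul, Linear.comp_smul]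

/-- Juxtaposition of elements of the group algebras. -/
theorem tensor_actMap_catIso (X : C) {i j : ℕ} (y : MonoidAlgebra K (Perm (Fin i)))
    (z : MonoidAlgebra K (Perm (Fin j))) :
    (catIso X i j).inv ≫ (actMap X y ⊗ₘ actMap X z) ≫ (catIso X i j).hom =
      actMap X (mapAlg K (extNHom j i) z * mapAlg K (padHom i j) y) := by
  rw [MonoidalCategory.tensorHom_def, Category.assoc, whiskerLeft_actMap_catIso,
    ← Category.assoc (actMap X y ▷ _), actMap_whiskerRight_catIso, actMap_mul, Category.assoc,
    Iso.inv_hom_id_assoc]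

/-- Block antisymmetrizers on disjoint blocks correspond under `catIso` to a tensor product of
idempotents, whose image is the tensor product of the images. So `blockAlt` cuts out a power of the
determinant. -/
theorem isIm_blockAlt [CharZero K] {s : ℤˣ} {X Λ : C} {d : ℕ} (h : IsIm (alt K s X d) Λ)
    (k : ℕ) : IsIm (actMap X (blockAlt K s d k)) (tensorPow Λ k) := by
  induction k with
  | zero =>
    rw [blockAlt, actMap_one]
    exact isIm_id _
  | succ k ih =>
    have h1 := (h.tensor ih).conj (catIso X d (d * k))
    rw [← actMap_altElt, tensor_actMap_catIso] at h1
    exact h1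

/-- The action of two symmetric groups on `X^{⊗ m} ⊗ Y^{⊗ n}`. -/
def prodRep (X Y : C) (m n : ℕ) :
    Perm (Fin m) × Perm (Fin n) →* End (tensorPow X m ⊗ tensorPow Y n) where
  toFun x := pm X m x.1 ⊗ₘ pm Y n x.2
  map_one' := by
    show pm X m 1 ⊗ₘ pm Y n 1 = 𝟙 _
    rw [pm_one, pm_one, id_tensorHom_id]
  map_mul' x y := by
    show pm X m (x.1 * y.1) ⊗ₘ pm Y n (x.2 * y.2) =
      (pm X m y.1 ⊗ₘ pm Y n y.2) ≫ (pm X m x.1 ⊗ₘ pm Y n x.2)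
    rw [pm_mul, pm_mul, tensorHom_comp_tensorHom]

theorem tensor_actMap_mem_range (X Y : C) {m n : ℕ} (y : MonoidAlgebra K (Perm (Fin m)))
    (z : MonoidAlgebra K (Perm (Fin n))) : End.of (actMap X y ⊗ₘ actMap Y z) ∈
      (MonoidAlgebra.lift K _ _ (prodRep X Y m n)).range := by
  have h1 : End.of (actMap X y ▷ tensorPow Y n) ∈
      (MonoidAlgebra.lift K _ _ (prodRep X Y m n)).range := by
    induction y using MonoidAlgebra.induction_on with
    | of σ =>
      refine ⟨MonoidAlgebra.of K _ (σ, 1), ?_⟩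
      refine (MonoidAlgebra.lift_of _ _).trans ?_
      rw [actMap_of]
      show pm X m σ ⊗ₘ pm Y n 1 = _
      rw [pm_one, tensorHom_id]
    | add x y hx hy =>
      rw [actMap_add, MonoidalPreadditive.add_whiskerRight]
      exact add_mem hx hy
    | smul c x hx =>
      rw [actMap_smul, MonoidalLinear.smul_whiskerRight]
      exact Subalgebra.smul_mem _ hx c
  have h2 : End.of (tensorPow X m ◁ actMap Y z) ∈
      (MonoidAlgebra.lift K _ _ (prodRep X Y m n)).range := by
    induction z using MonoidAlgebra.induction_on with
    | of σ =>
      refine ⟨MonoidAlgebra.of K _ (1, σ), ?_⟩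
      refine (MonoidAlgebra.lift_of _ _).trans ?_
      rw [actMap_of]
      show pm X m 1 ⊗ₘ pm Y n σ = _
      rw [pm_one, id_tensorHom]
    | add x y hx hy =>
      rw [actMap_add, MonoidalPreadditive.whiskerLeft_add]
      exact add_mem hx hy
    | smul c x hx =>
      rw [actMap_smul, MonoidalLinear.whiskerLeft_smul]
      exact Subalgebra.smul_mem _ hx c
  rw [MonoidalCategory.tensorHom_def]
  exact mul_mem h2 h1

/-- Both symmetric groups are seen as acting on the left factor, the second one after braiding. This
allows `jmEigen_of_invertible` to be applied to `X` and to `Y`. -/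
theorem mem_permSpan_of_mem_range {X Y : C} {m n : ℕ}
    {f : tensorPow X m ⊗ tensorPow Y n ⟶ tensorPow X m ⊗ tensorPow Y n}
    (hf : End.of f ∈ (MonoidAlgebra.lift K _ _ (prodRep X Y m n)).range) :
    f ∈ permSpan K X m (tensorPow Y n) ∧
      (β_ (tensorPow X m) (tensorPow Y n)).inv ≫ f ≫ (β_ (tensorPow X m) (tensorPow Y n)).hom ∈
        permSpan K Y n (tensorPow X m) := by
  obtain ⟨y, rfl : MonoidAlgebra.lift K _ _ (prodRep X Y m n) y = f⟩ := hf
  induction y using MonoidAlgebra.induction_on with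
  | of x =>
    rw [MonoidAlgebra.lift_of]
    refine ⟨Submodule.subset_span ⟨(x.1, pm Y n x.2), rfl⟩, ?_⟩
    refine Submodule.subset_span ⟨(x.2, pm X m x.1), ?_⟩
    show _ = _ ≫ (pm X m x.1 ⊗ₘ pm Y n x.2) ≫ _
    rw [BraidedCategory.braiding_naturality, Iso.inv_hom_id_assoc]
  | add x y hx hy =>
    rw [map_add]
    refine ⟨add_mem hx.1 hy.1, ?_⟩
    have := add_mem hx.2 hy.2
    rw [← Preadditive.comp_add, ← Preadditive.add_comp] at this
    exact this
  | smul c x hx =>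
    rw [map_smul]
    refine ⟨Submodule.smul_mem _ c hx.1, ?_⟩
    have := Submodule.smul_mem _ c hx.2
    rw [← Linear.comp_smul, ← Linear.smul_comp] at this
    exact this

theorem JMEigen.comp_whiskerLeft {X L W W' : C} {m : ℕ} {κ : K} {u : L ⟶ tensorPow X m ⊗ W}
    (h : JMEigen K X κ u) (w : W ⟶ W') : JMEigen K X κ (u ≫ tensorPow X m ◁ w) := by
  have h1 : upMap K X (u ≫ tensorPow X m ◁ w) = upMap K X u ≫ tensorPow X (m + 1) ◁ w := by
    rw [upMap_apply, upMap_apply, whiskerLeft_comp, Category.assoc]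
    refine (congrArg (_ ≫ ·) (associator_inv_naturality_right _ _ _)).trans ?_
    exact (Category.assoc _ _ _).symm
  rw [JMEigen] at h ⊢
  simp_rw [tensRep_apply, h1, Category.assoc, whisker_exchange, ← Category.assoc]
  rw [← Preadditive.sum_comp, ← Linear.smul_comp, ← h]
  rfl

end GroupAlgebra

/-! ### Determinants of signed objects, their tensor products and powers -/

section Determinants

open Equiv

variable {K : Type*} [Field K] [CharZero K]
variable {C : Type u} [Category.{v} C] [Preadditive C] [Linear K C] [MonoidalCategory C]
  [SymmetricCategory C] [MonoidalPreadditive C] [MonoidalLinear K C] [RigidCategory C]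
  [hK : Fact (Function.Bijective (algebraMap K (End (𝟙_ C))))]

theorem id_ne_zero_of_invertible (K : Type*) [Field K] [Linear K C] [MonoidalLinear K C]
    [hK : Fact (Function.Bijective (algebraMap K (End (𝟙_ C))))] {L T : C} (e : L ⊗ T ≅ 𝟙_ C) :
    𝟙 L ≠ 0 := by
  intro h
  refine id_unit_ne_zero K (C := C) ?_
  rw [← e.inv_hom_id, ← Category.id_comp e.hom, ← id_whiskerRight, h,
    MonoidalPreadditive.zero_whiskerRight, zero_comp, comp_zero]

theorem Signed.isScalar {s : ℤˣ} {L : C} (h : Signed K s 1 L) : IsScalar K L := by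
  obtain ⟨e⟩ := h.tensor_dual
  exact isScalar_of_invertible e

theorem Signed.chi_ne_zero {s : ℤˣ} {d : ℕ} {X : C} (h : Signed K s d X) (hd : 0 < d) :
    chi K X ≠ 0 := by
  rw [h.2]
  exact mul_ne_zero (by exact_mod_cast s.ne_zero) (Nat.cast_ne_zero.2 hd.ne')

/-- The determinant of a positive or negative object has dimension one. -/
theorem Signed.det {s : ℤˣ} {d : ℕ} {X Λ : C} (h : Signed K s d X) (hΛ : IsIm (alt K s X d) Λ) :
    Signed K (s ^ d) 1 Λ := by
  obtain ⟨e, he⟩ := (h.tensorPow d).exists_of_isIm hΛ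
  have h1 := tr_alt (K := K) s X d (x := s * d) (by rw [h.2]; push_cast; rfl)
  have h2 : ((s : ℤ) * (s * d) : ℤ) = d := by
    rw [← mul_assoc, ← Units.val_mul, Int.units_mul_self, Units.val_one, one_mul]
  rw [tr_of_isIm hΛ, he.2, h2, Ring.choose_natCast, Nat.choose_self] at h1
  -- The trace of `alt K s X d` is `s ^ d * choose d d`, while the Euler characteristic of its image
  -- is `s ^ d * e`.
  have h3 : (e : K) = 1 := by
    have h4 : (((s ^ d : ℤˣ) : ℤ) : K) ≠ 0 := by exact_mod_cast (s ^ d).ne_zero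
    refine mul_left_cancel₀ h4 (h1.trans ?_)
    push_cast
    rfl
  rw [show (1 : ℕ) = e by exact_mod_cast h3.symm]
  exact he

theorem Signed.tensorPow_det {s : ℤˣ} {d : ℕ} {X Λ : C} (h : Signed K s d X)
    (hΛ : IsIm (alt K s X d) Λ) (k : ℕ) : Signed K ((s ^ d) ^ k) 1 (TensorDet.tensorPow Λ k) := by
  have := (h.det hΛ).tensorPow k
  rwa [one_pow] at this

/-- The inclusion of `L` is a Jucys-Murphy eigenvector with eigenvalue `s k`, so some `blockAlt * y`
does not kill it. This gives a nonzero group algebra element linking `L` with the image of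
`blockAlt`, which is `Λ^{⊗ k}`, and `IsIm.iso_of_regular` applies. -/
theorem iso_tensorPow_det {s : ℤˣ} {d k m : ℕ} {X Λ L T : C} (hX : Signed K s d X) (hd : 0 < d)
    (hΛ : IsIm (alt K s X d) Λ) (hm : m = d * k) (z : MonoidAlgebra K (Perm (Fin m)))
    (hL : IsIm (actMap X z) L) (e : L ⊗ T ≅ 𝟙_ C) : Nonempty (L ≅ tensorPow Λ k) := by
  subst hm
  obtain ⟨i, r, hi, hp⟩ := id hL
  have hir : (i ≫ (ρ_ _).inv) ≫ (ρ_ _).hom ≫ r = 𝟙 L := by simp [hi]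
  have hJ : JMEigen K X (((s : ℤ) : K) * k) (i ≫ (ρ_ (tensorPow X (d * k))).inv) := by
    refine jmEigen_of_invertible e (hX.chi_ne_zero hd) hir ?_ ?_
    · have h1 : ((ρ_ _).hom ≫ r) ≫ i ≫ (ρ_ _).inv = actMap X z ▷ 𝟙_ C := by
        rw [Category.assoc, reassoc_of% hp]
        simp
      rw [h1]
      clear h1 hp hL
      induction z using MonoidAlgebra.induction_on with
      | of σ =>
        rw [actMap_of]
        exact Submodule.subset_span ⟨(σ, 𝟙 _), tensorHom_id _ _⟩
      | add x y hx hy =>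
        rw [actMap_add, MonoidalPreadditive.add_whiskerRight]
        exact add_mem hx hy
      | smul c x hx =>
        rw [actMap_smul, MonoidalLinear.smul_whiskerRight]
        exact Submodule.smul_mem _ c hx
    · rw [hX.2]
      push_cast
      linear_combination (k * d : K) * units_mul_self_cast (K := K) s
  have h0 : i ≫ (ρ_ (tensorPow X (d * k))).inv ≠ 0 := by
    intro h
    refine id_ne_zero_of_invertible K e ?_
    rw [← hir, h, zero_comp]
  obtain ⟨y, hy⟩ := exists_lift_blockAlt hd hX h0 hJ
  have hx : actMap X (blockAlt K s d k * y * z) ≠ 0 := by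
    intro h
    apply hy
    rw [lift_tensRep_apply, Category.assoc]
    have h1 : i ≫ actMap X (blockAlt K s d k * y) = 0 := by
      have h2 : i = i ≫ actMap X z := by rw [← hp, reassoc_of% hi]
      rw [h2, Category.assoc, ← actMap_mul, h, comp_zero]
    rw [← rightUnitor_inv_naturality, reassoc_of% h1, zero_comp]
  obtain ⟨y', hy'⟩ := exists_comp_comp_eq_self (permAction X (d * k))
    (x := actMap X (blockAlt K s d k * y * z)) ⟨_, rfl⟩
  have hB := isIm_blockAlt hΛ k
  refine hL.iso_of_regular hB (isScalar_of_invertible e) (hX.tensorPow_det hΛ k).isScalar hx ?_ ?_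
    hy'
  · rw [actMap_mul, ← Category.assoc, hL.idem]
  · rw [mul_assoc, actMap_mul, Category.assoc, hB.idem]

/-- The argument of `iso_tensorPow_det` is run for the factors `X`, and then for the factors `Y`
after braiding. The first step only composes with a map on the other factor, which preserves the
second eigenvector property (`JMEigen.comp_whiskerLeft`). -/
theorem iso_tensorPow_det_tensor {s t : ℤˣ} {d k m d' k' n : ℕ} {X Y Λ Λ' L T : C}
    (hX : Signed K s d X) (hY : Signed K t d' Y) (hd : 0 < d) (hd' : 0 < d')
    (hΛ : IsIm (alt K s X d) Λ) (hΛ' : IsIm (alt K t Y d') Λ') (hm : m = d * k)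
    (hn : n = d' * k') {p : tensorPow X m ⊗ tensorPow Y n ⟶ tensorPow X m ⊗ tensorPow Y n}
    (hp : End.of p ∈ (MonoidAlgebra.lift K _ _ (prodRep X Y m n)).range)
    (hL : IsIm p L) (e : L ⊗ T ≅ 𝟙_ C) : Nonempty (L ≅ tensorPow Λ k ⊗ tensorPow Λ' k') := by
  subst hm hn
  obtain ⟨i, r, hi, hir⟩ := id hL
  obtain ⟨hp1, hp2⟩ := mem_permSpan_of_mem_range hp
  have h0 : i ≠ 0 := by
    rintro rfl
    refine id_ne_zero_of_invertible K e ?_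
    rw [← hi, zero_comp]
  have hJ : JMEigen K X (((s : ℤ) : K) * k) i := by
    refine jmEigen_of_invertible e (hX.chi_ne_zero hd) hi (by rwa [hir]) ?_
    rw [hX.2]
    push_cast
    linear_combination (k * d : K) * units_mul_self_cast (K := K) s
  have hJ' : JMEigen K Y (((t : ℤ) : K) * k') (i ≫ (β_ _ _).hom) := by
    refine jmEigen_of_invertible e (hY.chi_ne_zero hd') (r := (β_ _ _).inv ≫ r) ?_ ?_ ?_
    · rw [Category.assoc, Iso.hom_inv_id_assoc, hi]
    · rw [Category.assoc, reassoc_of% hir]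
      exact hp2
    · rw [hY.2]
      push_cast
      linear_combination (k' * d' : K) * units_mul_self_cast (K := K) t
  obtain ⟨y, hy⟩ := exists_lift_blockAlt hd hX h0 hJ
  rw [lift_tensRep_apply] at hy
  have hy0 : (i ≫ (β_ _ _).hom) ≫ tensorPow Y (d' * k') ◁ actMap X (blockAlt K s d k * y) ≠ 0 := by
    intro h
    apply hy
    rw [Category.assoc, ← BraidedCategory.braiding_naturality_left] at h
    have h1 := congrArg (· ≫ (β_ _ _).inv) h
    simpa using h1
  obtain ⟨y', hy'⟩ := exists_lift_blockAlt hd' hY hy0 (hJ'.comp_whiskerLeft _)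
  rw [lift_tensRep_apply, Category.assoc, Category.assoc, ← MonoidalCategory.tensorHom_def',
    ← BraidedCategory.braiding_naturality] at hy'
  set x := p ≫ (actMap X (blockAlt K s d k * y) ⊗ₘ actMap Y (blockAlt K t d' k' * y')) with hxdef
  have hx : x ≠ 0 := by
    intro h
    apply hy'
    have h2 : i = i ≫ p := by rw [← hir, reassoc_of% hi]
    rw [h2, Category.assoc, ← Category.assoc p, ← hxdef, h, zero_comp, comp_zero]
  obtain ⟨z, hz⟩ := exists_comp_comp_eq_self (K := K) (prodRep X Y (d * k) (d' * k')) (x := x)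
    (mul_mem (tensor_actMap_mem_range X Y _ _) hp)
  have hB := (isIm_blockAlt hΛ k).tensor (isIm_blockAlt hΛ' k')
  have hS := (hX.tensorPow_det hΛ k).tensor (hY.tensorPow_det hΛ' k')
  refine IsIm.iso_of_regular (K := K) hL hB (isScalar_of_invertible e) ?_ hx ?_ ?_ hz
  · rw [one_mul] at hS
    exact hS.isScalar
  · rw [hxdef, ← Category.assoc, hL.idem]
  · rw [hxdef, Category.assoc, actMap_mul, actMap_mul, ← tensorHom_comp_tensorHom, Category.assoc,
      hB.idem]

theorem Signed.isIm_zero {s : ℤˣ} {X Λ : C} (hΛ : IsIm (alt K s X 0) Λ) :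
    Nonempty (Λ ≅ 𝟙_ C) := by
  rw [alt_zero] at hΛ
  exact hΛ.iso (isIm_id (𝟙_ C))

/-- The determinant of a tensor product of positive or negative objects. -/
theorem Signed.det_tensor {s t : ℤˣ} {a b : ℕ} {X Y Λ Λ' L : C} (hX : Signed K s a X)
    (hY : Signed K t b Y) (hΛ : IsIm (alt K s X a) Λ) (hΛ' : IsIm (alt K t Y b) Λ')
    (hL : IsIm (alt K (s * t) (X ⊗ Y) (a * b)) L) :
    Nonempty (L ≅ TensorDet.tensorPow Λ b ⊗ TensorDet.tensorPow Λ' a) := by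
  obtain ⟨e⟩ := ((hX.tensor hY).det hL).tensor_dual
  have pow_unit : ∀ {Λ : C} (f : Λ ≅ 𝟙_ C) (n : ℕ), Nonempty (TensorDet.tensorPow Λ n ≅ 𝟙_ C) := by
    intro Λ f n
    induction n with
    | zero => exact ⟨Iso.refl _⟩
    | succ n ih => exact ⟨(f ⊗ᵢ ih.some) ≪≫ λ_ _⟩
  -- Dimension zero is separate because `iso_tensorPow_det_tensor` needs positive dimensions. Here
  -- all the objects involved are isomorphic to the unit object.
  by_cases ha : a = 0
  · subst ha
    rw [zero_mul] at hL
    obtain ⟨f⟩ := Signed.isIm_zero hL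
    obtain ⟨g⟩ := Signed.isIm_zero hΛ
    exact ⟨f ≪≫ (((pow_unit g b).some ⊗ᵢ Iso.refl (𝟙_ C)) ≪≫ λ_ (𝟙_ C)).symm⟩
  by_cases hb : b = 0
  · subst hb
    rw [mul_zero] at hL
    obtain ⟨f⟩ := Signed.isIm_zero hL
    obtain ⟨g⟩ := Signed.isIm_zero hΛ'
    exact ⟨f ≪≫ ((Iso.refl (𝟙_ C) ⊗ᵢ (pow_unit g a).some) ≪≫ λ_ (𝟙_ C)).symm⟩
  have h1 := hL.conj (mulPow X Y (a * b)).symm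
  have h2 : (mulPow X Y (a * b)).symm.inv ≫ alt K (s * t) (X ⊗ Y) (a * b) ≫
      (mulPow X Y (a * b)).symm.hom =
        ((a * b).factorial : K)⁻¹ • diagSum K (-(s * t)) X Y (a * b) := by
    rw [Iso.symm_inv, Iso.symm_hom, ← Category.assoc, mulPow_alt, Category.assoc,
      Iso.hom_inv_id, Category.comp_id]
  rw [h2] at h1
  refine iso_tensorPow_det_tensor hX hY (Nat.pos_of_ne_zero ha) (Nat.pos_of_ne_zero hb) hΛ hΛ'
    rfl (mul_comm a b) ?_ h1 e
  refine Subalgebra.smul_mem _ (sum_mem fun σ _ => Subalgebra.smul_mem _ ?_ _) _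
  exact ⟨MonoidAlgebra.of K _ (σ, σ), MonoidAlgebra.lift_of _ _⟩

theorem exists_actMap_powMap (X : C) {i : ℕ} {p : tensorPow X i ⟶ tensorPow X i}
    {y : MonoidAlgebra K (Perm (Fin i))} (hp : p = actMap X y) (n : ℕ) :
    ∃ z : MonoidAlgebra K (Perm (Fin (i * n))),
      (powPow X i n).inv ≫ powMap p n ≫ (powPow X i n).hom = actMap X z := by
  induction n with
  | zero =>
    refine ⟨1, ?_⟩
    rw [actMap_one]
    show 𝟙 _ ≫ 𝟙 _ ≫ 𝟙 _ = _
    simp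
  | succ n ih =>
    obtain ⟨z, hz⟩ := ih
    have h1 := tensor_actMap_catIso X y z
    rw [← hz, ← hp] at h1
    refine ⟨_, Eq.trans ?_ h1⟩
    have h2 : (p ⊗ₘ (powPow X i n).inv ≫ powMap p n ≫ (powPow X i n).hom) =
        tensorPow X i ◁ (powPow X i n).inv ≫ (p ⊗ₘ powMap p n) ≫
          tensorPow X i ◁ (powPow X i n).hom := by
      simp [MonoidalCategory.tensorHom_def, whisker_exchange_assoc]
    rw [h2]
    have h3 : ((catIso X i (i * n)).inv ≫ tensorPow X i ◁ (powPow X i n).inv) ≫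
        (p ⊗ₘ powMap p n) ≫ tensorPow X i ◁ (powPow X i n).hom ≫ (catIso X i (i * n)).hom =
        (catIso X i (i * n)).inv ≫ (tensorPow X i ◁ (powPow X i n).inv ≫ (p ⊗ₘ powMap p n) ≫
          tensorPow X i ◁ (powPow X i n).hom) ≫ (catIso X i (i * n)).hom := by
      simp only [Category.assoc]
    exact h3

theorem exists_actMap_alt_powPow (X : C) (s : ℤˣ) (i n : ℕ) :
    ∃ z : MonoidAlgebra K (Perm (Fin (i * n))),
      (powPow X i n).inv ≫ alt K s (tensorPow X i) n ≫ (powPow X i n).hom = actMap X z := by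
  choose τ hτ using fun σ : Perm (Fin n) => (isPerm_powPow X i σ).exists_eq
  refine ⟨(n.factorial : K)⁻¹ • ∑ σ : Perm (Fin n), (((tw (-s) σ : ℤˣ) : ℤ) : K) •
    MonoidAlgebra.of K _ (τ σ), ?_⟩
  rw [actMap_smul, actMap_sum, alt]
  simp only [Linear.smul_comp, Linear.comp_smul, Preadditive.sum_comp, Preadditive.comp_sum, hτ,
    actMap_smul, actMap_of]

/-- The determinant of an exterior or symmetric power of a positive or negative object. -/
theorem Signed.det_alt {s t : ℤˣ} {d i D k : ℕ} {X Λ F L : C} (hX : Signed K s d X)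
    (hΛ : IsIm (alt K s X d) Λ) (hF : IsIm (alt K t X i) F) (hF' : Signed K (s ^ i) D F)
    (hL : IsIm (alt K (s ^ i) F D) L) (hd : 0 < d) (hk : d * k = i * D) :
    Nonempty (L ≅ TensorDet.tensorPow Λ k) := by
  obtain ⟨e⟩ := (hF'.det hL).tensor_dual
  obtain ⟨j, r, hj, hjr⟩ := id hF
  have h1 : powMap j D ≫ powMap r D = 𝟙 _ := by rw [← powMap_comp, hj, powMap_id]
  -- `L` is a summand of `F^{⊗ D}`, hence of `X^{⊗ i D}`. The corresponding idempotent is the action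
  -- of `z * y`, built from the block permutations and the `D`-th power of `alt K t X i`.
  have h2 := (hL.trans h1).conj (powPow X i D)
  obtain ⟨y, hy⟩ := exists_actMap_powMap X (actMap_altElt (K := K) t X i).symm D
  obtain ⟨z, hz⟩ := exists_actMap_alt_powPow (K := K) X (s ^ i) i D
  have h3 : (powPow X i D).inv ≫ (powMap r D ≫ alt K (s ^ i) F D ≫ powMap j D) ≫
      (powPow X i D).hom = actMap X (z * y) := by
    rw [actMap_mul, ← hy, ← hz, ← hjr, alt_powMap, powMap_comp]
    simp
  rw [h3] at h2
  exact iso_tensorPow_det hX hd hΛ hk.symm _ h2 e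

end Determinants

/-! ### Idempotents linked by scalars -/

section Scalar

/-- The maps `p ≫ q` and `c⁻¹ • (q ≫ p)` are inverse to each other on the images. This only needs
`c' = c` or `q = 0`. -/
theorem IsIm.iso_of_scalar {K C : Type*} [Category C] [Preadditive C] [Field K] [Linear K C]
    {X Y Y' : C} {p q : X ⟶ X} (h : IsIm p Y) (h' : IsIm q Y') {c c' : K} (hc : c ≠ 0)
    (hc' : c' ≠ 0) (h1 : p ≫ q ≫ p = c • p) (h2 : q ≫ p ≫ q = c' • q) : Nonempty (Y ≅ Y') := by
  have hp := h.idem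
  have hq := h'.idem
  -- Computing `p ≫ q ≫ p ≫ q ≫ p` in two ways gives `c' c p = c² p`. If `p = 0`, then `q = 0` as
  -- well.
  have h3 : (c⁻¹ * c') • q = q := by
    have e1 : c' • c • p = c • c • p := by
      calc c' • c • p = p ≫ (c' • q) ≫ p := by rw [← h1]; simp
        _ = (p ≫ q ≫ p) ≫ q ≫ p := by rw [← h2]; simp
        _ = c • c • p := by rw [h1, Linear.smul_comp, h1]
    by_cases hp0 : p = 0
    · have : c' • q = 0 := by rw [← h2, hp0]; simp
      rw [(smul_eq_zero.1 this).resolve_left hc', smul_zero]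
    · rw [smul_smul, smul_smul] at e1
      have e2 : (c' * c - c * c) • p = 0 := by rw [sub_smul, e1, sub_self]
      have e3 := (smul_eq_zero.1 e2).resolve_right hp0
      have e4 : c' = c := mul_right_cancel₀ hc (sub_eq_zero.1 e3)
      rw [e4, inv_mul_cancel₀ hc, one_smul]
  refine h.iso_of_equiv h' (p ≫ q) (c⁻¹ • (q ≫ p)) ?_ ?_
  · simp only [Category.assoc, Linear.smul_comp, Linear.comp_smul, reassoc_of% hp,
      reassoc_of% hq, hp]
    rw [h1, smul_smul, inv_mul_cancel₀ hc, one_smul]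
  · simp only [Category.assoc, Linear.smul_comp, Linear.comp_smul, reassoc_of% hp,
      reassoc_of% hq, hq]
    rw [h2, smul_smul, h3]

end Scalar

/-! ### Words in two complementary idempotents -/

section Words

open Equiv

variable {C : Type u} [Category.{v} C] [Preadditive C] [MonoidalCategory C]
  [SymmetricCategory C] [MonoidalPreadditive C]

/-- A pair of complementary idempotents. -/
structure Splitting {Z : C} (E : Bool → (Z ⟶ Z)) : Prop where
  comp : ∀ b b', E b ≫ E b' = if b = b' then E b else 0
  add : E true + E false = 𝟙 Z

/-- The tensor product of the idempotents given by a word. -/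
def word {Z : C} (E : Bool → (Z ⟶ Z)) {n : ℕ} (g : Fin n → Bool) :
    tensorPow Z n ⟶ tensorPow Z n := tens n fun i => E (g i)

/-- The sum of all words with `j` letters `true`. -/
def wordSum {Z : C} (E : Bool → (Z ⟶ Z)) (n j : ℕ) : tensorPow Z n ⟶ tensorPow Z n :=
  ∑ g : Fin n → Bool with (Finset.univ.filter fun x => g x = true).card = j, word E g

theorem Splitting.word_comp {Z : C} {E : Bool → (Z ⟶ Z)} (hE : Splitting E) {n : ℕ}
    (g h : Fin n → Bool) : word E g ≫ word E h = if g = h then word E g else 0 := by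
  rw [word, word, tens_comp]
  split_ifs with hgh
  · subst hgh
    simp_rw [hE.comp, if_true]
  · obtain ⟨i, hi⟩ := Function.ne_iff.1 hgh
    exact tens_zero n _ i (by rw [hE.comp, if_neg hi])

theorem Splitting.sum_word {Z : C} {E : Bool → (Z ⟶ Z)} (hE : Splitting E) (n : ℕ) :
    ∑ g : Fin n → Bool, word E g = 𝟙 _ := by
  induction n with
  | zero =>
    rw [Fintype.sum_unique]
    rfl
  | succ n ih =>
    rw [← (Fin.consEquiv fun _ => Bool).sum_comp, Fintype.sum_prod_type, Fintype.sum_bool,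
      ← Finset.sum_add_distrib]
    have h1 (g : Fin n → Bool) : word E (Fin.consEquiv (fun _ => Bool) (true, g)) +
        word E (Fin.consEquiv (fun _ => Bool) (false, g)) = Z ◁ word E g := by
      refine (MonoidalPreadditive.add_tensor _ _ _).symm.trans ?_
      have h2 : E (Fin.consEquiv (fun _ => Bool) (true, g) 0) +
        E (Fin.consEquiv (fun _ => Bool) (false, g) 0) = 𝟙 Z := hE.add
      rw [h2]
      exact id_tensorHom _ _
    simp_rw [h1]
    have h3 : ∑ g, Z ◁ word E g = 𝟙 (Z ⊗ tensorPow Z n) := by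
      rw [← whiskerLeft_sum, ih, whiskerLeft_id]
    exact h3

theorem word_pm {Z : C} (E : Bool → (Z ⟶ Z)) {n : ℕ} (g : Fin n → Bool) (σ : Perm (Fin n)) :
    word E (g ∘ σ) ≫ pm Z n σ = pm Z n σ ≫ word E g := by
  rw [word, tens_pm, word]
  simp

theorem card_comp_perm {n : ℕ} (g : Fin n → Bool) (σ : Perm (Fin n)) :
    (Finset.univ.filter fun x => (g ∘ σ) x = true).card =
      (Finset.univ.filter fun x => g x = true).card :=
  Finset.card_equiv σ (by simp)

theorem exists_perm_of_card {n : ℕ} (g h : Fin n → Bool)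
    (hgh : (Finset.univ.filter fun x => g x = true).card =
      (Finset.univ.filter fun x => h x = true).card) : ∃ σ : Perm (Fin n), g = h ∘ σ := by
  have e : {x // g x = true} ≃ {x // h x = true} := Fintype.equivOfCardEq (by
    rw [Fintype.card_subtype, Fintype.card_subtype, hgh])
  refine ⟨e.extendSubtype, funext fun x => ?_⟩
  by_cases hx : g x = true
  · rw [hx]
    exact (e.extendSubtype_mem x hx).symm
  · have := e.extendSubtype_not_mem x hx
    rw [Function.comp_apply]
    grind

theorem wordSum_pm {Z : C} (E : Bool → (Z ⟶ Z)) {n j : ℕ} (σ : Perm (Fin n)) :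
    wordSum E n j ≫ pm Z n σ = pm Z n σ ≫ wordSum E n j := by
  rw [wordSum, Preadditive.sum_comp, Preadditive.comp_sum]
  refine Finset.sum_equiv (Equiv.arrowCongr σ (Equiv.refl Bool)) (fun g => ?_) fun g _ => ?_
  · have := card_comp_perm g σ⁻¹
    simp only [Finset.mem_filter, Finset.mem_univ, true_and]
    exact ⟨fun h => this.trans h, fun h => this.symm.trans h⟩
  · rw [← word_pm]
    congr 2
    funext x
    simp

theorem Splitting.wordSum_comp {Z : C} {E : Bool → (Z ⟶ Z)} (hE : Splitting E) (n i j : ℕ) :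
    wordSum E n i ≫ wordSum E n j = if i = j then wordSum E n i else 0 := by
  rw [wordSum, wordSum, Preadditive.sum_comp]
  simp_rw [Preadditive.comp_sum, hE.word_comp, Finset.sum_ite_eq, Finset.mem_filter,
    Finset.mem_univ, true_and]
  split_ifs with h
  · subst h
    exact Finset.sum_congr rfl fun g hg => if_pos (Finset.mem_filter.1 hg).2
  · refine Finset.sum_eq_zero fun g hg => if_neg fun hg' => h ?_
    rw [← (Finset.mem_filter.1 hg).2, hg']

theorem Splitting.sum_wordSum {Z : C} {E : Bool → (Z ⟶ Z)} (hE : Splitting E) (n : ℕ) :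
    ∑ j ∈ Finset.range (n + 1), wordSum E n j = 𝟙 _ := by
  rw [← hE.sum_word n]
  refine Finset.sum_fiberwise_of_maps_to (fun g _ => ?_) _
  rw [Finset.mem_range, Nat.lt_succ_iff]
  exact (Finset.card_le_univ _).trans (by simp)

theorem Splitting.word_wordSum {Z : C} {E : Bool → (Z ⟶ Z)} (hE : Splitting E) {n : ℕ}
    (g : Fin n → Bool) :
    word E g ≫ wordSum E n (Finset.univ.filter fun x => g x = true).card = word E g ∧
    wordSum E n (Finset.univ.filter fun x => g x = true).card ≫ word E g = word E g := by
  rw [wordSum, Preadditive.comp_sum, Preadditive.sum_comp]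
  simp_rw [hE.word_comp, Finset.sum_ite_eq, Finset.sum_ite_eq']
  simp

theorem tens_catIso {Z : C} (i j : ℕ) (g : Fin (j + i) → (Z ⟶ Z)) :
    tens (j + i) g = (catIso Z i j).inv ≫ (tens i (fun x => g (firstEmb i j x)) ⊗ₘ
      tens j (fun x => g (x.addNat i))) ≫ (catIso Z i j).hom := by
  induction i with
  | zero =>
    have h1 (f : tensorPow Z j ⟶ tensorPow Z j) :
        (λ_ (tensorPow Z j)).inv ≫ (𝟙 (𝟙_ C) ⊗ₘ f) ≫ (λ_ (tensorPow Z j)).hom = f := by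
      rw [id_tensorHom, leftUnitor_naturality, Iso.inv_hom_id_assoc]
    exact (h1 _).symm
  | succ i ih =>
    have h1 (f : Z ⟶ Z) (g : tensorPow Z i ⟶ tensorPow Z i) (h : tensorPow Z j ⟶ tensorPow Z j) :
        (Z ◁ (catIso Z i j).inv ≫ (α_ _ _ _).inv) ≫ ((f ⊗ₘ g) ⊗ₘ h) ≫
          (α_ _ _ _).hom ≫ Z ◁ (catIso Z i j).hom =
        f ⊗ₘ ((catIso Z i j).inv ≫ (g ⊗ₘ h) ≫ (catIso Z i j).hom) := by
      rw [associator_naturality_assoc, Category.assoc, Iso.inv_hom_id_assoc]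
      simp only [← id_tensorHom, tensorHom_comp_tensorHom, Category.id_comp, Category.comp_id]
    refine Eq.trans ?_ (h1 _ _ _).symm
    exact congrArg (g 0 ⊗ₘ ·) (ih (Fin.tail g))

end Words

/-! ### Permutations preserving two blocks -/

section Blocks

open Equiv

theorem tw_ofSubtype {α : Type*} [Fintype α] [DecidableEq α] (s : ℤˣ) (S : Finset α)
    (σ : Perm S) : tw s (Perm.ofSubtype σ) = tw s σ := by
  rcases Int.units_eq_one_or s with rfl | rfl
  · simp [tw_one]
  · simp only [tw_neg_one, Perm.sign_ofSubtype]

theorem tw_padHom (s : ℤˣ) {i : ℕ} (j : ℕ) (σ : Perm (Fin i)) :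
    tw s (padHom i j σ) = tw s σ := by
  induction i, σ using perm_fin_induction with
  | one n => rw [map_one, map_one, map_one]
  | mul n σ τ h1 h2 => rw [map_mul, map_mul, map_mul, h1, h2]
  | first n =>
    have h0 : padHom (n + 2) j (swap 0 1) = swap 0 1 := padHom_swap 0 1
    have h1 : (0 : Fin (j + n + 2)) ≠ 1 := by simp
    have h2 : (0 : Fin (n + 2)) ≠ 1 := by simp
    exact (congrArg (tw s) h0).trans ((tw_swap s h1).trans (tw_swap s h2).symm)
  | ext n σ h =>
    rw [padHom_extPerm, tw_extPerm s σ]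
    exact (tw_extPerm s _).trans h

/-- A vector antisymmetric in `S` and in the complement of `S` is an eigenvector of all
permutations preserving `S`. -/
theorem SwapEigen.of_preserves {K α W : Type*} [Field K] [AddCommGroup W] [Module K W] [Fintype α]
    [DecidableEq α] {ρ : Perm α →* Module.End K W} {s : ℤˣ} {S : Finset α} {w : W}
    (h : SwapEigen ρ s S w) (h' : SwapEigen ρ s Sᶜ w) {σ : Perm α} (hσ : ∀ x, σ x ∈ S ↔ x ∈ S) :
    ρ σ w = (((tw s σ : ℤˣ) : ℤ) : K) • w := by
  set a := Perm.ofSubtype (σ.subtypePerm hσ) with ha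
  have hafix : ∀ x ∈ S, a x = σ x := fun x hx => by
    rw [ha, Perm.ofSubtype_apply_of_mem _ hx, Perm.subtypePerm_apply]
  have hfix : ∀ x ∈ S, (a⁻¹ * σ) x = x := fun x hx => by
    rw [Perm.mul_apply, ← hafix x hx, ← Perm.mul_apply, inv_mul_cancel, Perm.one_apply]
  have h1 : ∀ x, (a⁻¹ * σ) x ∈ Sᶜ ↔ x ∈ Sᶜ := fun x => by
    rw [Finset.mem_compl, Finset.mem_compl, not_iff_not]
    refine ⟨fun hx => ?_, fun hx => by rwa [hfix x hx]⟩
    have := (a⁻¹ * σ).injective (hfix _ hx)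
    rwa [this] at hx
  have h2 : Perm.ofSubtype ((a⁻¹ * σ).subtypePerm h1) = a⁻¹ * σ :=
    Perm.ofSubtype_subtypePerm h1 fun x hx => by
      rw [Finset.mem_compl]
      exact fun hx' => hx (hfix x hx')
  -- `σ` is split as a permutation of `S` times a permutation of the complement of `S`, on each of
  -- which the character is known.
  obtain ⟨b, hb⟩ : ∃ b : Perm (Sᶜ : Finset α), σ = a * Perm.ofSubtype b :=
    ⟨_, by rw [h2, mul_inv_cancel_left]⟩
  rw [hb, map_mul, Module.End.mul_apply, h'.perm, map_smul, ha, h.perm, map_mul, tw_ofSubtype,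
    tw_ofSubtype, smul_smul]
  push_cast
  rw [mul_comm]

end Blocks

/-! ### Exterior and symmetric powers of a direct sum -/

section AltSum

open Equiv

variable {K : Type*} [Field K] [CharZero K]
variable {C : Type u} [Category.{v} C] [Preadditive C] [Linear K C] [MonoidalCategory C]
  [SymmetricCategory C] [MonoidalPreadditive C] [MonoidalLinear K C]

variable (K) in
/-- The product of two antisymmetrizers acting on the two blocks of `Z^{⊗ (j + i)}`. -/
def altAlt (t : ℤˣ) (Z : C) (i j : ℕ) : tensorPow Z (j + i) ⟶ tensorPow Z (j + i) :=
  (catIso Z i j).inv ≫ (alt K t Z i ⊗ₘ alt K t Z j) ≫ (catIso Z i j).hom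

theorem sum_smul_alt (t : ℤˣ) {n : ℕ} {V : Type*} [AddCommGroup V] [Module K V] (v : V) :
    (n.factorial : K)⁻¹ • ∑ σ : Perm (Fin n), (((tw (-t) σ : ℤˣ) : ℤ) : K) •
      (((tw (-t) σ : ℤˣ) : ℤ) : K) • v = v := by
  simp_rw [smul_smul, units_mul_self_cast, one_smul]
  rw [Finset.sum_const, Finset.card_univ, Fintype.card_perm, Fintype.card_fin,
    ← Nat.cast_smul_eq_nsmul K, smul_smul,
    inv_mul_cancel₀ (Nat.cast_ne_zero.2 n.factorial_ne_zero), one_smul]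

theorem smul_tensorHom {X Y X' Y' : C} (c : K) (f : X ⟶ Y) (g : X' ⟶ Y') :
    (c • f) ⊗ₘ g = c • (f ⊗ₘ g) := by
  rw [MonoidalCategory.tensorHom_def, MonoidalCategory.tensorHom_def,
    MonoidalLinear.smul_whiskerRight, Linear.smul_comp]

theorem tensorHom_smul {X Y X' Y' : C} (c : K) (f : X ⟶ Y) (g : X' ⟶ Y') :
    f ⊗ₘ (c • g) = c • (f ⊗ₘ g) := by
  rw [MonoidalCategory.tensorHom_def, MonoidalCategory.tensorHom_def,
    MonoidalLinear.whiskerLeft_smul, Linear.comp_smul]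

theorem tensor_alt_catIso (t : ℤˣ) (Z : C) (i j : ℕ) : altAlt K t Z i j =
    actMap Z (mapAlg K (padHom i j) (altElt K t i)) ≫
      actMap Z (mapAlg K (extNHom j i) (altElt K t j)) := by
  rw [altAlt, ← actMap_altElt, ← actMap_altElt, tensor_actMap_catIso, actMap_mul]

theorem actMap_mapAlg_altElt (t : ℤˣ) (Z : C) {i n : ℕ} (f : Perm (Fin i) →* Perm (Fin n)) :
    actMap Z (mapAlg K f (altElt K t i)) =
      (i.factorial : K)⁻¹ • ∑ σ, (((tw (-t) σ : ℤˣ) : ℤ) : K) • pm Z n (f σ) := by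
  rw [altElt, map_smul, map_sum, actMap_smul, actMap_sum]
  simp_rw [map_smul, actMap_smul, mapAlg, MonoidAlgebra.lift_of, MonoidHom.comp_apply, actMap_of]

theorem alt_comp_altAlt (t : ℤˣ) (Z : C) (i j : ℕ) :
    alt K t Z (j + i) ≫ altAlt K t Z i j = alt K t Z (j + i) ∧
      altAlt K t Z i j ≫ alt K t Z (j + i) = alt K t Z (j + i) := by
  rw [tensor_alt_catIso, actMap_mapAlg_altElt, actMap_mapAlg_altElt]
  have hpad : ∀ σ : Perm (Fin i), tw (-t) (padHom i j σ) = tw (-t) σ := tw_padHom (-t) j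
  have hext : ∀ σ : Perm (Fin j), tw (-t) (extNHom j i σ) = tw (-t) σ := fun σ => tw_extN _ _ _
  constructor
  · rw [← Category.assoc]
    simp only [Linear.comp_smul, Preadditive.comp_sum, alt_pm, hpad, hext, sum_smul_alt]
  · rw [Category.assoc]
    simp only [Linear.smul_comp, Preadditive.sum_comp, pm_alt, hpad, hext, sum_smul_alt]

/-- The word `true ⋯ true false ⋯ false`. -/
def blockWord (i j : ℕ) (x : Fin (j + i)) : Bool := decide ((x : ℕ) < i)

theorem card_blockWord (i j : ℕ) :
    (Finset.univ.filter fun x => blockWord i j x = true).card = i := by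
  have h : (Finset.univ.filter fun x => blockWord i j x = true) =
      Finset.univ.map (firstEmb i j) := by
    ext x
    rw [Finset.mem_filter, Finset.mem_map]
    refine ⟨fun h => ⟨⟨x, by simpa [blockWord] using h⟩, Finset.mem_univ _, Fin.ext rfl⟩, ?_⟩
    rintro ⟨y, -, rfl⟩
    simp [blockWord, firstEmb_val]
  rw [h, Finset.card_map, Finset.card_univ, Fintype.card_fin]

theorem word_blockWord {Z : C} (E : Bool → (Z ⟶ Z)) (i j : ℕ) : word E (blockWord i j) =
    (catIso Z i j).inv ≫ (powMap (E true) i ⊗ₘ powMap (E false) j) ≫ (catIso Z i j).hom := by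
  rw [word, tens_catIso, ← tens_const, ← tens_const]
  congr 4
  · funext x
    congr 1
    simp [blockWord, firstEmb_val]
  · funext x
    congr 1
    simp [blockWord]

theorem altAlt_word {Z : C} (E : Bool → (Z ⟶ Z)) (t : ℤˣ) (i j : ℕ) :
    altAlt K t Z i j ≫ word E (blockWord i j) = (catIso Z i j).inv ≫
      ((alt K t Z i ≫ powMap (E true) i) ⊗ₘ (alt K t Z j ≫ powMap (E false) j)) ≫
        (catIso Z i j).hom ∧
    word E (blockWord i j) ≫ altAlt K t Z i j = altAlt K t Z i j ≫ word E (blockWord i j) := by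
  rw [altAlt, word_blockWord, ← tensorHom_comp_tensorHom]
  simp only [Category.assoc, Iso.hom_inv_id_assoc, true_and]
  rw [tensorHom_comp_tensorHom_assoc, tensorHom_comp_tensorHom_assoc, alt_powMap, alt_powMap]

/-- A permutation fixing the word preserves each of the two blocks of positions. The block
antisymmetrizers supply the eigenvector property inside each block, and `SwapEigen.of_preserves`
combines the two. -/
theorem altAlt_word_pm {Z : C} (E : Bool → (Z ⟶ Z)) (t : ℤˣ) {i j : ℕ} {σ : Perm (Fin (j + i))}
    (hσ : blockWord i j ∘ σ = blockWord i j) :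
    (altAlt K t Z i j ≫ word E (blockWord i j)) ≫ pm Z (j + i) σ =
      (((tw (-t) σ : ℤˣ) : ℤ) : K) • (altAlt K t Z i j ≫ word E (blockWord i j)) := by
  set q := altAlt K t Z i j ≫ word E (blockWord i j) with hq
  have hpad (σ : Perm (Fin i)) : q ≫ pm Z (j + i) (padHom i j σ) =
      (((tw (-t) σ : ℤˣ) : ℤ) : K) • q := by
    rw [hq, (altAlt_word E t i j).1, Category.assoc, Category.assoc, ← pm_whiskerRight_catIso,
      ← tensorHom_id, ← Category.assoc (_ ⊗ₘ _) (_ ⊗ₘ _), tensorHom_comp_tensorHom, Category.assoc,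
      ← pm_powMap, ← Category.assoc (alt K t Z i), alt_pm, Category.comp_id, Linear.smul_comp,
      smul_tensorHom, Linear.smul_comp, Linear.comp_smul]
  have hext (σ : Perm (Fin j)) : q ≫ pm Z (j + i) (extNHom j i σ) =
      (((tw (-t) σ : ℤˣ) : ℤ) : K) • q := by
    rw [hq, (altAlt_word E t i j).1, Category.assoc, Category.assoc, ← whiskerLeft_pm_catIso,
      ← id_tensorHom, ← Category.assoc (_ ⊗ₘ _) (_ ⊗ₘ _), tensorHom_comp_tensorHom,
      Category.assoc (alt K t Z j),
      ← pm_powMap, ← Category.assoc (alt K t Z j), alt_pm, Category.comp_id, Linear.smul_comp,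
      tensorHom_smul, Linear.smul_comp, Linear.comp_smul]
  refine SwapEigen.of_preserves (ρ := postRep K (tensorPow Z (j + i)) Z (j + i))
    (S := Finset.univ.filter fun x => blockWord i j x = true) ?_ ?_ ?_
  · intro x hx y hy hxy
    rw [postRep_apply]
    simp only [blockWord, Finset.mem_filter, Finset.mem_univ, true_and, decide_eq_true_eq] at hx hy
    have := hpad (swap ⟨x, hx⟩ ⟨y, hy⟩)
    rw [padHom_swap, tw_swap _ (by simpa [Fin.ext_iff] using hxy)] at this
    exact this
  · intro x hx y hy hxy
    rw [postRep_apply]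
    simp only [blockWord, Finset.mem_compl, Finset.mem_filter, Finset.mem_univ, true_and,
      decide_eq_true_eq, not_lt] at hx hy
    have hx' : (⟨x - i, by omega⟩ : Fin j).addNat i = x := Fin.ext (by simp; omega)
    have hy' : (⟨y - i, by omega⟩ : Fin j).addNat i = y := Fin.ext (by simp; omega)
    have hne : (⟨x - i, by omega⟩ : Fin j) ≠ ⟨y - i, by omega⟩ := fun h =>
      hxy (by rw [← hx', ← hy', h])
    have := hext (swap ⟨x - i, by omega⟩ ⟨y - i, by omega⟩)
    rw [extN_swap_comp, hx', hy', tw_swap _ hne] at this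
    exact this
  · intro x
    have := congrFun hσ x
    rw [Function.comp_apply] at this
    simp only [Finset.mem_filter, Finset.mem_univ, true_and, this]

/-- All words with `i` letters `true` are conjugate under permutations, and the full antisymmetrizer
`A` absorbs the conjugations, so `A ≫ S` is the number of such words times `A ≫ T ≫ A`. Conversely,
compressing `A` by `B ≫ T` keeps only the permutations which fix the block word. The idempotents `A
≫ S` and `B ≫ T` are thus linked by nonzero scalars, and the image of `B ≫ T` is `F ⊗ G`. -/
theorem isIm_wordSum {Z X Y F G P : C} {E : Bool → (Z ⟶ Z)} (hE : Splitting E)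
    (hX : IsIm (E true) X) (hY : IsIm (E false) Y) {t : ℤˣ} {i j : ℕ}
    (hF : IsIm (alt K t X i) F) (hG : IsIm (alt K t Y j) G)
    (hP : IsIm (alt K t Z (j + i) ≫ wordSum E (j + i) i) P) : Nonempty (P ≅ F ⊗ G) := by
  set A := alt K t Z (j + i) with hA
  set B := altAlt K t Z i j with hB
  set T := word E (blockWord i j) with hT
  set S := wordSum E (j + i) i with hS
  have hAA : A ≫ A = A := alt_idem K t Z (j + i)
  obtain ⟨hAB, hBA⟩ := alt_comp_altAlt (K := K) t Z i j
  rw [← hA, ← hB] at hAB hBA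
  obtain ⟨hq, hTB⟩ := altAlt_word (K := K) E t i j
  rw [← hB, ← hT] at hq hTB
  have hQ : IsIm (B ≫ T) (F ⊗ G) := by
    rw [hq]
    refine (IsIm.tensor ?_ ?_).conj (catIso Z i j)
    · obtain ⟨a, b, hab, hba⟩ := hX
      have := hF.trans (i := powMap a i) (r := powMap b i)
        (by rw [← powMap_comp, hab, powMap_id])
      rwa [← Category.assoc, ← alt_powMap, Category.assoc, ← powMap_comp, hba] at this
    · obtain ⟨a, b, hab, hba⟩ := hY
      have := hG.trans (i := powMap a j) (r := powMap b j)
        (by rw [← powMap_comp, hab, powMap_id])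
      rwa [← Category.assoc, ← alt_powMap, Category.assoc, ← powMap_comp, hba] at this
  have hAS : A ≫ S = S ≫ A := by
    rw [hA, alt]
    simp only [Linear.smul_comp, Linear.comp_smul, Preadditive.sum_comp, Preadditive.comp_sum,
      hS, wordSum_pm]
  have hTS := hE.word_wordSum (blockWord i j)
  rw [card_blockWord, ← hT, ← hS] at hTS
  set N : K := ((Finset.univ.filter fun g : Fin (j + i) → Bool =>
      (Finset.univ.filter fun x => g x = true).card = i).card : K) with hN
  have hcard : N ≠ 0 := by
    refine Nat.cast_ne_zero.2 (Finset.card_ne_zero_of_mem (a := blockWord i j) ?_)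
    rw [Finset.mem_filter, card_blockWord]
    exact ⟨Finset.mem_univ _, rfl⟩
  have hATA : A ≫ S = N • (A ≫ T ≫ A) := by
    calc A ≫ S = A ≫ S ≫ A := by rw [← hAS, ← Category.assoc, hAA]
      _ = ∑ g : Fin (j + i) → Bool with (Finset.univ.filter fun x => g x = true).card = i,
            A ≫ word E g ≫ A := by
          rw [hS, wordSum, Preadditive.sum_comp, Preadditive.comp_sum]
      _ = ∑ g : Fin (j + i) → Bool with (Finset.univ.filter fun x => g x = true).card = i,
            A ≫ T ≫ A := by
          refine Finset.sum_congr rfl fun g hg => ?_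
          obtain ⟨σ, rfl⟩ := exists_perm_of_card g (blockWord i j)
            ((Finset.mem_filter.1 hg).2.trans (card_blockWord i j).symm)
          have h1 : word E (blockWord i j ∘ σ) = pm Z (j + i) σ ≫ T ≫ pm Z (j + i) σ⁻¹ := by
            rw [hT, ← Category.assoc, ← word_pm, Category.assoc, ← pm_mul, inv_mul_cancel, pm_one,
              Category.comp_id]
          rw [h1, Category.assoc, Category.assoc, hA, pm_alt, ← Category.assoc, alt_pm]
          simp only [Linear.smul_comp, Linear.comp_smul, smul_smul]
          have h2 : tw (-t) σ⁻¹ = tw (-t) σ := by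
            rw [map_inv, Int.units_inv_eq_self]
          rw [h2, units_mul_self_cast, one_smul]
      _ = _ := by
          rw [Finset.sum_const, ← Nat.cast_smul_eq_nsmul K]
  have hQS : (B ≫ T) ≫ S = B ≫ T := by rw [Category.assoc, hTS.1]
  have hQS' : S ≫ B ≫ T = B ≫ T := by rw [← hTB, ← Category.assoc, hTS.2]
  refine hP.iso_of_scalar hQ (inv_ne_zero hcard) (c' := ((j + i).factorial : K)⁻¹ *
    ((Finset.univ.filter fun σ : Perm (Fin (j + i)) =>
      blockWord i j ∘ σ = blockWord i j).card : K)) ?_ ?_ ?_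
  · refine mul_ne_zero (inv_ne_zero (Nat.cast_ne_zero.2 (Nat.factorial_ne_zero _)))
      (Nat.cast_ne_zero.2 (Finset.card_ne_zero_of_mem (a := 1) ?_))
    rw [Finset.mem_filter]
    exact ⟨Finset.mem_univ _, rfl⟩
  · calc (A ≫ S) ≫ (B ≫ T) ≫ A ≫ S = A ≫ (S ≫ B ≫ T) ≫ A ≫ S := by simp only [Category.assoc]
      _ = A ≫ ((B ≫ T) ≫ S) ≫ A := by rw [hQS', hAS]; simp only [Category.assoc]
      _ = (A ≫ B) ≫ T ≫ A := by rw [hQS]; simp only [Category.assoc]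
      _ = A ≫ T ≫ A := by rw [hAB]
      _ = _ := by rw [hATA, smul_smul, inv_mul_cancel₀ hcard, one_smul]
  · have hqp (σ : Perm (Fin (j + i))) : (B ≫ T) ≫ pm Z (j + i) σ ≫ B ≫ T =
        if blockWord i j ∘ σ = blockWord i j then (((tw (-t) σ : ℤˣ) : ℤ) : K) • (B ≫ T) else 0 := by
      split_ifs with hσ
      · rw [← Category.assoc, altAlt_word_pm E t hσ, Linear.smul_comp, hQ.idem]
      · have h2 : T ≫ pm Z (j + i) σ ≫ T = 0 := by
          rw [hT, ← word_pm, ← Category.assoc, hE.word_comp, if_neg (Ne.symm hσ), zero_comp]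
        have h3 : (B ≫ T) ≫ pm Z (j + i) σ ≫ T ≫ B = 0 := by
          rw [Category.assoc, reassoc_of% h2, zero_comp, comp_zero]
        rwa [hTB] at h3
    calc (B ≫ T) ≫ (A ≫ S) ≫ B ≫ T = (B ≫ T) ≫ A ≫ (S ≫ B ≫ T) := by
          simp only [Category.assoc]
      _ = (B ≫ T) ≫ A ≫ B ≫ T := by rw [hQS']
      _ = _ := by
          rw [hA, alt]
          simp only [Linear.smul_comp, Linear.comp_smul, Preadditive.sum_comp,
            Preadditive.comp_sum, hqp, smul_ite, smul_zero, smul_smul, units_mul_self_cast,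
            one_smul]
          rw [← Finset.sum_filter, Finset.sum_const, ← Nat.cast_smul_eq_nsmul K, smul_smul]

end AltSum

/-! ### Identities for the dimensions and the exponents -/

section Binomials

/-- The dimension of the exterior (`t = 1`) or symmetric (`t = -1`) power of an object of
dimension `x`. -/
def powDim (t : ℤˣ) (n : ℕ) (x : ℤ) : ℤ := (t : ℤ) ^ n * Ring.choose ((t : ℤ) * x) n

/-- The exponent of the determinant of the exterior (`t = 1`) or symmetric (`t = -1`) power of an
object of dimension `x`. -/
def powExp (t : ℤˣ) (n : ℕ) (x : ℤ) : ℤ :=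
  if n = 0 then 0 else (t : ℤ) ^ (n - 1) * Ring.choose ((t : ℤ) * x - 1) (n - 1)

theorem powExp_zero (t : ℤˣ) (x : ℤ) : powExp t 0 x = 0 := if_pos rfl

theorem powExp_succ (t : ℤˣ) (n : ℕ) (x : ℤ) :
    powExp t (n + 1) x = (t : ℤ) ^ n * Ring.choose ((t : ℤ) * x - 1) n := if_neg n.succ_ne_zero

theorem units_mul_self_int (t : ℤˣ) : (t : ℤ) * t = 1 := by
  rw [← Units.val_mul, Int.units_mul_self, Units.val_one]

/-- The absorption identity `n * choose X n = X * choose (X - 1) (n - 1)`, with signs. It makes the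
quotient in the exponents an integer, with a value also at dimension zero. -/
theorem powExp_mul (t : ℤˣ) (n : ℕ) (x : ℤ) : powExp t n x * x = n * powDim t n x := by
  cases n with
  | zero => simp [powExp_zero]
  | succ n =>
    have := Ring.choose_smul_choose ((t : ℤ) * x) (Nat.le_add_left 1 n)
    rw [Nat.choose_one_right,
      Nat.add_sub_cancel, Ring.choose_one_right, nsmul_eq_mul, Nat.cast_one] at this
    rw [powExp_succ, powDim]
    linear_combination (-(t : ℤ) ^ (n + 1)) * this -
      (t : ℤ) ^ n * x * Ring.choose ((t : ℤ) * x - 1) n * units_mul_self_int t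

theorem powDim_add (t : ℤˣ) (n : ℕ) (x y : ℤ) : powDim t n (x + y) =
    ∑ ij ∈ Finset.HasAntidiagonal.antidiagonal n, powDim t ij.1 x * powDim t ij.2 y := by
  rw [powDim, mul_add, Ring.add_choose_eq n (Commute.all _ _), Finset.mul_sum]
  refine Finset.sum_congr rfl fun ij hij => ?_
  rw [powDim, powDim, ← Finset.HasAntidiagonal.mem_antidiagonal.1 hij, pow_add]
  ring

/-- Vandermonde's identity with the shift by `-1` attached to `x`. Its terms are the exponents
produced by the determinant formula for a tensor product. -/
theorem powExp_add (t : ℤˣ) (n : ℕ) (x y : ℤ) : powExp t n (x + y) =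
    ∑ ij ∈ Finset.HasAntidiagonal.antidiagonal n, powExp t ij.1 x * powDim t ij.2 y := by
  cases n with
  | zero => simp [powExp_zero]
  | succ n =>
    rw [Finset.Nat.sum_antidiagonal_succ, powExp_zero, zero_mul, zero_add, powExp_succ,
      show (t : ℤ) * (x + y) - 1 = ((t : ℤ) * x - 1) + t * y by ring,
      Ring.add_choose_eq n (Commute.all _ _), Finset.mul_sum]
    refine Finset.sum_congr rfl fun ij hij => ?_
    rw [powExp_succ, powDim, ← Finset.HasAntidiagonal.mem_antidiagonal.1 hij, pow_add]
    ring

theorem choose_neg_one (n : ℕ) : Ring.choose (-1 : ℤ) n = (-1) ^ n := by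
  rw [Ring.choose_neg', Ring.multichoose_one]
  simp [Int.negOnePow_def, Units.smul_def]

theorem powDim_one (n : ℕ) (x : ℤ) : powDim 1 n x = Ring.choose x n := by
  simp [powDim]

theorem powDim_neg_one (n : ℕ) (x : ℤ) : powDim (-1) n x = Ring.choose (x + n - 1) n := by
  have h : ((-1 : ℤ) ^ n) * (-1) ^ n = 1 := by rw [← mul_pow]; simp
  have := Ring.choose_neg x n
  rw [powDim, Units.val_neg, Units.val_one, neg_one_mul, this]
  simp only [Int.negOnePow_def, Units.smul_def, zpow_natCast, Units.val_pow_eq_pow_val,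
    Units.val_neg, Units.val_one, smul_eq_mul]
  rw [← mul_assoc, h, one_mul]

theorem powExp_one_zero (n : ℕ) : powExp 1 n 0 = if n = 0 then 0 else (-1) ^ (n - 1) := by
  rw [powExp, mul_zero, zero_sub, choose_neg_one]
  simp

theorem powExp_neg_one_zero (n : ℕ) : powExp (-1) n 0 = if n = 0 then 0 else 1 := by
  rw [powExp, mul_zero, zero_sub, choose_neg_one, Units.val_neg, Units.val_one, ← mul_pow]
  simp

end Binomials

/-! ### Images and direct sums -/

section Images

variable {C : Type u} [Category.{v} C] [Preadditive C] [HasBinaryBiproducts C]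

theorem IsIm.iso_biprod {X Y Y' W : C} {p q : X ⟶ X} (h : IsIm p Y) (h' : IsIm q Y')
    (hpq : p ≫ q = 0) (hqp : q ≫ p = 0) (hW : IsIm (p + q) W) : Nonempty (W ≅ Y ⊞ Y') := by
  obtain ⟨i, r, hi, rfl⟩ := h
  obtain ⟨i', r', hi', rfl⟩ := h'
  have h1 : i ≫ r' = 0 := by
    have := congrArg (fun f => i ≫ f ≫ r') hpq
    simpa [reassoc_of% hi, hi'] using this
  have h2 : i' ≫ r = 0 := by
    have := congrArg (fun f => i' ≫ f ≫ r) hqp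
    simpa [reassoc_of% hi', hi] using this
  refine hW.iso (⟨biprod.desc i i', biprod.lift r r', ?_, by simp⟩ : IsIm _ (Y ⊞ Y'))
  ext <;> simp [hi, hi', h1, h2]

theorem isIm_biprod (X Y : C) : IsIm (biprod.fst ≫ biprod.inl : X ⊞ Y ⟶ X ⊞ Y) X ∧
    IsIm (biprod.snd ≫ biprod.inr : X ⊞ Y ⟶ X ⊞ Y) Y :=
  ⟨⟨biprod.inl, biprod.fst, by simp, rfl⟩, ⟨biprod.inr, biprod.snd, by simp, rfl⟩⟩

/-- The isomorphism `(A ⊞ B) ⊞ (A' ⊞ B') ≅ (A ⊞ A') ⊞ (B ⊞ B')`. -/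
def biprodComm (A B A' B' : C) : (A ⊞ B) ⊞ (A' ⊞ B') ≅ (A ⊞ A') ⊞ (B ⊞ B') where
  hom := biprod.lift (biprod.map biprod.fst biprod.fst) (biprod.map biprod.snd biprod.snd)
  inv := biprod.lift (biprod.map biprod.fst biprod.fst) (biprod.map biprod.snd biprod.snd)

theorem tensor_biprod [MonoidalCategory C] [MonoidalPreadditive C] (X A B : C) :
    Nonempty (X ⊗ (A ⊞ B) ≅ (X ⊗ A) ⊞ (X ⊗ B)) := by
  refine ⟨⟨biprod.lift (X ◁ biprod.fst) (X ◁ biprod.snd),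
    biprod.desc (X ◁ biprod.inl) (X ◁ biprod.inr), ?_, ?_⟩⟩
  · rw [biprod.lift_desc, ← whiskerLeft_comp, ← whiskerLeft_comp,
      ← MonoidalPreadditive.whiskerLeft_add, biprod.total, whiskerLeft_id]
  · ext <;> simp [← whiskerLeft_comp]

end Images

/-! ### Duals of invertible objects -/

section Dual

variable {C : Type u} [Category.{v} C] [MonoidalCategory C] [SymmetricCategory C]

/-- The dual of an invertible object is its inverse. -/
theorem dual_iso_of_invertible [RigidCategory C] {L T : C} (e : L ⊗ T ≅ 𝟙_ C) :
    Nonempty (Lᘁ ≅ T) := by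
  have f := Adjunction.rightAdjointUniq (tensorRightAdjunction L (Lᘁ))
    (tensorRightEquivalence e).toAdjunction
  exact ⟨(λ_ _).symm ≪≫ f.app (𝟙_ C) ≪≫ λ_ _⟩

end Dual

/-! ### Invertible objects as units of the monoid of isomorphism classes -/

section SkeletonUnits

variable {C : Type u} [Category.{v} C] [MonoidalCategory C] [SymmetricCategory C]

theorem toSkeleton_tensorPow (X : C) (n : ℕ) :
    toSkeleton (tensorPow X n) = toSkeleton X ^ n := by
  induction n with
  | zero => rw [pow_zero, Skeleton.one_eq, tensorPow]
  | succ n ih => rw [pow_succ', ← ih, tensorPow, Skeleton.toSkeleton_tensorObj]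

theorem toSkeleton_mul_of_iso {L T : C} (e : L ⊗ T ≅ 𝟙_ C) :
    toSkeleton L * toSkeleton T = 1 := by
  rw [← Skeleton.toSkeleton_tensorObj, Skeleton.one_eq]
  exact congr_toSkeleton_of_iso e

theorem exists_unit_of_iso {L T : C} (e : L ⊗ T ≅ 𝟙_ C) :
    ∃ w : (Skeleton C)ˣ, (w : Skeleton C) = toSkeleton L :=
  ⟨Units.mkOfMulEqOne _ _ (toSkeleton_mul_of_iso e), rfl⟩

theorem exists_iso_of_unit {L : C} {w : (Skeleton C)ˣ} (h : (w : Skeleton C) = toSkeleton L) :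
    ∃ T, Nonempty (L ⊗ T ≅ 𝟙_ C) := by
  obtain ⟨T, hT⟩ := Quotient.exists_rep (w⁻¹ : (Skeleton C)ˣ).val
  refine ⟨T, toSkeleton_eq_toSkeleton_iff.1 ?_⟩
  have hT' : toSkeleton T = (w⁻¹ : (Skeleton C)ˣ).val := hT
  rw [Skeleton.toSkeleton_tensorObj, ← h, hT', Units.mul_inv, Skeleton.one_eq]

theorem toSkeleton_dual [RigidCategory C] {L : C} {w : (Skeleton C)ˣ}
    (h : (w : Skeleton C) = toSkeleton L) :
    toSkeleton (Lᘁ) = ((w⁻¹ : (Skeleton C)ˣ) : Skeleton C) := by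
  obtain ⟨T, ⟨e⟩⟩ := exists_iso_of_unit h
  obtain ⟨f⟩ := dual_iso_of_invertible e
  rw [congr_toSkeleton_of_iso f]
  refine (Units.inv_eq_of_mul_eq_one_right ?_).symm
  rw [h, toSkeleton_mul_of_iso e]

theorem toSkeleton_tensorZPow [RigidCategory C] {L : C} {w : (Skeleton C)ˣ}
    (h : (w : Skeleton C) = toSkeleton L) (z : ℤ) :
    toSkeleton (tensorZPow L z) = ((w ^ z : (Skeleton C)ˣ) : Skeleton C) := by
  cases z with
  | ofNat n =>
    rw [tensorZPow, toSkeleton_tensorPow, ← h, Int.ofNat_eq_natCast, zpow_natCast,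
      Units.val_pow_eq_pow_val]
  | negSucc n =>
    rw [tensorZPow, toSkeleton_tensorPow, toSkeleton_dual h, zpow_negSucc, ← inv_pow,
      Units.val_pow_eq_pow_val]

end SkeletonUnits

/-! ### Determinant classes of signed objects -/

section DetClass

open Equiv

variable {C : Type u} [Category.{v} C] [Preadditive C] [MonoidalCategory C]
  [SymmetricCategory C] [MonoidalPreadditive C] [RigidCategory C]

/-- `X` is positive or negative of dimension `d`, and its determinant has the class `w`. -/
structure DetClass (K : Type*) [Field K] [CharZero K] [Linear K C] [MonoidalLinear K C]
    [Fact (Function.Bijective (algebraMap K (End (𝟙_ C))))] (s : ℤˣ) (d : ℕ)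
    (w : (Skeleton C)ˣ) (X : C) : Prop where
  signed : Signed K s d X
  det : ∀ Λ, IsIm (alt K s X d) Λ → (w : Skeleton C) = toSkeleton Λ

variable {K : Type*} [Field K] [CharZero K] [Linear K C] [MonoidalLinear K C]

theorem IsIm.alt_of_iso {t : ℤˣ} {n : ℕ} {X Y F : C} (h : IsIm (alt K t X n) F) (e : X ≅ Y) :
    IsIm (alt K t Y n) F := by
  have h1 : powMap e.inv n ≫ powMap e.hom n = 𝟙 _ := by
    rw [← powMap_comp, e.inv_hom_id, powMap_id]
  have := h.conj ⟨powMap e.hom n, powMap e.inv n,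
    by rw [← powMap_comp, e.hom_inv_id, powMap_id], h1⟩
  rwa [alt_powMap, reassoc_of% h1] at this

theorem alt_eq_zero_of_le {s : ℤˣ} {X : C} {n m : ℕ} (h : alt K s X n = 0) (hnm : n ≤ m) :
    alt K s X m = 0 := by
  obtain ⟨j, rfl⟩ := Nat.exists_eq_add_of_le' hnm
  rw [← (alt_comp_altAlt s X n j).1, altAlt, h, MonoidalPreadditive.zero_tensor, zero_comp,
    comp_zero, comp_zero]

theorem alt_single (s : ℤˣ) (X : C) : alt K s X 1 = 𝟙 _ := by
  rw [alt, Fintype.sum_unique, show (default : Perm (Fin 1)) = 1 from rfl, map_one, pm_one]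
  simp

variable [IsIdempotentComplete C]
variable [hK : Fact (Function.Bijective (algebraMap K (End (𝟙_ C))))]

theorem Signed.exists_detClass {s : ℤˣ} {d : ℕ} {X : C} (h : Signed K s d X) :
    ∃ w, DetClass K s d w X := by
  obtain ⟨Λ, hΛ⟩ := exists_isIm _ (alt_idem K s X d)
  obtain ⟨e⟩ := (h.det hΛ).tensor_dual
  obtain ⟨w, hw⟩ := exists_unit_of_iso e
  refine ⟨w, h, fun Λ' hΛ' => ?_⟩
  obtain ⟨f⟩ := hΛ.iso hΛ'
  rw [hw, congr_toSkeleton_of_iso f]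

theorem DetClass.of_isIm {s : ℤˣ} {d : ℕ} {X Λ : C} {w : (Skeleton C)ˣ} (h : Signed K s d X)
    (hΛ : IsIm (alt K s X d) Λ) (hw : (w : Skeleton C) = toSkeleton Λ) : DetClass K s d w X := by
  refine ⟨h, fun Λ' hΛ' => ?_⟩
  obtain ⟨f⟩ := hΛ.iso hΛ'
  rw [hw, congr_toSkeleton_of_iso f]

theorem DetClass.of_iso {s : ℤˣ} {d : ℕ} {X Y : C} {w : (Skeleton C)ˣ} (h : DetClass K s d w X)
    (e : X ≅ Y) : DetClass K s d w Y :=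
  ⟨h.signed.of_iso e, fun Λ hΛ => h.det Λ (hΛ.alt_of_iso e.symm)⟩

theorem DetClass.unique {s : ℤˣ} {d d' : ℕ} {X : C} {w w' : (Skeleton C)ˣ}
    (h : DetClass K s d w X) (h' : DetClass K s d' w' X) : d = d' ∧ w = w' := by
  obtain rfl := h.signed.eq h'.signed
  obtain ⟨Λ, hΛ⟩ := exists_isIm _ (alt_idem K s X d)
  exact ⟨rfl, Units.ext ((h.det Λ hΛ).trans (h'.det Λ hΛ).symm)⟩

theorem DetClass.eq_one {s : ℤˣ} {X : C} {w : (Skeleton C)ˣ} (h : DetClass K s 0 w X) :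
    w = 1 := by
  refine Units.ext (h.det (𝟙_ C) ?_)
  rw [alt_zero]
  exact isIm_id _

theorem detClass_of_isZero (s : ℤˣ) {X : C} (h : IsZero X) : DetClass K s 0 1 X := by
  refine .of_isIm (Λ := 𝟙_ C) ⟨?_, ?_⟩ ?_ rfl
  · have h1 : powMap (𝟙 X) 1 = 0 := by
      rw [(IsZero.iff_id_eq_zero X).1 h]
      exact MonoidalPreadditive.zero_tensor _
    rw [← Category.comp_id (alt K s X (0 + 1)), ← powMap_id, h1, comp_zero]
  · rw [chi, (IsZero.iff_id_eq_zero X).1 h, map_zero, Nat.cast_zero, mul_zero]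
  · rw [alt_zero]
    exact isIm_id _

theorem DetClass.tensor {s t : ℤˣ} {a b : ℕ} {X Y : C} {w w' : (Skeleton C)ˣ}
    (hX : DetClass K s a w X) (hY : DetClass K t b w' Y) :
    DetClass K (s * t) (a * b) (w ^ b * w' ^ a) (X ⊗ Y) := by
  refine ⟨hX.signed.tensor hY.signed, fun L hL => ?_⟩
  obtain ⟨Λ, hΛ⟩ := exists_isIm _ (alt_idem K s X a)
  obtain ⟨Λ', hΛ'⟩ := exists_isIm _ (alt_idem K t Y b)
  obtain ⟨e⟩ := hX.signed.det_tensor hY.signed hΛ hΛ' hL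
  rw [congr_toSkeleton_of_iso e, Skeleton.toSkeleton_tensorObj, toSkeleton_tensorPow,
    toSkeleton_tensorPow, ← hX.det Λ hΛ, ← hY.det Λ' hΛ']
  simp

variable [HasBinaryBiproducts C]

/-- The projectors onto the two summands of a direct sum. -/
def biprodProj (X Y : C) (b : Bool) : X ⊞ Y ⟶ X ⊞ Y :=
  if b then biprod.fst ≫ biprod.inl else biprod.snd ≫ biprod.inr

theorem splitting_biprodProj (X Y : C) : Splitting (biprodProj X Y) where
  comp b b' := by cases b <;> cases b' <;> simp [biprodProj]
  add := by simp [biprodProj]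

theorem isIm_alt_biprod {X Y F G P : C} {t : ℤˣ} {i j n : ℕ} (hF : IsIm (alt K t X i) F)
    (hG : IsIm (alt K t Y j) G) (hn : i + j = n)
    (hP : IsIm (alt K t (X ⊞ Y) n ≫ wordSum (biprodProj X Y) n i) P) : Nonempty (P ≅ F ⊗ G) := by
  obtain rfl : j + i = n := by omega
  exact isIm_wordSum (splitting_biprodProj X Y) (isIm_biprod X Y).1 (isIm_biprod X Y).2 hF hG hP

theorem alt_comp_wordSum {Z : C} {E : Bool → (Z ⟶ Z)} (t : ℤˣ) (n j : ℕ) :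
    alt K t Z n ≫ wordSum E n j = wordSum E n j ≫ alt K t Z n := by
  rw [alt]
  simp only [Linear.smul_comp, Linear.comp_smul, Preadditive.sum_comp, Preadditive.comp_sum,
    wordSum_pm]

theorem Splitting.alt_wordSum_comp {Z : C} {E : Bool → (Z ⟶ Z)} (hE : Splitting E) (t : ℤˣ)
    (n i j : ℕ) : (alt K t Z n ≫ wordSum E n i) ≫ alt K t Z n ≫ wordSum E n j =
      if i = j then alt K t Z n ≫ wordSum E n i else 0 := by
  rw [alt_comp_wordSum t n j, Category.assoc, ← Category.assoc (wordSum E n i), hE.wordSum_comp]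
  split_ifs
  · rw [← alt_comp_wordSum, ← Category.assoc, alt_idem]
  · rw [zero_comp, comp_zero]

theorem Splitting.sum_alt_wordSum {Z : C} {E : Bool → (Z ⟶ Z)} (hE : Splitting E) (t : ℤˣ)
    (n : ℕ) : ∑ i ∈ Finset.range (n + 1), alt K t Z n ≫ wordSum E n i = alt K t Z n := by
  rw [← Preadditive.comp_sum, hE.sum_wordSum, Category.comp_id]

theorem isZero_tensor {F G : C} (h : IsZero F ∨ IsZero G) : IsZero (F ⊗ G) := by
  rw [IsZero.iff_id_eq_zero, ← id_tensorHom_id]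
  rcases h with h | h
  · rw [(IsZero.iff_id_eq_zero F).1 h, MonoidalPreadditive.zero_tensor]
  · rw [(IsZero.iff_id_eq_zero G).1 h, MonoidalPreadditive.tensor_zero]

/-- The power of degree `n` of `X ⊞ Y` is the sum of the products of the `i`-th power of `X` and the
`(n - i)`-th power of `Y`. For `n = a + b + 1` every term vanishes, and for `n = a + b` only `i = a`
survives, which gives the product of the determinants. -/
theorem DetClass.biprod {s : ℤˣ} {a b : ℕ} {X Y : C} {w w' : (Skeleton C)ˣ}
    (hX : DetClass K s a w X) (hY : DetClass K s b w' Y) :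
    DetClass K s (a + b) (w * w') (X ⊞ Y) := by
  have hE := splitting_biprodProj X Y
  have key (n i j : ℕ) (hn : i + j = n) (h : a < i ∨ b < j) :
      alt K s (X ⊞ Y) n ≫ wordSum (biprodProj X Y) n i = 0 := by
    obtain ⟨F, hF⟩ := exists_isIm _ (alt_idem K s X i)
    obtain ⟨G, hG⟩ := exists_isIm _ (alt_idem K s Y j)
    obtain ⟨P, hP⟩ := exists_isIm _ ((hE.alt_wordSum_comp (K := K) s n i i).trans (if_pos rfl))
    obtain ⟨e⟩ := isIm_alt_biprod hF hG hn hP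
    refine hP.isZero_iff.1 (IsZero.of_iso (isZero_tensor (h.imp (fun h => ?_) fun h => ?_)) e)
    · exact hF.isZero_iff.2 (alt_eq_zero_of_le hX.signed.1 h)
    · exact hG.isZero_iff.2 (alt_eq_zero_of_le hY.signed.1 h)
  have hS : Signed K s (a + b) (X ⊞ Y) := by
    refine ⟨?_, ?_⟩
    · rw [← hE.sum_alt_wordSum]
      refine Finset.sum_eq_zero fun i hi => ?_
      rw [Finset.mem_range] at hi
      exact key _ i (a + b + 1 - i) (by omega) (by omega)
    · rw [chi_biprod, hX.signed.2, hY.signed.2]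
      push_cast
      ring
  refine ⟨hS, fun L hL => ?_⟩
  rw [← hE.sum_alt_wordSum, Finset.sum_eq_single a (fun i hi hia => ?_) fun h => ?_] at hL
  · obtain ⟨Λ, hΛ⟩ := exists_isIm _ (alt_idem K s X a)
    obtain ⟨Λ', hΛ'⟩ := exists_isIm _ (alt_idem K s Y b)
    obtain ⟨e⟩ := isIm_alt_biprod hΛ hΛ' rfl hL
    rw [congr_toSkeleton_of_iso e, Skeleton.toSkeleton_tensorObj, ← hX.det Λ hΛ, ← hY.det Λ' hΛ',
      Units.val_mul]
  · rw [Finset.mem_range] at hi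
    exact key _ i (a + b - i) (by omega) (by omega)
  · exact absurd (Finset.mem_range.2 (by omega)) h

/-- A power of a signed object is a summand of `X^{⊗ i}`, hence signed with sign `s ^ i`; its
dimension is read off from the trace, and its determinant from `Signed.det_alt`. The signs are put
into the exponents so that one formula covers all combinations of `s` and `t`. -/
theorem DetClass.alt {s t : ℤˣ} {d i : ℕ} {X F : C} {w : (Skeleton C)ˣ} (hX : DetClass K s d w X)
    (hF : IsIm (TensorDet.alt K t X i) F) : ∃ D w', DetClass K (s ^ i) D w' F ∧
      ((s ^ i : ℤˣ) : ℤ) * D = powDim t i (s * d) ∧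
      w' ^ ((s ^ i : ℤˣ) : ℤ) = (w ^ (s : ℤ)) ^ powExp t i (s * d) := by
  obtain ⟨D, hD⟩ := (hX.signed.tensorPow i).exists_of_isIm hF
  obtain ⟨w', hw'⟩ := hD.exists_detClass
  have h1 : ((s ^ i : ℤˣ) : ℤ) * D = powDim t i (s * d) := by
    have h2 := tr_alt (K := K) t X i (x := s * d) (by rw [hX.signed.2]; push_cast; rfl)
    rw [tr_of_isIm hF, hD.2] at h2
    exact_mod_cast h2
  refine ⟨D, w', hw', h1, ?_⟩
  -- `Signed.det_alt` requires `d > 0`. If `d = 0`, then `alt` at `1`, which is the identity for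
  -- both signs, vanishes, so `F` is the unit object for `i = 0` and zero otherwise.
  by_cases hd : d = 0
  · subst hd
    obtain rfl := hX.eq_one
    have hone : w' = 1 := by
      cases i with
      | zero =>
        rw [alt_zero] at hF
        obtain ⟨e⟩ := hF.iso (isIm_id (𝟙_ C))
        have h3 : DetClass K 1 1 1 (𝟙_ C) := by
          refine .of_isIm (Λ := 𝟙_ C) signed_unit ?_ rfl
          rw [alt_single]
          exact (isIm_id (𝟙_ C ⊗ 𝟙_ C)).of_iso (λ_ _)
        rw [pow_zero] at hw'
        exact (hw'.unique (h3.of_iso e.symm)).2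
      | succ i =>
        have h3 : TensorDet.alt K t X 1 = 0 := by
          rw [alt_single, ← alt_single (K := K) s]
          exact hX.signed.1
        have h4 : IsZero F :=
          hF.isZero_iff.2 (alt_eq_zero_of_le h3 (Nat.succ_le_succ (Nat.zero_le i)))
        exact (hw'.unique (detClass_of_isZero _ h4)).2
    rw [hone, one_zpow, one_zpow, one_zpow]
  · have h2 := powExp_mul t i (s * d)
    rw [← h1] at h2
    have hs := units_mul_self_int s
    have hsi := units_mul_self_int (s ^ i)
    have h3 : (d : ℤ) * (((s ^ i : ℤˣ) : ℤ) * s * powExp t i (s * d)) = i * D := by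
      linear_combination ((s ^ i : ℤˣ) : ℤ) * h2 + i * D * hsi
    -- `k` is the exponent required by `Signed.det_alt`; the divisibility is the absorption identity
    -- `powExp_mul`.
    obtain ⟨k, hk⟩ : d ∣ i * D := by
      have : (d : ℤ) ∣ ((i * D : ℕ) : ℤ) := ⟨_, by push_cast; exact h3.symm⟩
      exact_mod_cast this
    obtain ⟨Λ, hΛ⟩ := exists_isIm _ (alt_idem K s X d)
    obtain ⟨L, hL⟩ := exists_isIm _ (alt_idem K (s ^ i) F D)
    obtain ⟨e⟩ := hX.signed.det_alt hΛ hF hD hL (Nat.pos_of_ne_zero hd) hk.symm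
    have h4 : w' = w ^ (k : ℤ) := by
      rw [zpow_natCast]
      refine Units.ext ?_
      rw [hw'.det L hL, congr_toSkeleton_of_iso e, toSkeleton_tensorPow, ← hX.det Λ hΛ,
        Units.val_pow_eq_pow_val]
    have h5 : (k : ℤ) = ((s ^ i : ℤˣ) : ℤ) * s * powExp t i (s * d) := by
      have h6 : (d : ℤ) * k = i * D := by exact_mod_cast hk.symm
      exact mul_left_cancel₀ (Nat.cast_ne_zero.2 hd) (h6.trans h3.symm)
    rw [h4, ← zpow_mul, ← zpow_mul, h5]
    congr 1
    linear_combination (s : ℤ) * powExp t i (s * d) * hsi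

end DetClass

/-! ### Determinant classes of finite-dimensional objects -/

section VirtualDet

variable {C : Type u} [Category.{v} C] [Preadditive C] [HasZeroObject C] [HasBinaryBiproducts C]
  [IsIdempotentComplete C] [MonoidalCategory C] [SymmetricCategory C] [MonoidalPreadditive C]
  [RigidCategory C]

/-- `Z` is a sum of a positive and a negative object, it has dimension `a` and its determinant has
the class `δ`. -/
def HasDetClass (K : Type*) [Field K] [CharZero K] [Linear K C] [MonoidalLinear K C]
    [Fact (Function.Bijective (algebraMap K (End (𝟙_ C))))] (a : ℤ) (δ : (Skeleton C)ˣ) (Z : C) :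
    Prop :=
  ∃ (P N : C) (p n : ℕ) (w w' : (Skeleton C)ˣ), Nonempty (Z ≅ P ⊞ N) ∧ DetClass K 1 p w P ∧
    DetClass K (-1) n w' N ∧ a = p - n ∧ δ = w * w'⁻¹

variable {K : Type*} [Field K] [CharZero K] [Linear K C] [MonoidalLinear K C]
  [hK : Fact (Function.Bijective (algebraMap K (End (𝟙_ C))))]

theorem HasDetClass.of_iso {a : ℤ} {δ : (Skeleton C)ˣ} {Z Z' : C} (h : HasDetClass K a δ Z)
    (e : Z ≅ Z') : HasDetClass K a δ Z' := by
  obtain ⟨P, N, p, n, w, w', ⟨f⟩, h⟩ := h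
  exact ⟨P, N, p, n, w, w', ⟨e.symm ≪≫ f⟩, h⟩

theorem DetClass.hasDetClass {s : ℤˣ} {d : ℕ} {w : (Skeleton C)ˣ} {X : C}
    (h : DetClass K s d w X) : HasDetClass K (s * d) (w ^ (s : ℤ)) X := by
  obtain ⟨Z, hZ⟩ := HasZeroObject.zero (C := C)
  rcases Int.units_eq_one_or s with rfl | rfl
  · exact ⟨X, Z, d, 0, w, 1, ⟨isoBiprodZero hZ⟩, h, detClass_of_isZero _ hZ, by simp, by simp⟩
  · exact ⟨Z, X, 0, d, 1, w, ⟨isoZeroBiprod hZ⟩, detClass_of_isZero _ hZ, h, by simp, by simp⟩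

theorem hasDetClass_of_isZero {Z : C} (h : IsZero Z) : HasDetClass K 0 1 Z := by
  simpa using (detClass_of_isZero (K := K) 1 h).hasDetClass

theorem HasDetClass.biprod {a b : ℤ} {δ ε : (Skeleton C)ˣ} {X Y : C} (hX : HasDetClass K a δ X)
    (hY : HasDetClass K b ε Y) : HasDetClass K (a + b) (δ * ε) (X ⊞ Y) := by
  obtain ⟨P, N, p, n, w, w', ⟨f⟩, hP, hN, rfl, rfl⟩ := hX
  obtain ⟨P', N', p', n', v, v', ⟨f'⟩, hP', hN', rfl, rfl⟩ := hY
  refine ⟨P ⊞ P', N ⊞ N', p + p', n + n', w * v, w' * v',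
    ⟨biprod.mapIso f f' ≪≫ biprodComm P N P' N'⟩, hP.biprod hP', hN.biprod hN', ?_, ?_⟩
  · push_cast
    ring
  · rw [mul_inv, mul_mul_mul_comm]

/-- By distributivity the second factor is split for a signed first factor, and then the first one
is split after braiding. All four products of signs are signed. -/
theorem HasDetClass.tensor {a b : ℤ} {δ ε : (Skeleton C)ˣ} {X Y : C} (hX : HasDetClass K a δ X)
    (hY : HasDetClass K b ε Y) : HasDetClass K (a * b) (δ ^ b * ε ^ a) (X ⊗ Y) := by
  have key {s : ℤˣ} {d : ℕ} {P Y : C} {w ε : (Skeleton C)ˣ} {b : ℤ} (hP : DetClass K s d w P)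
      (hY : HasDetClass K b ε Y) :
      HasDetClass K ((s * d) * b) ((w ^ (s : ℤ)) ^ b * ε ^ ((s : ℤ) * d)) (P ⊗ Y) := by
    obtain ⟨Q, N, p, n, v, v', ⟨f⟩, hQ, hN, rfl, rfl⟩ := hY
    obtain ⟨e⟩ := tensor_biprod P Q N
    have h1 := (hP.tensor hQ).hasDetClass.biprod (hP.tensor hN).hasDetClass
    have h2 := h1.of_iso (e.symm ≪≫ whiskerLeftIso P f.symm)
    convert h2 using 1
    · push_cast
      ring
    -- The identity of exponents is checked in additive notation, where it is an identity in a
    -- `ℤ`-module.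
    · have h3 {A : Type _} [AddCommGroup A] (w v v' : A) (s : ℤ) :
          ((p : ℤ) - n) • s • w + (s * d) • (v + -v') =
            (s * 1) • (p • w + d • v) + (s * -1) • (n • w + d • v') := by module
      rw [Units.val_mul, Units.val_mul, Units.val_neg, Units.val_one]
      exact h3 (A := Additive (Skeleton C)ˣ) w v v' s
  obtain ⟨P, N, p, n, w, w', ⟨f⟩, hP, hN, rfl, rfl⟩ := hX
  obtain ⟨e⟩ := tensor_biprod Y P N
  have h1 := (key hP hY).biprod (key hN hY)
  have h2 := h1.of_iso (biprod.mapIso (β_ P Y) (β_ N Y) ≪≫ e.symm ≪≫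
    whiskerLeftIso Y f.symm ≪≫ β_ Y X)
  convert h2 using 1
  · push_cast
    ring
  · have h3 {A : Type _} [AddCommGroup A] (w w' ε : A) :
        b • (w + -w') + ((p : ℤ) - n) • ε =
          (b • (1 : ℤ) • w + ((1 : ℤ) * p) • ε) + (b • (-1 : ℤ) • w' + ((-1 : ℤ) * n) • ε) := by
      module
    exact h3 (A := Additive (Skeleton C)ˣ) w w' ε

/-- Any two decompositions have isomorphic positive parts and isomorphic negative parts, and the
class of a signed object is unique. -/
theorem HasDetClass.unique {a b : ℤ} {δ ε : (Skeleton C)ˣ} {X : C} (h : HasDetClass K a δ X)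
    (h' : HasDetClass K b ε X) : a = b ∧ δ = ε := by
  obtain ⟨P, N, p, n, w, w', ⟨f⟩, hP, hN, rfl, rfl⟩ := h
  obtain ⟨P', N', p', n', v, v', ⟨f'⟩, hP', hN', rfl, rfl⟩ := h'
  obtain ⟨e⟩ := iso_of_biprod_iso (s := 1) (f.symm ≪≫ f') hP.signed.1 hN.signed.1 hP'.signed.1
    hN'.signed.1
  -- Exchanging the two summands of each decomposition compares the negative parts.
  obtain ⟨e'⟩ := iso_of_biprod_iso (s := -1)
    (biprod.braiding N P ≪≫ f.symm ≪≫ f' ≪≫ biprod.braiding P' N') hN.signed.1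
    (by rw [neg_neg]; exact hP.signed.1) hN'.signed.1 (by rw [neg_neg]; exact hP'.signed.1)
  obtain ⟨rfl, rfl⟩ := (hP.of_iso e).unique hP'
  obtain ⟨rfl, rfl⟩ := (hN.of_iso e').unique hN'
  exact ⟨rfl, rfl⟩

theorem HasDetClass.chi_eq {a : ℤ} {δ : (Skeleton C)ˣ} {X : C} (h : HasDetClass K a δ X) :
    chi K X = a := by
  obtain ⟨P, N, p, n, w, w', ⟨f⟩, hP, hN, rfl, rfl⟩ := h
  rw [chi_iso f, chi_biprod, hP.signed.2, hN.signed.2]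
  push_cast
  ring

/-- A finite sum of images of orthogonal idempotents. -/
theorem hasDetClass_of_sum {Z : C} {p : ℕ → (Z ⟶ Z)}
    (hp : ∀ i j, p i ≫ p j = if i = j then p i else 0) {a : ℕ → ℤ} {δ : ℕ → (Skeleton C)ˣ}
    (m : ℕ) (h : ∀ i < m, ∀ Y, IsIm (p i) Y → HasDetClass K (a i) (δ i) Y) :
    ∀ W, IsIm (∑ i ∈ Finset.range m, p i) W →
      HasDetClass K (∑ i ∈ Finset.range m, a i) (∏ i ∈ Finset.range m, δ i) W := by
  induction m with
  | zero =>
    intro W hW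
    rw [Finset.sum_range_zero] at hW
    exact hasDetClass_of_isZero (hW.isZero_iff.2 rfl)
  | succ m ih =>
    intro W hW
    rw [Finset.sum_range_succ] at hW ⊢
    rw [Finset.prod_range_succ]
    have h1 : (∑ i ∈ Finset.range m, p i) ≫ p m = 0 := by
      rw [Preadditive.sum_comp]
      exact Finset.sum_eq_zero fun i hi => by rw [hp, if_neg (Finset.mem_range.1 hi).ne]
    have h2 : p m ≫ (∑ i ∈ Finset.range m, p i) = 0 := by
      rw [Preadditive.comp_sum]
      exact Finset.sum_eq_zero fun i hi => by rw [hp, if_neg (Finset.mem_range.1 hi).ne']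
    have h3 : (∑ i ∈ Finset.range m, p i) ≫ (∑ i ∈ Finset.range m, p i) =
        ∑ i ∈ Finset.range m, p i := by
      rw [Preadditive.sum_comp]
      refine Finset.sum_congr rfl fun i hi => ?_
      simp_rw [Preadditive.comp_sum, hp, Finset.sum_ite_eq, if_pos hi]
    obtain ⟨V, hV⟩ := exists_isIm _ h3
    obtain ⟨Y, hY⟩ := exists_isIm (p m) ((hp m m).trans (if_pos rfl))
    obtain ⟨e⟩ := IsIm.iso_biprod hV hY h1 h2 hW
    exact ((ih (fun i hi => h i (Nat.lt_succ_of_lt hi)) V hV).biprod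
      (h m (Nat.lt_succ_self m) Y hY)).of_iso e.symm

/-- The power of `P ⊞ N` splits into products of powers of `P` and of `N`, whose classes are known.
`powDim_add` sums the dimensions and `powExp_add` the exponents; this is why the formula depends
only on `p - q`. -/
theorem HasDetClass.alt {a : ℤ} {δ : (Skeleton C)ˣ} {X F : C} (h : HasDetClass K a δ X) (t : ℤˣ)
    (n : ℕ) (hF : IsIm (TensorDet.alt K t X n) F) :
    HasDetClass K (powDim t n a) (δ ^ powExp t n a) F := by
  obtain ⟨P, N, p, q, w, w', ⟨f⟩, hP, hN, rfl, rfl⟩ := h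
  have hE := splitting_biprodProj P N
  have key {s : ℤˣ} {d : ℕ} {P : C} {w : (Skeleton C)ˣ} (hP : DetClass K s d w P) (i : ℕ) (F : C)
      (hF : IsIm (TensorDet.alt K t P i) F) : HasDetClass K (powDim t i (s * d))
        ((w ^ (s : ℤ)) ^ powExp t i (s * d)) F := by
    obtain ⟨D, w', h1, h2, h3⟩ := hP.alt hF
    rw [← h2, ← h3]
    exact h1.hasDetClass
  have h1 := hasDetClass_of_sum (K := K) (a := fun i => powDim t i p * powDim t (n - i) (-q))
    (δ := fun i => (w ^ powExp t i p) ^ powDim t (n - i) (-q) *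
      (w'⁻¹ ^ powExp t (n - i) (-q)) ^ powDim t i p)
    (hE.alt_wordSum_comp (K := K) t n) (n + 1) (fun i hi Y hY => by
      obtain ⟨A, hA⟩ := exists_isIm _ (alt_idem K t P i)
      obtain ⟨B, hB⟩ := exists_isIm _ (alt_idem K t N (n - i))
      obtain ⟨e⟩ := isIm_alt_biprod hA hB (by omega) hY
      have h1 := key hP i A hA
      have h2 := key hN (n - i) B hB
      rw [Units.val_one, one_mul, zpow_one] at h1
      rw [Units.val_neg, Units.val_one, neg_one_mul, zpow_neg_one] at h2
      exact (h1.tensor h2).of_iso e.symm) F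
    (by rw [hE.sum_alt_wordSum]; exact hF.alt_of_iso f)
  convert h1 using 1
  · rw [sub_eq_add_neg, powDim_add, Finset.Nat.sum_antidiagonal_eq_sum_range_succ
      (fun i j => powDim t i p * powDim t j (-q))]
  -- The exponents of `w` and of `w'⁻¹` are collected separately. Both equal `powExp t n (p - q)`,
  -- the second after reversing the antidiagonal.
  · have h2 {A : Type _} [AddCommGroup A] (w w' : A) (f f' g g' : ℕ → ℤ) (S : Finset ℕ) :
        ∑ i ∈ S, (g i • f i • w + g' i • f' i • w') =
          (∑ i ∈ S, f i * g i) • w + (∑ i ∈ S, f' i * g' i) • w' := by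
      rw [Finset.sum_add_distrib, Finset.sum_smul, Finset.sum_smul]
      simp_rw [mul_comm (f _), mul_comm (f' _), mul_smul]
    have h3 := h2 (A := Additive (Skeleton C)ˣ) w (w'⁻¹ : (Skeleton C)ˣ) (fun i => powExp t i p)
      (fun i => powExp t (n - i) (-q)) (fun i => powDim t (n - i) (-q)) (fun i => powDim t i p)
      (Finset.range (n + 1))
    have h4 := Finset.Nat.sum_antidiagonal_eq_sum_range_succ
      (fun i j => powExp t i p * powDim t j (-q)) n
    have h5 := Finset.Nat.sum_antidiagonal_eq_sum_range_succ
      (fun i j => powExp t j (-q) * powDim t i p) n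
    have h6 : ∑ ij ∈ Finset.HasAntidiagonal.antidiagonal n, powExp t ij.2 (-q) * powDim t ij.1 p =
        powExp t n (p + -q) := by
      rw [add_comm, powExp_add, ← Finset.Nat.sum_antidiagonal_swap]
      rfl
    rw [← powExp_add] at h4
    rw [h6] at h5
    rw [← h4, ← h5] at h3
    rw [sub_eq_add_neg, mul_zpow]
    exact h3.symm

end VirtualDet

/-! ### Chosen decompositions and the statement -/

section Decompositions

variable {K : Type*} [Field K] [CharZero K]
variable {C : Type u} [Category.{v} C] [Preadditive C] [HasZeroObject C] [HasBinaryBiproducts C]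
  [IsIdempotentComplete C] [Linear K C] [MonoidalCategory C] [SymmetricCategory C]
  [MonoidalPreadditive C] [MonoidalLinear K C] [RigidCategory C]

theorem isIm_extPow (M : C) (n : ℕ) : IsIm (alt K 1 M n) (extPow K M n) := by
  rw [alt_one]
  exact isIm_idemImage _ _

theorem isIm_symPow (M : C) (n : ℕ) : IsIm (alt K (-1) M n) (symPow K M n) := by
  rw [alt_neg_one]
  exact isIm_idemImage _ _

variable [hK : Fact (Function.Bijective (algebraMap K (End (𝟙_ C))))]

theorem IsPositive.exists_signed {M : C} (h : IsPositive K M) : ∃ d, Signed K 1 d M := by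
  obtain ⟨N, -, hN⟩ := h
  exact TensorDet.exists_signed 1 ((isIm_extPow M N).isZero_iff.1 hN)

theorem IsNegative.exists_signed {M : C} (h : IsNegative K M) : ∃ d, Signed K (-1) d M := by
  obtain ⟨N, -, hN⟩ := h
  exact TensorDet.exists_signed (-1) ((isIm_symPow M N).isZero_iff.1 hN)

theorem Signed.isPositive {M : C} {d : ℕ} (h : Signed K 1 d M) : IsPositive K M :=
  ⟨d + 1, d.succ_pos, (isIm_extPow M _).isZero_iff.2 h.1⟩

theorem Signed.isNegative {M : C} {d : ℕ} (h : Signed K (-1) d M) : IsNegative K M :=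
  ⟨d + 1, d.succ_pos, (isIm_symPow M _).isZero_iff.2 h.1⟩

/-- In characteristic zero at most one natural number represents `x`, so the value picked by
`Classical.epsilon` is `n`. -/
theorem natValue_eq {x : End (𝟙_ C)} {n : ℕ} (h : x = (n : K) • (1 : End (𝟙_ C))) :
    natValue x = n := by
  have h1 (n : ℕ) : (n : End (𝟙_ C)) = (n : K) • (1 : End (𝟙_ C)) := by
    rw [Nat.cast_smul_eq_nsmul, nsmul_one]
  have h2 : x = (natValue x : End (𝟙_ C)) :=
    Classical.epsilon_spec (p := fun n : ℕ => x = (n : End (𝟙_ C))) ⟨n, h.trans (h1 n).symm⟩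
  have h3 := smul_id_unit_injective (K := K) (((h1 _).symm.trans h2.symm).trans h)
  exact_mod_cast h3

theorem SignDecomposition.hasDetClass {M : C} (d : SignDecomposition K M) :
    ∃ a δ, HasDetClass K a δ M ∧ (δ : Skeleton C) = toSkeleton d.det := by
  obtain ⟨p, hp⟩ := d.isPositive.exists_signed
  obtain ⟨n, hn⟩ := d.isNegative.exists_signed
  obtain ⟨w, hw⟩ := hp.exists_detClass
  obtain ⟨w', hw'⟩ := hn.exists_detClass
  refine ⟨p - n, w * w'⁻¹, ⟨d.pos, d.neg, p, n, w, w', ⟨d.iso⟩, hw, hw', rfl, rfl⟩, ?_⟩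
  have h1 : natValue (eulerChar d.pos) = p := by
    refine natValue_eq (K := K) ?_
    rw [← chi_smul_id (K := K), hp.2, Units.val_one, Int.cast_one, one_mul]
    rfl
  have h2 : natValue (-eulerChar d.neg) = n := by
    refine natValue_eq (K := K) ?_
    rw [← chi_smul_id (K := K), hn.2, ← neg_smul]
    simp
  rw [SignDecomposition.det, h1, h2, Skeleton.toSkeleton_tensorObj,
    toSkeleton_dual (hw'.det _ (isIm_symPow d.neg n)),
    ← hw.det _ (isIm_extPow d.pos p), Units.val_mul]

/-- Each decomposition computes a class of `Z`, and all of these agree by `HasDetClass.unique`.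
Equal classes in the skeleton mean isomorphic objects. -/
theorem HasDetClass.hasDet {a : ℤ} {δ : (Skeleton C)ˣ} {Z D : C} (h : HasDetClass K a δ Z)
    (hD : (δ : Skeleton C) = toSkeleton D) : HasDet K Z D := by
  refine ⟨?_, fun d => ?_⟩
  · obtain ⟨P, N, p, n, w, w', ⟨f⟩, hP, hN, -⟩ := h
    exact ⟨⟨P, N, f, hP.signed.isPositive, hN.signed.isNegative⟩⟩
  · obtain ⟨a', δ', h', hδ'⟩ := d.hasDetClass
    obtain ⟨-, rfl⟩ := h.unique h'
    exact toSkeleton_eq_toSkeleton_iff.1 (hδ'.symm.trans hD)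

theorem HasDetClass.eulerChar_eq {a : ℤ} {δ : (Skeleton C)ˣ} {Z : C} (h : HasDetClass K a δ Z) :
    eulerChar Z = (a : End (𝟙_ C)) := by
  rw [← chi_smul_id (K := K), h.chi_eq, Int.cast_smul_eq_zsmul, ← zsmul_one]
  rfl

end Decompositions

end TensorDet

end

theorem mainTheorem5 {K : Type*} [Field K] [CharZero K]
    {C : Type*} [Category C] [Preadditive C] [HasZeroObject C] [HasBinaryBiproducts C]
    [IsIdempotentComplete C] [Linear K C] [MonoidalCategory C] [SymmetricCategory C] [MonoidalPreadditive C]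
    [MonoidalLinear K C] [RigidCategory C]
    (hK : Function.Bijective (algebraMap K (End (𝟙_ C))))
    (M N : C) (dM : TensorDet.SignDecomposition K M) (dN : TensorDet.SignDecomposition K N) :
    ∃ a b : ℤ, TensorDet.eulerChar M = (a : End (𝟙_ C)) ∧
      TensorDet.eulerChar N = (b : End (𝟙_ C)) ∧
      -- the determinants of `M` and `N` are well-defined and invertible
      TensorDet.HasDet K M dM.det ∧ TensorDet.IsTensorInvertible dM.det ∧
      TensorDet.HasDet K N dN.det ∧ TensorDet.IsTensorInvertible dN.det ∧
      -- direct sums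
      TensorDet.HasDet K (M ⊞ N) (dM.det ⊗ dN.det) ∧
      -- tensor products
      TensorDet.HasDet K (M ⊗ N)
        (TensorDet.tensorZPow dM.det b ⊗ TensorDet.tensorZPow dN.det a) ∧
      -- exterior powers; if `a = 0`, then `r` is the value at `0` of the polynomial
      -- `n * choose X n / X`
      (∀ n : ℕ, ∃ r : ℤ, r * a = n * Ring.choose a n ∧
        (a = 0 → r = if n = 0 then 0 else (-1) ^ (n - 1)) ∧
        TensorDet.HasDet K (TensorDet.extPow K M n) (TensorDet.tensorZPow dM.det r)) ∧
      -- symmetric powers; if `a = 0`, then `s` is the value at `0` of the polynomial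
      -- `n * choose (X + n - 1) n / X`
      (∀ n : ℕ, ∃ s : ℤ, s * a = n * Ring.choose (a + n - 1) n ∧
        (a = 0 → s = if n = 0 then 0 else 1) ∧
        TensorDet.HasDet K (TensorDet.symPow K M n) (TensorDet.tensorZPow dM.det s)) := by
  have : Fact (Function.Bijective (algebraMap K (End (𝟙_ C)))) := ⟨hK⟩
  obtain ⟨a, δ, hM, hδ⟩ := dM.hasDetClass
  obtain ⟨b, ε, hN, hε⟩ := dN.hasDetClass
  -- For `n ≥ 1` the exponents are `choose (a - 1) (n - 1)` and, after removing the signs, `choose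
  -- (a + n - 1) (n - 1)`. These are the polynomial quotients, so `a = 0` needs no separate
  -- treatment of the determinants.
  refine ⟨a, b, hM.eulerChar_eq, hN.eulerChar_eq, hM.hasDet hδ, TensorDet.exists_iso_of_unit hδ,
    hN.hasDet hε, TensorDet.exists_iso_of_unit hε, (hM.biprod hN).hasDet ?_,
    (hM.tensor hN).hasDet ?_, fun n => ⟨TensorDet.powExp 1 n a, ?_, ?_, ?_⟩,
    fun n => ⟨TensorDet.powExp (-1) n a, ?_, ?_, ?_⟩⟩
  · rw [Skeleton.toSkeleton_tensorObj, ← hδ, ← hε, Units.val_mul]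
  · rw [Skeleton.toSkeleton_tensorObj, TensorDet.toSkeleton_tensorZPow hδ,
      TensorDet.toSkeleton_tensorZPow hε, Units.val_mul]
  · rw [TensorDet.powExp_mul, TensorDet.powDim_one]
  · rintro rfl
    exact TensorDet.powExp_one_zero n
  · exact (hM.alt 1 n (TensorDet.isIm_extPow M n)).hasDet
      (TensorDet.toSkeleton_tensorZPow hδ _).symm
  · rw [TensorDet.powExp_mul, TensorDet.powDim_neg_one]
  · rintro rfl
    exact TensorDet.powExp_neg_one_zero n
  · exact (hM.alt (-1) n (TensorDet.isIm_symPow M n)).hasDet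
      (TensorDet.toSkeleton_tensorZPow hδ _).symm
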